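/- Let $(\Omega,\mathcal F,(\mathcal F_t)_{t\ge 0},\mathbb P)$ be a filtered probability space carrying an $\mathcal F_t$-Brownian motion $W$, let $T>0$ and $a\in L^\infty(0,T)$. Let $z$ be a (measurable) $\mathcal F_t$-adapted process satisfying (H1) for some $p\ge 2$: $z(t)\in L^p(\Omega,\mathbb P)$ for all $t\in[0,T]$ and $\int_0^T \mathbb E[|z(t)|^p]^{2/p}\,dt<\infty$. For $u\in L^1(0,T)$ let $\xi_u$ be the (unique, square integrable, continuous) strong solution of $$d\xi_u(t)=[a(t)\xi_u(t)+z(t)-u(t)]\,dt+\xi_u(t)\,dW(t),\quad t\in[0,T],\qquad \xi_u(0)=0 ,$$ and set $J[u]=\mathbb E\left[\int_0^T F(t,\xi_u(t))\,dt\right]$, where $F:[0,T]\times\mathbb R\to\mathbb R$ is measurable in its first variable and satisfies (H2) $F\ge 0$; (H3) $F(t,\cdot)$ is twice continuously differentiable for all $t\in[0,T]$, and $\partial_\xi F$, $\partial^2_\xi F$ are continuous on $[0,T]\times\mathbb R$; (H4) there are $\alpha\in(0,p)$ and $0\le L\in L^1(0,T)$ with $|F(t,\xi)|+|\partial_\xi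 F(t,\xi)|+|\partial_\xi^2F(t,\xi)|\le L(t)(1+|\xi|^\alpha)$ for all $t\in[0,T]$, $\xi\in\mathbb R$; (H5) $F(t,\cdot)$ is convex for every $t\in[0,T]$. A Young function is a function $\Psi(t)=\int_0^t\psi(s)\,ds$, $t\ge0$, where $\psi:[0,\infty)\to[0,\infty)$ is non-decreasing and right-continuous, $\psi(0)=0$, $\psi(s)>0$ for $s>0$ and $\psi(s)\to\infty$ as $s\to\infty$; $\Psi\in\Delta_2$ means that $\Psi(2t)\le k\Psi(t)$ for all $t\ge 0$ and some $k>0$. Let $\Psi_1,\Psi_2\in\Delta_2$ be Young functions and let $C,\delta_0>0$. For every $\delta\in(0,\delta_0)$ let $\bar u_{\delta,\Psi_1}\in L^1(0,T)$ be a global minimizer over $L^1(0,T)$ of $$J_{\delta,\Psi_1}[u]=J[u]+\delta\int_0^T\Psi_1(|u(t)|)\,dt ,$$ and assume that $\int_0^T\Psi_2(|\bar u_{\delta,\Psi_1}(t)|)\,dt\le C$ for all $\delta\in(0,\delta_0)$. Then: 1. There is $\bar u\in L^1(0,T)$ with $J[\bar u]=\inf_{u\in L^1(0,T)}J[u]<\infty$.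 2. Every sequence $\delta_n\to0$, $\delta_n>0$, has a subsequence $(\delta_{n_k})_k$ such that $\bar u_{\delta_{n_k},\Psi_1}\rightharpoonup\bar u$ weakly in $L^1(0,T)$ for some global minimizer $\bar u$ of $J$ over $L^1(0,T)$. 3. If moreover (H5+): $F(t,\cdot)$ is strictly convex for every $t\in[0,T]$, then the global minimizer $\bar u$ of $J$ is unique, and $\bar u_{\delta,\Psi_1}\rightharpoonup\bar u$ weakly in $L^1(0,T)$ as $\delta\to0^+$. -/

import Mathlib

open MeasureTheory ProbabilityTheory Filter Set
open scoped NNReal ENNReal Topology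

noncomputable section

namespace LinearSDE

/-- Lebesgue measure on `(0,T)`. -/
abbrev timeMeasure (T : ℝ) : Measure ℝ := volume.restrict (Ioo 0 T)

/-- The Banach space `L¹(0,T)` of (classes of) real functions. -/
abbrev L1 (T : ℝ) : Type := Lp ℝ 1 (timeMeasure T)

section Processes

variable {Ω : Type*} [mΩ : MeasurableSpace Ω]

/-- `W` is a standard real Brownian motion with respect to the filtration `𝓕`. -/
structure IsFilteredBrownian (𝓕 : Filtration ℝ≥0 mΩ) (P : Measure Ω) (W : ℝ≥0 → Ω → ℝ) :
    Prop where
  brownian : IsBrownianReal W P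
  adapted : ∀ t, Measurable[𝓕 t] (W t)
  indep_increments : ∀ s t, s ≤ t →
    Indep (MeasurableSpace.comap (fun ω => W t ω - W s ω) inferInstance) (𝓕 s) P

/-- The space `𝓛²_p(Ω,P;[0,T])`: jointly measurable adapted processes, defined on `[0,T]`, with
`z(t) ∈ L^p(Ω)` for every `t ∈ [0,T]` and `∫₀ᵀ E[|z(t)|^p]^{2/p} dt < ∞`. Measurability and
adaptedness are required up to null sets, since the filtration need not be complete. -/
structure MemL2p (𝓕 : Filtration ℝ≥0 mΩ) (P : Measure Ω) (T p : ℝ) (z : ℝ → Ω → ℝ) : Prop where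
  measurable : AEStronglyMeasurable (fun q : ℝ × Ω => z q.1 q.2) ((timeMeasure T).prod P)
  adapted : ∀ t ∈ Icc 0 T, AEStronglyMeasurable[𝓕 t.toNNReal] (z t) P
  memLp : ∀ t ∈ Icc 0 T, MemLp (z t) (ENNReal.ofReal p) P
  norm_lt_top : ∫⁻ t in Ioo 0 T, eLpNorm (z t) (ENNReal.ofReal p) P ^ 2 < ⊤

/-- Simple adapted processes `∑_{i<N} c_i 1_{(t_i,t_{i+1}]}`, where `t_0 ≤ ⋯ ≤ t_N` and `c_i` is
bounded and `𝓕_{t_i}`-measurable. -/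
structure SimpleAdapted (𝓕 : Filtration ℝ≥0 mΩ) where
  N : ℕ
  time : ℕ → ℝ≥0
  mono : Monotone time
  coeff : ℕ → Ω → ℝ
  measurable : ∀ i, Measurable[𝓕 (time i)] (coeff i)
  bounded : ∀ i, ∃ K : ℝ, ∀ ω, |coeff i ω| ≤ K

/-- Value at time `t` of a simple adapted process. -/
def SimpleAdapted.value {𝓕 : Filtration ℝ≥0 mΩ} (S : SimpleAdapted 𝓕) (t : ℝ) (ω : Ω) : ℝ :=
  ∑ i ∈ Finset.range S.N,
    (Ioc (S.time i : ℝ) (S.time (i + 1) : ℝ)).indicator (fun _ => S.coeff i ω) t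

/-- The elementary stochastic integral `∫₀ᵗ S dW = ∑ c_i (W(t_{i+1} ∧ t) - W(t_i ∧ t))`. -/
def SimpleAdapted.integral {𝓕 : Filtration ℝ≥0 mΩ} (S : SimpleAdapted 𝓕) (W : ℝ≥0 → Ω → ℝ)
    (t : ℝ) (ω : Ω) : ℝ :=
  ∑ i ∈ Finset.range S.N,
    S.coeff i ω * (W (min (S.time (i + 1)) t.toNNReal) ω - W (min (S.time i) t.toNNReal) ω)

/-- `I` is (a version of) the Itô integral `I(t) = ∫₀ᵗ H dW`, `t ∈ [0,T]`: some simple adapted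
processes converge to `H` in `L²((0,T) × Ω)` and their elementary integrals over `[0,t]` converge
to `I(t)` in `L²(Ω)`, for every `t ∈ [0,T]`. -/
def IsItoIntegral (𝓕 : Filtration ℝ≥0 mΩ) (P : Measure Ω) (W : ℝ≥0 → Ω → ℝ) (T : ℝ)
    (H I : ℝ → Ω → ℝ) : Prop :=
  ∃ S : ℕ → SimpleAdapted 𝓕,
    Tendsto (fun n => eLpNorm (fun q : ℝ × Ω => H q.1 q.2 - (S n).value q.1 q.2) 2
      ((timeMeasure T).prod P)) atTop (𝓝 0) ∧
    ∀ t ∈ Icc 0 T,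
      AEStronglyMeasurable (I t) P ∧
      Tendsto (fun n => eLpNorm (fun ω => I t ω - (S n).integral W t ω) 2 P) atTop (𝓝 0)

/-- `X` is a strong solution on `[0,T]`, in `𝓛²_2(Ω,P;[0,T])` and with almost surely continuous
paths, of `dX(t) = [a(t) X(t) + f(t)] dt + X(t) dW(t)`, `X(0) = X₀`. -/
structure IsSolution (𝓕 : Filtration ℝ≥0 mΩ) (P : Measure Ω) (W : ℝ≥0 → Ω → ℝ) (T : ℝ)
    (a : ℝ → ℝ) (X₀ : Ω → ℝ) (f X : ℝ → Ω → ℝ) : Prop where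
  mem : MemL2p 𝓕 P T 2 X
  cont : ∀ᵐ ω ∂P, ContinuousOn (fun t => X t ω) (Icc 0 T)
  integrable_drift : ∀ᵐ ω ∂P, Integrable (fun s => a s * X s ω + f s ω) (timeMeasure T)
  equation : ∃ I : ℝ → Ω → ℝ, IsItoIntegral 𝓕 P W T X I ∧
    ∀ t ∈ Icc 0 T, ∀ᵐ ω ∂P,
      X t ω = X₀ ω + (∫ s in (0 : ℝ)..t, (a s * X s ω + f s ω)) + I t ω

open Classical in
/-- The solution map `f ↦ 𝓢_{X₀} f`. Solutions are unique up to indistinguishability, so one of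
them is chosen; the value `0` is only used when there is no solution. -/
def solutionMap (𝓕 : Filtration ℝ≥0 mΩ) (P : Measure Ω) (W : ℝ≥0 → Ω → ℝ) (T : ℝ)
    (a : ℝ → ℝ) (X₀ : Ω → ℝ) (f : ℝ → Ω → ℝ) : ℝ → Ω → ℝ :=
  if h : ∃ X, IsSolution 𝓕 P W T a X₀ f X then h.choose else 0

/-- The gap process `ξ_u = 𝓢₀(z - u)`. -/
def gap (𝓕 : Filtration ℝ≥0 mΩ) (P : Measure Ω) (W : ℝ≥0 → Ω → ℝ) (T : ℝ)
    (a : ℝ → ℝ) (z : ℝ → Ω → ℝ) (u : L1 T) : ℝ → Ω → ℝ :=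
  solutionMap 𝓕 P W T a 0 (fun t ω => z t ω - u t)

/-- The cost functional `J[u] = E[∫₀ᵀ F(t, ξ_u(t)) dt]`, for `F ≥ 0`, with values in `[0,∞]`. -/
def cost (𝓕 : Filtration ℝ≥0 mΩ) (P : Measure Ω) (W : ℝ≥0 → Ω → ℝ) (T : ℝ)
    (a : ℝ → ℝ) (z : ℝ → Ω → ℝ) (F : ℝ → ℝ → ℝ) (u : L1 T) : ℝ≥0∞ :=
  ∫⁻ ω, (∫⁻ t in Ioo 0 T, ENNReal.ofReal (F t (gap 𝓕 P W T a z u t ω))) ∂P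

end Processes

/-- (H2): `F(t,ξ) ≥ 0`. -/
def HypH2 (T : ℝ) (F : ℝ → ℝ → ℝ) : Prop :=
  ∀ t ∈ Icc 0 T, ∀ ξ, 0 ≤ F t ξ

/-- (H3): `F` is `C²` in `ξ`, and both `ξ`-derivatives are continuous in `(t,ξ)`; moreover `F` is
measurable in `t`. -/
structure HypH3 (T : ℝ) (F : ℝ → ℝ → ℝ) : Prop where
  contDiff : ∀ t ∈ Icc 0 T, ContDiff ℝ 2 (F t)
  cont_deriv : ContinuousOn (fun q : ℝ × ℝ => deriv (F q.1) q.2) (Icc 0 T ×ˢ univ)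
  cont_deriv2 : ContinuousOn (fun q : ℝ × ℝ => deriv (deriv (F q.1)) q.2) (Icc 0 T ×ˢ univ)
  measurable : ∀ ξ, AEMeasurable (fun t => F t ξ) (timeMeasure T)

/-- (H4): growth of order `α < p` of `F` and of its two `ξ`-derivatives. -/
def HypH4 (T p : ℝ) (F : ℝ → ℝ → ℝ) : Prop :=
  ∃ α ∈ Ioo 0 p, ∃ L : ℝ → ℝ, Integrable L (timeMeasure T) ∧ (∀ t ∈ Icc 0 T, 0 ≤ L t) ∧
    ∀ t ∈ Icc 0 T, ∀ ξ,
      |F t ξ| + |deriv (F t) ξ| + |deriv (deriv (F t)) ξ| ≤ L t * (1 + |ξ| ^ α)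

/-- (H5): convexity of `F(t,·)`. -/
def HypH5 (T : ℝ) (F : ℝ → ℝ → ℝ) : Prop :=
  ∀ t ∈ Icc 0 T, ConvexOn ℝ univ (F t)

/-- (H5+): strict convexity of `F(t,·)`. -/
def HypH5plus (T : ℝ) (F : ℝ → ℝ → ℝ) : Prop :=
  ∀ t ∈ Icc 0 T, StrictConvexOn ℝ univ (F t)

/-- Young functions; only the values of `Ψ` on `[0,∞)` matter. -/
def IsYoung (Ψ : ℝ → ℝ) : Prop :=
  ∃ ψ : ℝ → ℝ, (∀ t, 0 ≤ t → Ψ t = ∫ s in (0 : ℝ)..t, ψ s) ∧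
    ψ 0 = 0 ∧ (∀ s, 0 < s → 0 < ψ s) ∧ (∀ s, 0 ≤ s → ContinuousWithinAt ψ (Ici s) s) ∧
    MonotoneOn ψ (Ici 0) ∧ Tendsto ψ atTop atTop

/-- The condition `Ψ ∈ Δ₂`. -/
def Delta2 (Ψ : ℝ → ℝ) : Prop :=
  ∃ k > 0, ∀ t, 0 ≤ t → Ψ (2 * t) ≤ k * Ψ t

/-- The modular `𝓕_Ψ[u] = ∫₀ᵀ Ψ(|u(t)|) dt`, with values in `[0,∞]`. -/
def modular (T : ℝ) (Ψ : ℝ → ℝ) (u : L1 T) : ℝ≥0∞ :=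
  ∫⁻ t in Ioo 0 T, ENNReal.ofReal (Ψ |u t|)

/-- `u` is a global minimizer over `L¹(0,T)` of the penalized functional
`J_{δ,Ψ} = J + δ 𝓕_Ψ`. -/
def IsPenalizedMinimizer (T : ℝ) (J : L1 T → ℝ≥0∞) (δ : ℝ) (Ψ : ℝ → ℝ) (u : L1 T) : Prop :=
  ∀ v : L1 T, J u + ENNReal.ofReal δ * modular T Ψ u ≤ J v + ENNReal.ofReal δ * modular T Ψ v

end LinearSDE

end

/-!
The proof separates a deterministic minimization argument from the stochastic analysis that verifies
its hypotheses.

*Minimization.* Let `J` be a finite, convex, lower semicontinuous functional on `L¹(0,T)` for which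
bounded controls are dense in energy. A bound on the modular `∫ Ψ₂(|u|)` makes the minimizers of the
penalized functionals uniformly integrable, since `Ψ₂` grows faster than linearly. Weak sequential
compactness is proved without the Dunford–Pettis theorem: the truncations of the sequence are
bounded in the Hilbert space `L²(0,T)` and approximate it in `L¹` uniformly, and a diagonal sequence
along which all truncations converge weakly does the rest (`exists_subseq_tendsto_weak`). A weak
limit `ū` minimizes `J`: for bounded `w` the penalty `δ ∫ Ψ₁(|w|)` vanishes with `δ`, and convexity
makes `J` weakly lower semicontinuous, so `J ū ≤ J w`; bounded controls suffice by density. Under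
strict convexity the minimizer is unique, and convergence of subsequences upgrades to convergence.
This is `penalized_minimizers_converge`.

*The state equation.* With `A` a primitive of the drift coefficient and `B` a version of the
Brownian motion with continuous paths, the solution is given by variation of constants,
`X(t) = ∫₀ᵗ exp(A(t) - A(s) + B(t) - B(s) - (t - s)/2) f(s) ds` (`linSol`). No Itô formula is used.
The identity `∫₀ᵗ X dW = X(t) - ∫₀ᵗ g`, for `g = a X + f`, is checked along the Euler scheme
(`isItoIntegral_linSol`): the one-step errors consist of the orthogonal martingale terms
`X(s) (exp(ΔB - Δt/2) - 1 - ΔB)`, of second order in `L²`, and of terms controlled by the integral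
of `g`. Uniqueness follows from the Itô isometry and Grönwall's inequality (`IsSolution.ae_eq`), so
the solution map picks this process. Its `L^p` norms are estimated by Minkowski's integral
inequality and the independence of the kernel over `[s,t]` from the past of `s`.

*The cost.* The explicit formula shows that the state is affine in the control, depends on it
continuously in `L¹(0,T)` path by path, and determines it. Hence the cost is convex, lower
semicontinuous by Fatou's lemma, finite by the growth condition, continuous along truncations by
dominated convergence, and strictly convex if the integrand is (`gapCost_convex`, `gapCost_lsc`,
`gapCost_lt_top`, `exists_bounded_gapCost_lt`, `gapCost_strict`).
-/

namespace LinearSDE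

/-! ### Weak sequential compactness -/

theorem tendsto_toWeakSpace_iff {ι E : Type*} [NormedAddCommGroup E] [NormedSpace ℝ E]
    {l : Filter ι} {x : ι → E} {y : E} :
    Tendsto (fun n => toWeakSpace ℝ E (x n)) l (𝓝 (toWeakSpace ℝ E y)) ↔
      ∀ f : StrongDual ℝ E, Tendsto (fun n => f (x n)) l (𝓝 (f y)) := by
  have hinj : Function.Injective (topDualPairing ℝ E).flip := by
    intro a b hab
    refine SeparatingDual.eq_iff_forall_dual_eq (R := ℝ) |>.2 fun g => ?_
    exact DFunLike.congr_fun hab g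
  exact WeakBilin.tendsto_iff_forall_eval_tendsto (B := (topDualPairing ℝ E).flip) hinj

/-- If, up to an arbitrarily small error, a sequence is contained in the image of a ball of a
separable Hilbert space, then it has a weakly convergent subsequence: a diagonal sequence is
chosen along which all the Hilbert space approximations converge weakly. -/
theorem exists_subseq_tendsto_weak {H E : Type*} [NormedAddCommGroup H] [InnerProductSpace ℝ H]
    [CompleteSpace H] [TopologicalSpace.SeparableSpace H] [NormedAddCommGroup E] [NormedSpace ℝ E]
    [CompleteSpace E] (ι : H →L[ℝ] E) (x : ℕ → E)
    (h : ∀ ε > 0, ∃ R : ℝ, ∀ n, ∃ y : H, ‖y‖ ≤ R ∧ ‖x n - ι y‖ ≤ ε) :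
    ∃ φ : ℕ → ℕ, StrictMono φ ∧ ∃ v : E,
      Tendsto (fun n => toWeakSpace ℝ E (x (φ n))) atTop (𝓝 (toWeakSpace ℝ E v)) := by
  have hε : ∀ k : ℕ, (0 : ℝ) < 1 / ((k : ℝ) + 1) := fun k => Nat.one_div_pos_of_nat
  choose R hR using fun k : ℕ => h _ (hε k)
  choose y hy hxy using hR
  let K : ℕ → Set (WeakDual ℝ H) := fun k =>
    WeakDual.toStrongDual ⁻¹' Metric.closedBall (0 : StrongDual ℝ H) (R k)
  have hKc : ∀ k, IsCompact (K k) := fun k => WeakDual.isCompact_closedBall _ _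
  have : ∀ k, CompactSpace (K k) := fun k => isCompact_iff_compactSpace.1 (hKc k)
  have : ∀ k, TopologicalSpace.MetrizableSpace (K k) :=
    fun k => WeakDual.metrizable_of_isCompact ℝ H _ (hKc k)
  -- all approximation levels at once: a sequence in a countable product of compact
  -- metrizable spaces
  let Y : ℕ → (∀ k, K k) := fun n k =>
    ⟨StrongDual.toWeakDual (InnerProductSpace.toDual ℝ H (y k n)), by
      simp only [K, mem_preimage, mem_closedBall_zero_iff]
      simpa using hy k n⟩
  obtain ⟨w, φ, hφ, hw⟩ := SeqCompactSpace.tendsto_subseq Y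
  refine ⟨φ, hφ, ?_⟩
  have hw' : ∀ k, ∀ a : H, Tendsto (fun n => inner ℝ (y k (φ n)) a) atTop
      (𝓝 ((w k : WeakDual ℝ H) a)) := by
    intro k a
    have h1 := (tendsto_pi_nhds.1 hw k)
    have h2 := ((continuous_subtype_val.tendsto _).comp h1)
    have h3 := ((WeakDual.eval_continuous a).tendsto _).comp h2
    refine h3.congr fun n => ?_
    simp [Y]
  let v : ℕ → H := fun k =>
    (InnerProductSpace.toDual ℝ H).symm (WeakDual.toStrongDual (w k : WeakDual ℝ H))
  have hv : ∀ k, ∀ g : StrongDual ℝ H, Tendsto (fun n => g (y k (φ n))) atTop (𝓝 (g (v k))) := by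
    intro k g
    have := hw' k ((InnerProductSpace.toDual ℝ H).symm g)
    have e1 : ∀ b : H, g b = inner ℝ b ((InnerProductSpace.toDual ℝ H).symm g) := by
      intro b
      rw [real_inner_comm, InnerProductSpace.toDual_symm_apply]
    simp only [e1]
    convert this using 2
    simp only [v]
    rw [InnerProductSpace.toDual_symm_apply]
    rfl
  have hιv : ∀ k, ∀ g : StrongDual ℝ E,
      Tendsto (fun n => g (ι (y k (φ n)))) atTop (𝓝 (g (ι (v k)))) := fun k g => hv k (g.comp ι)
  have hdist : ∀ k l, ‖ι (v k) - ι (v l)‖ ≤ 1 / ((k : ℝ) + 1) + 1 / ((l : ℝ) + 1) := by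
    intro k l
    obtain ⟨g, hg1, hg2⟩ := exists_dual_vector'' ℝ (ι (v k) - ι (v l))
    have h1 : Tendsto (fun n => g (ι (y k (φ n)) - ι (y l (φ n)))) atTop
        (𝓝 (g (ι (v k) - ι (v l)))) := by
      simp only [map_sub g]
      exact (hιv k g).sub (hιv l g)
    have h2 : g (ι (v k) - ι (v l)) = ‖ι (v k) - ι (v l)‖ := by simpa using hg2
    rw [← h2]
    refine le_of_tendsto h1 (Eventually.of_forall fun n => ?_)
    calc g (ι (y k (φ n)) - ι (y l (φ n))) ≤ ‖g (ι (y k (φ n)) - ι (y l (φ n)))‖ := le_abs_self _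
      _ ≤ 1 * ‖ι (y k (φ n)) - ι (y l (φ n))‖ := g.le_of_opNorm_le hg1 _
      _ = ‖(x (φ n) - ι (y l (φ n))) - (x (φ n) - ι (y k (φ n)))‖ := by
          rw [one_mul]; congr 1; abel
      _ ≤ ‖x (φ n) - ι (y l (φ n))‖ + ‖x (φ n) - ι (y k (φ n))‖ := norm_sub_le _ _
      _ ≤ _ := by linarith [hxy k (φ n), hxy l (φ n)]
  have hcauchy : CauchySeq fun k => ι (v k) := by
    refine cauchySeq_of_le_tendsto_0 (fun N : ℕ => 1 / ((N : ℝ) + 1) + 1 / ((N : ℝ) + 1)) ?_ ?_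
    · intro k l N hk hl
      rw [dist_eq_norm]
      refine (hdist k l).trans ?_
      gcongr
    · simpa using tendsto_one_div_add_atTop_nhds_zero_nat.add
        (tendsto_one_div_add_atTop_nhds_zero_nat (𝕜 := ℝ))
  obtain ⟨V, hV⟩ := cauchySeq_tendsto_of_complete hcauchy
  refine ⟨V, tendsto_toWeakSpace_iff.2 fun g => ?_⟩
  rw [Metric.tendsto_atTop]
  intro ε hε'
  have hsmall : ∃ k : ℕ, ‖g‖ * (1 / ((k : ℝ) + 1)) < ε / 3 ∧ ‖g (ι (v k)) - g V‖ < ε / 3 := by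
    have a1 : Tendsto (fun k : ℕ => ‖g‖ * (1 / ((k : ℝ) + 1))) atTop (𝓝 0) := by
      simpa using (tendsto_one_div_add_atTop_nhds_zero_nat (𝕜 := ℝ)).const_mul ‖g‖
    have a2 : Tendsto (fun k => ‖g (ι (v k)) - g V‖) atTop (𝓝 0) :=
      tendsto_iff_norm_sub_tendsto_zero.1 ((g.continuous.tendsto _).comp hV)
    exact ((a1.eventually_lt_const (by positivity)).and
      (a2.eventually_lt_const (by positivity))).exists
  obtain ⟨k, hk1, hk2⟩ := hsmall
  obtain ⟨N, hN⟩ := (Metric.tendsto_atTop.1 (hιv k g)) (ε / 3) (by positivity)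
  refine ⟨N, fun n hn => ?_⟩
  have b1 := hN n hn
  rw [Real.dist_eq] at b1 ⊢
  have b2 : |g (x (φ n)) - g (ι (y k (φ n)))| < ε / 3 := by
    rw [← map_sub]
    refine lt_of_le_of_lt ((g.le_opNorm _).trans ?_) hk1
    gcongr
    exact hxy k (φ n)
  rw [Real.norm_eq_abs] at hk2
  rw [abs_lt] at *
  constructor <;> linarith [b1.1, b1.2, b2.1, b2.2, hk2.1, hk2.2]

/-! ### Young functions and uniform integrability -/

/-- Monotonicity on `[0,∞)`, from `ψ ≥ 0`. -/
theorem IsYoung.monotoneOn {Ψ : ℝ → ℝ} (h : IsYoung Ψ) : MonotoneOn Ψ (Ici 0) := by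
  obtain ⟨ψ, h1, h2, h3, -, h5, -⟩ := h
  intro s hs t ht hst
  have hint : ∀ a b : ℝ, 0 ≤ a → 0 ≤ b → IntervalIntegrable ψ volume a b := fun a b ha hb =>
    (h5.mono (fun x hx => (le_min ha hb).trans hx.1)).intervalIntegrable
  rw [h1 s hs, h1 t ht, ← intervalIntegral.integral_add_adjacent_intervals
    (hint 0 s le_rfl hs) (hint s t hs ht)]
  have : 0 ≤ ∫ r in s..t, ψ r := intervalIntegral.integral_nonneg hst fun r hr => by
    rcases (le_trans (mem_Ici.1 hs) hr.1).eq_or_lt with h0 | h0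
    · rw [← h0, h2]
    · exact (h3 r h0).le
  linarith

/-- Young functions grow faster than linearly. -/
theorem IsYoung.superlinear {Ψ : ℝ → ℝ} (h : IsYoung Ψ) (M : ℝ) :
    ∃ K : ℝ, 0 < K ∧ ∀ t, K ≤ t → M * t ≤ Ψ t := by
  obtain ⟨ψ, h1, h2, h3, -, h5, h6⟩ := h
  have hint : ∀ a b : ℝ, 0 ≤ a → 0 ≤ b → IntervalIntegrable ψ volume a b := fun a b ha hb =>
    (h5.mono (fun x hx => (le_min ha hb).trans hx.1)).intervalIntegrable
  have hnn : ∀ r, 0 ≤ r → 0 ≤ ψ r := fun r hr => by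
    rcases hr.eq_or_lt with h0 | h0
    · rw [← h0, h2]
    · exact (h3 r h0).le
  obtain ⟨K, hK⟩ := eventually_atTop.1 (h6.eventually_ge_atTop (2 * M))
  -- `ψ ≥ 2M` on `[t/2, t]`, which contributes at least `M t` to the integral
  refine ⟨2 * max K 1, by positivity, fun t ht => ?_⟩
  have hmax : max K 1 ≤ t / 2 := by linarith
  have ht1 : 1 ≤ t / 2 := (le_max_right _ _).trans hmax
  have ht0 : 0 ≤ t / 2 := by linarith
  rw [h1 t (by linarith), ← intervalIntegral.integral_add_adjacent_intervals
    (hint 0 (t / 2) le_rfl ht0) (hint (t / 2) t ht0 (by linarith))]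
  have i1 : 0 ≤ ∫ r in (0 : ℝ)..(t / 2), ψ r :=
    intervalIntegral.integral_nonneg ht0 fun r hr => hnn r hr.1
  have i2 : (∫ _ in (t / 2)..t, 2 * M) ≤ ∫ r in (t / 2)..t, ψ r := by
    refine intervalIntegral.integral_mono_on (by linarith) (by simp)
      (hint _ _ ht0 (by linarith)) fun r hr => ?_
    exact hK r ((le_max_left _ _).trans (hmax.trans hr.1))
  rw [intervalIntegral.integral_const, smul_eq_mul] at i2
  linarith

instance isFiniteMeasure_timeMeasure (T : ℝ) : IsFiniteMeasure (timeMeasure T) :=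
  ⟨by simp [timeMeasure]⟩

/-- The inclusion `L²(0,T) → L¹(0,T)`. -/
noncomputable def inclusionL2L1 (T : ℝ) : Lp ℝ 2 (timeMeasure T) →L[ℝ] L1 T :=
  LinearMap.mkContinuous
    { toFun := fun f => ((Lp.memLp f).mono_exponent one_le_two).toLp f
      map_add' := fun f g => by
        rw [← MemLp.toLp_add]
        exact MemLp.toLp_congr _ _ (Lp.coeFn_add f g)
      map_smul' := fun c f => by
        rw [RingHom.id_apply, ← MemLp.toLp_const_smul]
        exact MemLp.toLp_congr _ _ (Lp.coeFn_smul c f) }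
    (timeMeasure T univ ^ (1 / (1 : ℝ≥0∞).toReal - 1 / (2 : ℝ≥0∞).toReal)).toReal (by
      intro f
      simp only [LinearMap.coe_mk, AddHom.coe_mk, Lp.norm_toLp]
      rw [Lp.norm_def, ← ENNReal.toReal_mul, mul_comm]
      refine ENNReal.toReal_mono (ENNReal.mul_ne_top (Lp.eLpNorm_ne_top f) ?_)
        (eLpNorm_le_eLpNorm_mul_rpow_measure_univ one_le_two (Lp.aestronglyMeasurable f))
      refine ENNReal.rpow_ne_top_of_nonneg (by norm_num) (measure_ne_top _ _))

theorem coeFn_inclusionL2L1 (T : ℝ) (f : Lp ℝ 2 (timeMeasure T)) :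
    inclusionL2L1 T f =ᵐ[timeMeasure T] f :=
  MemLp.coeFn_toLp ((Lp.memLp f).mono_exponent one_le_two)

/-- The truncation `u 1_{|u| ≤ K}`. -/
noncomputable def truncate {T : ℝ} (K : ℝ) (u : L1 T) (t : ℝ) : ℝ := {s | |u s| ≤ K}.indicator u t

theorem measurable_truncate {T : ℝ} (K : ℝ) (u : L1 T) : Measurable (truncate K u) := by
  have hu : Measurable u := (Lp.stronglyMeasurable u).measurable
  exact hu.indicator (measurableSet_le hu.abs measurable_const)

theorem abs_truncate_le {T : ℝ} {K : ℝ} (hK : 0 ≤ K) (u : L1 T) (t : ℝ) : |truncate K u t| ≤ K := by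
  unfold truncate
  by_cases h : t ∈ {s | |u s| ≤ K}
  · rw [indicator_of_mem h]; exact h
  · rw [indicator_of_notMem h]; simpa using hK

theorem abs_truncate_le_abs {T : ℝ} {K : ℝ} (u : L1 T) (t : ℝ) : |truncate K u t| ≤ |u t| := by
  unfold truncate
  by_cases h : t ∈ {s | |u s| ≤ K}
  · rw [indicator_of_mem h]
  · rw [indicator_of_notMem h]; simp

theorem memLp_truncate {T K : ℝ} (hK : 0 ≤ K) (u : L1 T) (p : ℝ≥0∞) :
    MemLp (truncate K u) p (timeMeasure T) :=
  MemLp.of_bound (measurable_truncate K u).aestronglyMeasurable K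
    (Eventually.of_forall (abs_truncate_le hK u))

/-- A sequence with bounded modular is, up to a small error in `L¹`, bounded in `L²`, hence weakly
relatively compact in `L¹(0,T)` (the de la Vallée-Poussin and Dunford–Pettis criteria). -/
theorem exists_subseq_tendsto_weak_of_modular_le {T : ℝ} {Ψ : ℝ → ℝ}
    (hΨ : IsYoung Ψ) {C : ℝ} (hC : 0 < C) (u : ℕ → L1 T)
    (hu : ∀ n, modular T Ψ (u n) ≤ ENNReal.ofReal C) :
    ∃ φ : ℕ → ℕ, StrictMono φ ∧ ∃ v : L1 T,
      Tendsto (fun n => toWeakSpace ℝ (L1 T) (u (φ n))) atTop (𝓝 (toWeakSpace ℝ (L1 T) v)) := by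
  have : Fact ((1 : ℝ≥0∞) ≤ 2) := ⟨one_le_two⟩
  have : Fact ((2 : ℝ≥0∞) ≠ ⊤) := ⟨by simp⟩
  refine exists_subseq_tendsto_weak (inclusionL2L1 T) u fun ε hε => ?_
  -- beyond the level `K` the modular, at most `C`, controls `|u|` with the factor `ε / C`
  obtain ⟨K, hK, hKΨ⟩ := hΨ.superlinear (C / ε)
  refine ⟨((timeMeasure T).real univ) ^ ((2 : ℝ≥0∞).toReal)⁻¹ * K, fun n => ?_⟩
  refine ⟨(memLp_truncate hK.le (u n) 2).toLp _, ?_, ?_⟩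
  · refine Lp.norm_le_of_ae_bound hK.le ?_
    filter_upwards [MemLp.coeFn_toLp (memLp_truncate hK.le (u n) 2)] with t ht
    rw [ht]
    exact abs_truncate_le hK.le (u n) t
  · rw [Lp.norm_def]
    refine ENNReal.toReal_le_of_le_ofReal hε.le ?_
    rw [eLpNorm_one_eq_lintegral_enorm]
    have hMpos : 0 < C / ε := by positivity
    have key : ∀ᵐ t ∂timeMeasure T,
        ‖(u n - inclusionL2L1 T ((memLp_truncate hK.le (u n) 2).toLp _) : L1 T) t‖ₑ ≤
        ENNReal.ofReal (ε / C) * ENNReal.ofReal (Ψ |u n t|) := by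
      filter_upwards [Lp.coeFn_sub (u n)
        (inclusionL2L1 T ((memLp_truncate hK.le (u n) 2).toLp _)),
        coeFn_inclusionL2L1 T ((memLp_truncate hK.le (u n) 2).toLp _),
        MemLp.coeFn_toLp (memLp_truncate hK.le (u n) 2)] with t h1 h2 h3
      rw [h1, Pi.sub_apply, h2, h3]
      unfold truncate
      by_cases h : t ∈ {s | |u n s| ≤ K}
      · rw [indicator_of_mem h]; simp
      · rw [indicator_of_notMem h, sub_zero, ← ENNReal.ofReal_mul (by positivity),
          Real.enorm_eq_ofReal_abs]
        refine ENNReal.ofReal_le_ofReal ?_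
        have := hKΨ |u n t| (not_le.1 h).le
        calc |u n t| = ε / C * (C / ε * |u n t|) := by field_simp
          _ ≤ _ := by gcongr
    refine (lintegral_mono_ae key).trans ?_
    rw [lintegral_const_mul' _ _ ENNReal.ofReal_ne_top]
    refine (mul_le_mul_right (hu n) _).trans ?_
    rw [← ENNReal.ofReal_mul (by positivity)]
    refine ENNReal.ofReal_le_ofReal (le_of_eq ?_)
    field_simp

theorem modular_lt_top_of_bounded {T : ℝ} {Ψ : ℝ → ℝ} (hΨ : IsYoung Ψ) {K : ℝ} (v : L1 T)
    (hv : ∀ᵐ t ∂timeMeasure T, |v t| ≤ K) : modular T Ψ v < ⊤ := by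
  calc modular T Ψ v ≤ ∫⁻ _ in Ioo 0 T, ENNReal.ofReal (Ψ K) := by
        refine lintegral_mono_ae ?_
        filter_upwards [hv] with t ht
        exact ENNReal.ofReal_le_ofReal
          (hΨ.monotoneOn (mem_Ici.2 (abs_nonneg _)) (mem_Ici.2 ((abs_nonneg _).trans ht)) ht)
    _ < ⊤ := by
        rw [setLIntegral_const]
        exact ENNReal.mul_lt_top ENNReal.ofReal_lt_top (by simp)

/-! ### Minimizers of convex functionals with vanishing penalty -/

/-- A convex lower semicontinuous functional is weakly lower semicontinuous along sequences. -/
theorem le_of_tendsto_weak {T : ℝ} {J : L1 T → ℝ≥0∞}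
    (hconv : ∀ u v : L1 T, ∀ s t : ℝ, 0 ≤ s → 0 ≤ t → s + t = 1 →
      J (s • u + t • v) ≤ ENNReal.ofReal s * J u + ENNReal.ofReal t * J v)
    (hlsc : ∀ (u : ℕ → L1 T) (v : L1 T) (c : ℝ≥0∞), Tendsto u atTop (𝓝 v) → (∀ n, J (u n) ≤ c) →
      J v ≤ c)
    {u : ℕ → L1 T} {v : L1 T} {c : ℝ≥0∞}
    (huv : Tendsto (fun n => toWeakSpace ℝ (L1 T) (u n)) atTop (𝓝 (toWeakSpace ℝ (L1 T) v)))
    (hc : ∀ᶠ n in atTop, J (u n) ≤ c) : J v ≤ c := by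
  have hcv : Convex ℝ {w : L1 T | J w ≤ c} := by
    intro a ha b hb s t hs ht hst
    refine (hconv a b s t hs ht hst).trans ?_
    calc ENNReal.ofReal s * J a + ENNReal.ofReal t * J b
        ≤ ENNReal.ofReal s * c + ENNReal.ofReal t * c :=
          add_le_add (mul_le_mul_right ha _) (mul_le_mul_right hb _)
      _ = c := by rw [← add_mul, ← ENNReal.ofReal_add hs ht, hst]; simp
  have hcl : IsClosed {w : L1 T | J w ≤ c} :=
    IsSeqClosed.isClosed fun a b ha hab => hlsc a b c hab ha
  have h1 := hcv.toWeakSpace_closure (𝕜 := ℝ)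
  rw [hcl.closure_eq] at h1
  have h2 : toWeakSpace ℝ (L1 T) v ∈ closure (toWeakSpace ℝ (L1 T) '' {w : L1 T | J w ≤ c}) :=
    mem_closure_of_tendsto huv (hc.mono fun n hn => mem_image_of_mem _ hn)
  rw [← h1] at h2
  obtain ⟨w, hw, hwv⟩ := h2
  rwa [(toWeakSpace ℝ (L1 T)).injective hwv] at hw

/-- Weak limits of minimizers of the penalized functionals minimize the functional itself, if
bounded controls are dense in energy. -/
theorem isMinimizer_of_tendsto_weak {T : ℝ} {J : L1 T → ℝ≥0∞} {Ψ : ℝ → ℝ}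
    (hΨ : IsYoung Ψ)
    (hconv : ∀ u v : L1 T, ∀ s t : ℝ, 0 ≤ s → 0 ≤ t → s + t = 1 →
      J (s • u + t • v) ≤ ENNReal.ofReal s * J u + ENNReal.ofReal t * J v)
    (hlsc : ∀ (u : ℕ → L1 T) (v : L1 T) (c : ℝ≥0∞), Tendsto u atTop (𝓝 v) → (∀ n, J (u n) ≤ c) →
      J v ≤ c)
    (hdense : ∀ (v : L1 T) (c : ℝ≥0∞), J v < c → ∃ w : L1 T, J w < c ∧ ∃ K : ℝ,
      ∀ᵐ t ∂timeMeasure T, |w t| ≤ K)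
    {δ : ℕ → ℝ} (hδ : Tendsto δ atTop (𝓝 0)) {u : ℕ → L1 T}
    (hu : ∀ᶠ n in atTop, IsPenalizedMinimizer T J (δ n) Ψ (u n)) {v : L1 T}
    (huv : Tendsto (fun n => toWeakSpace ℝ (L1 T) (u n)) atTop (𝓝 (toWeakSpace ℝ (L1 T) v))) :
    J v = ⨅ w, J w := by
  refine le_antisymm (le_iInf fun w => le_of_forall_gt fun c hc => ?_) (iInf_le _ _)
  obtain ⟨c', hwc', hc'⟩ := exists_between hc
  obtain ⟨w', hw', K, hK⟩ := hdense w c' hwc'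
  refine lt_of_le_of_lt ?_ hc'
  refine le_of_tendsto_weak hconv hlsc huv ?_
  have h1 : Tendsto (fun n => J w' + ENNReal.ofReal (δ n) * modular T Ψ w') atTop
      (𝓝 (J w' + ENNReal.ofReal 0 * modular T Ψ w')) := by
    refine Tendsto.add tendsto_const_nhds (ENNReal.Tendsto.mul_const ?_
      (Or.inr (modular_lt_top_of_bounded hΨ w' hK).ne))
    exact (ENNReal.continuous_ofReal.tendsto 0).comp hδ
  rw [ENNReal.ofReal_zero, zero_mul, add_zero] at h1
  filter_upwards [h1.eventually_lt_const hw', hu] with n hn hun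
  exact (le_self_add.trans (hun w')).trans hn.le

/-- Existence of minimizers and weak convergence of penalized minimizers, for a finite convex lower
semicontinuous functional for which bounded controls are dense in energy. -/
theorem penalized_minimizers_converge {T : ℝ} {J : L1 T → ℝ≥0∞} {Ψ₁ Ψ₂ : ℝ → ℝ}
    (hΨ₁ : IsYoung Ψ₁) (hΨ₂ : IsYoung Ψ₂)
    (hfin : ∀ u, J u < ⊤)
    (hconv : ∀ u v : L1 T, ∀ s t : ℝ, 0 ≤ s → 0 ≤ t → s + t = 1 →
      J (s • u + t • v) ≤ ENNReal.ofReal s * J u + ENNReal.ofReal t * J v)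
    (hlsc : ∀ (u : ℕ → L1 T) (v : L1 T) (c : ℝ≥0∞), Tendsto u atTop (𝓝 v) → (∀ n, J (u n) ≤ c) →
      J v ≤ c)
    (hdense : ∀ (v : L1 T) (c : ℝ≥0∞), J v < c → ∃ w : L1 T, J w < c ∧ ∃ K : ℝ,
      ∀ᵐ t ∂timeMeasure T, |w t| ≤ K)
    {C δ₀ : ℝ} (hC : 0 < C) (hδ₀ : 0 < δ₀) {u : ℝ → L1 T}
    (hu : ∀ δ ∈ Ioo 0 δ₀, IsPenalizedMinimizer T J δ Ψ₁ (u δ))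
    (hbound : ∀ δ ∈ Ioo 0 δ₀, modular T Ψ₂ (u δ) ≤ ENNReal.ofReal C) {strict : Prop}
    (hstrict : strict → ∀ u v : L1 T, u ≠ v →
      J ((1 / 2 : ℝ) • u + (1 / 2 : ℝ) • v) < (J u + J v) / 2) :
    (∃ ū : L1 T, J ū = (⨅ v, J v) ∧ J ū < ⊤) ∧
    (∀ δ : ℕ → ℝ, (∀ n, 0 < δ n) → Tendsto δ atTop (𝓝 0) →
      ∃ φ : ℕ → ℕ, StrictMono φ ∧ ∃ ū : L1 T, J ū = (⨅ v, J v) ∧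
        Tendsto (fun n => toWeakSpace ℝ (L1 T) (u (δ (φ n)))) atTop
          (𝓝 (toWeakSpace ℝ (L1 T) ū))) ∧
    (strict →
      (∃! ū : L1 T, J ū = (⨅ v, J v)) ∧
      ∀ ū : L1 T, J ū = (⨅ v, J v) →
        Tendsto (fun δ => toWeakSpace ℝ (L1 T) (u δ)) (𝓝[>] 0)
          (𝓝 (toWeakSpace ℝ (L1 T) ū))) := by
  have hseq : ∀ δ : ℕ → ℝ, (∀ n, 0 < δ n) → Tendsto δ atTop (𝓝 0) →
      ∃ φ : ℕ → ℕ, StrictMono φ ∧ ∃ ū : L1 T, J ū = (⨅ v, J v) ∧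
        Tendsto (fun n => toWeakSpace ℝ (L1 T) (u (δ (φ n)))) atTop
          (𝓝 (toWeakSpace ℝ (L1 T) ū)) := by
    intro δ hδ hδ0
    obtain ⟨N, hN⟩ := eventually_atTop.1 (hδ0.eventually_lt_const hδ₀)
    have hmem : ∀ n, δ (n + N) ∈ Ioo 0 δ₀ := fun n => ⟨hδ _, hN _ (Nat.le_add_left _ _)⟩
    obtain ⟨φ, hφ, v, hv⟩ := exists_subseq_tendsto_weak_of_modular_le hΨ₂ hC
      (fun n => u (δ (n + N))) (fun n => hbound _ (hmem n))
    have hφ' : StrictMono fun n => φ n + N := fun a b hab => Nat.add_lt_add_right (hφ hab) N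
    refine ⟨fun n => φ n + N, hφ', v, ?_, hv⟩
    exact isMinimizer_of_tendsto_weak hΨ₁ hconv hlsc hdense (hδ0.comp hφ'.tendsto_atTop)
      (Eventually.of_forall fun n => hu _ (hmem _)) hv
  have hex : ∃ ū : L1 T, J ū = ⨅ v, J v := by
    obtain ⟨-, -, ū, hū, -⟩ := hseq (fun n => 1 / ((n : ℝ) + 1)) (fun n => Nat.one_div_pos_of_nat)
      tendsto_one_div_add_atTop_nhds_zero_nat
    exact ⟨ū, hū⟩
  refine ⟨hex.imp fun ū hū => ⟨hū, hfin ū⟩, hseq, fun hs => ?_⟩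
  have huniq : ∀ v w : L1 T, J v = (⨅ x, J x) → J w = (⨅ x, J x) → v = w := by
    intro v w hv hw
    by_contra hne
    have h1 := hstrict hs v w hne
    rw [hv, hw, ENNReal.add_div, ENNReal.add_halves] at h1
    exact absurd (iInf_le J _) (not_le.2 h1)
  refine ⟨hex.imp fun ū hū => ⟨hū, fun w hw => huniq w ū hw hū⟩, fun ū hū => ?_⟩
  refine tendsto_of_subseq_tendsto fun δ hδ => ?_
  have hδ0 : Tendsto δ atTop (𝓝 0) := hδ.mono_right nhdsWithin_le_nhds
  have hpos : ∀ᶠ n in atTop, 0 < δ n := hδ.eventually self_mem_nhdsWithin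
  obtain ⟨N, hN⟩ := eventually_atTop.1 hpos
  obtain ⟨φ, hφ, w, hw, hlim⟩ := hseq (fun n => δ (n + N)) (fun n => hN _ (Nat.le_add_left _ _))
    (hδ0.comp (tendsto_add_atTop_nat N))
  rw [huniq w ū hw hū] at hlim
  exact ⟨fun n => φ n + N, hlim⟩

/-! ### Exponential moments of Gaussian variables -/

theorem integral_exp_mul_gaussianReal (v : ℝ≥0) (c : ℝ) :
    ∫ x, Real.exp (c * x) ∂gaussianReal 0 v = Real.exp (v * c ^ 2 / 2) := by
  have := congrFun (mgf_id_gaussianReal (μ := 0) (v := v)) c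
  simpa [mgf] using this

theorem integrable_exp_gaussianReal (v : ℝ≥0) :
    Integrable (fun x => Real.exp x) (gaussianReal 0 v) := by
  simpa using integrable_exp_mul_gaussianReal (μ := 0) (v := v) 1

theorem integral_exp_gaussianReal (v : ℝ≥0) :
    ∫ x, Real.exp x ∂gaussianReal 0 v = Real.exp (v / 2) := by
  simpa using integral_exp_mul_gaussianReal v 1

/-- The first exponential moment is a derivative of the moment generating function. -/
theorem integral_id_mul_exp_gaussianReal (v : ℝ≥0) :
    Integrable (fun x => x * Real.exp x) (gaussianReal 0 v) ∧
    ∫ x, x * Real.exp x ∂gaussianReal 0 v = v * Real.exp (v / 2) := by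
  have h1 : (1 : ℝ) ∈ interior (integrableExpSet (fun x => x) (gaussianReal 0 v)) := by
    have : integrableExpSet (fun x : ℝ => x) (gaussianReal 0 v) = univ :=
      eq_univ_of_forall fun t => integrable_exp_mul_gaussianReal t
    rw [this]; simp
  refine ⟨?_, ?_⟩
  · simpa using integrable_pow_mul_exp_of_mem_interior_integrableExpSet h1 1
  · have h2 := deriv_mgf h1
    have h3 : mgf (fun x => x) (gaussianReal 0 v) = fun t => Real.exp (v * t ^ 2 / 2) := by
      have := mgf_id_gaussianReal (μ := 0) (v := v)
      simp only [zero_mul, zero_add] at this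
      exact this
    have h4 : HasDerivAt (fun t : ℝ => Real.exp (v * t ^ 2 / 2)) (Real.exp (v / 2) * v) 1 := by
      have : HasDerivAt (fun t : ℝ => (v : ℝ) * t ^ 2 / 2) (v : ℝ) 1 := by
        have := ((hasDerivAt_pow 2 (1 : ℝ)).const_mul (v : ℝ)).div_const 2
        norm_num at this
        exact this
      simpa using this.exp
    rw [h3, h4.deriv] at h2
    simp only [one_mul] at h2
    rw [← h2, mul_comm]

theorem eLpNorm_exp_gaussianReal (v : ℝ≥0) {p : ℝ} (hp : 1 ≤ p) :
    eLpNorm (fun x => Real.exp (x - v / 2)) (ENNReal.ofReal p) (gaussianReal 0 v) =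
      ENNReal.ofReal (Real.exp ((p - 1) * v / 2)) := by
  have hp0 : 0 < p := by linarith
  rw [eLpNorm_eq_lintegral_rpow_enorm_toReal (by simpa using hp0) ENNReal.ofReal_ne_top,
    ENNReal.toReal_ofReal hp0.le]
  have h1 : ∀ x : ℝ, ‖Real.exp (x - v / 2)‖ₑ ^ p =
      ENNReal.ofReal (Real.exp (-(p * v / 2)) * Real.exp (p * x)) := by
    intro x
    rw [Real.enorm_eq_ofReal (Real.exp_pos _).le, ENNReal.ofReal_rpow_of_pos (Real.exp_pos _),
      ← Real.exp_mul, ← Real.exp_add]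
    congr 2; ring
  simp_rw [h1]
  rw [← ofReal_integral_eq_lintegral_ofReal ((integrable_exp_mul_gaussianReal p).const_mul _)
    (Eventually.of_forall fun x => by positivity), integral_const_mul,
    integral_exp_mul_gaussianReal, ← Real.exp_add, ENNReal.ofReal_rpow_of_pos (Real.exp_pos _),
    ← Real.exp_mul]
  congr 2
  field_simp
  ring

theorem sq_eLpNorm_eq_lintegral {α : Type*} {mα : MeasurableSpace α} (ν : Measure α) (f : α → ℝ) :
    eLpNorm f 2 ν ^ 2 = ∫⁻ x, ‖f x‖ₑ ^ 2 ∂ν := by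
  have h := eLpNorm_nnreal_pow_eq_lintegral (p := 2) (f := f) (μ := ν) (by norm_num)
  have e : ((2 : ℝ≥0) : ℝ≥0∞) = 2 := rfl
  have e2 : ((2 : ℝ≥0) : ℝ) = ((2 : ℕ) : ℝ) := by norm_num
  simpa only [e, e2, ENNReal.rpow_natCast] using h

theorem sq_eLpNorm_two {Ω : Type*} {mΩ : MeasurableSpace Ω} {P : Measure Ω} {f : Ω → ℝ}
    (hf : MemLp f 2 P) : eLpNorm f 2 P ^ 2 = ENNReal.ofReal (∫ ω, f ω ^ 2 ∂P) := by
  rw [sq_eLpNorm_eq_lintegral, ofReal_integral_eq_lintegral_ofReal hf.integrable_sq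
    (Eventually.of_forall fun x => sq_nonneg _)]
  refine lintegral_congr fun ω => ?_
  rw [← ofReal_norm, ← ENNReal.ofReal_pow (norm_nonneg _), Real.norm_eq_abs, sq_abs]

theorem memLp_exp_gaussianReal (v : ℝ≥0) :
    MemLp (fun x => Real.exp (x - v / 2)) 2 (gaussianReal 0 v) := by
  refine ⟨by fun_prop, ?_⟩
  have := eLpNorm_exp_gaussianReal v (p := 2) (by norm_num)
  rw [show ENNReal.ofReal 2 = 2 by norm_num] at this
  rw [this]
  exact ENNReal.ofReal_lt_top

theorem sq_eLpNorm_exp_sub_one_gaussianReal (v : ℝ≥0) :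
    eLpNorm (fun x => Real.exp (x - v / 2) - 1) 2 (gaussianReal 0 v) ^ 2 =
      ENNReal.ofReal (Real.exp v - 1) := by
  have m1 : MemLp (fun x => Real.exp (x - v / 2) - 1) 2 (gaussianReal 0 v) :=
    (memLp_exp_gaussianReal v).sub (memLp_const 1)
  rw [sq_eLpNorm_two m1]
  congr 1
  have h : ∀ x : ℝ, (Real.exp (x - v / 2) - 1) ^ 2 =
      Real.exp (-v) * Real.exp (2 * x) - 2 * Real.exp (-(v / 2)) * Real.exp x + 1 := by
    intro x
    have e1 : Real.exp (x - v / 2) = Real.exp (-(v / 2)) * Real.exp x := by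
      rw [← Real.exp_add]; congr 1; ring
    have e2 : Real.exp (2 * x) = Real.exp x ^ 2 := by rw [← Real.exp_nat_mul]; simp
    have e3 : Real.exp (-v) = Real.exp (-(v / 2)) ^ 2 := by
      rw [← Real.exp_nat_mul]; congr 1; push_cast; ring
    rw [e1, e2, e3]; ring
  simp_rw [h]
  have i1 := (integrable_exp_mul_gaussianReal (μ := 0) (v := v) 2).const_mul (Real.exp (-v))
  have i2 := (integrable_exp_gaussianReal v).const_mul (2 * Real.exp (-(v / 2)))
  have i12 : Integrable (fun x => Real.exp (-v) * Real.exp (2 * x) -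
      2 * Real.exp (-(v / 2)) * Real.exp x) (gaussianReal 0 v) := i1.sub i2
  rw [integral_add i12 (integrable_const 1), integral_sub i1 i2, integral_const_mul,
    integral_const_mul, integral_exp_mul_gaussianReal, integral_exp_gaussianReal]
  rw [mul_assoc, ← Real.exp_add, ← Real.exp_add]
  simp only [integral_const, probReal_univ, smul_eq_mul, mul_one]
  rw [show -(v : ℝ) + v * 2 ^ 2 / 2 = v by ring, show -((v : ℝ) / 2) + v / 2 = 0 by ring,
    Real.exp_zero]
  ring

/-- The one-step error of the Euler scheme for `dE = E dB`, as a function of the increment. -/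
noncomputable def expDefect (v x : ℝ) : ℝ := Real.exp (x - v / 2) - 1 - x

theorem measurable_expDefect (v : ℝ) : Measurable (expDefect v) := by
  unfold expDefect; fun_prop

theorem memLp_expDefect (v : ℝ≥0) : MemLp (expDefect v) 2 (gaussianReal 0 v) :=
  ((memLp_exp_gaussianReal v).sub (memLp_const 1)).sub (memLp_id_gaussianReal 2)

theorem integral_expDefect (v : ℝ≥0) : ∫ x, expDefect v x ∂gaussianReal 0 v = 0 := by
  have i1 : Integrable (fun x => Real.exp (x - v / 2)) (gaussianReal 0 v) :=
    (memLp_exp_gaussianReal v).integrable one_le_two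
  have i2 : Integrable (fun x : ℝ => x) (gaussianReal 0 v) :=
    (memLp_id_gaussianReal 2).integrable one_le_two
  unfold expDefect
  have i12 : Integrable (fun x => Real.exp (x - v / 2) - 1) (gaussianReal 0 v) :=
    i1.sub (integrable_const 1)
  rw [integral_sub i12 i2, integral_sub i1 (integrable_const 1)]
  have : ∀ x : ℝ, Real.exp (x - v / 2) = Real.exp (-(v / 2)) * Real.exp x := by
    intro x; rw [← Real.exp_add]; congr 1; ring
  simp_rw [this]
  rw [integral_const_mul, integral_exp_gaussianReal, ← Real.exp_add]
  simp

/-- The one-step error is of second order. -/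
theorem sq_eLpNorm_expDefect (v : ℝ≥0) :
    eLpNorm (expDefect v) 2 (gaussianReal 0 v) ^ 2 = ENNReal.ofReal (Real.exp v - 1 - v) := by
  rw [sq_eLpNorm_two (memLp_expDefect v)]
  congr 1
  have h : ∀ x : ℝ, expDefect v x ^ 2 = (Real.exp (x - v / 2) - 1) ^ 2 + x ^ 2 -
      2 * Real.exp (-(v / 2)) * (x * Real.exp x) + 2 * x := by
    intro x
    have e1 : Real.exp (x - v / 2) = Real.exp (-(v / 2)) * Real.exp x := by
      rw [← Real.exp_add]; congr 1; ring
    unfold expDefect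
    rw [e1]; ring
  simp_rw [h]
  have m1 : MemLp (fun x => Real.exp (x - v / 2) - 1) 2 (gaussianReal 0 v) :=
    (memLp_exp_gaussianReal v).sub (memLp_const 1)
  have i1 := m1.integrable_sq
  have m2 : MemLp (fun x : ℝ => x) 2 (gaussianReal 0 v) := memLp_id_gaussianReal 2
  have i2 := m2.integrable_sq
  have i3 := (integral_id_mul_exp_gaussianReal v).1.const_mul (2 * Real.exp (-(v / 2)))
  have i4 : Integrable (fun x : ℝ => 2 * x) (gaussianReal 0 v) :=
    (m2.integrable one_le_two).const_mul 2
  have v1 : ∫ x, (Real.exp (x - v / 2) - 1) ^ 2 ∂gaussianReal 0 v = Real.exp v - 1 := by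
    have a := sq_eLpNorm_exp_sub_one_gaussianReal v
    rw [sq_eLpNorm_two m1] at a
    refine (ENNReal.ofReal_eq_ofReal_iff (integral_nonneg fun _ => sq_nonneg _) ?_).1 a
    have := Real.add_one_le_exp (v : ℝ)
    have := v.coe_nonneg
    linarith
  have v2 : ∫ x : ℝ, x ^ 2 ∂gaussianReal 0 v = v := by
    have a := variance_fun_id_gaussianReal (μ := 0) (v := v)
    rw [variance_eq_integral measurable_id'.aemeasurable] at a
    simpa using a
  have i12 : Integrable (fun x => (Real.exp (x - v / 2) - 1) ^ 2 + x ^ 2) (gaussianReal 0 v) :=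
    i1.add i2
  have i123 : Integrable (fun x => (Real.exp (x - v / 2) - 1) ^ 2 + x ^ 2 -
      2 * Real.exp (-(v / 2)) * (x * Real.exp x)) (gaussianReal 0 v) := i12.sub i3
  rw [integral_add i123 i4, integral_sub i12 i3, integral_add i1 i2, v1, v2,
    integral_const_mul, integral_const_mul, (integral_id_mul_exp_gaussianReal v).2,
    integral_id_gaussianReal]
  have : Real.exp (-((v : ℝ) / 2)) * Real.exp (v / 2) = 1 := by rw [← Real.exp_add]; simp
  linear_combination (-2 * (v : ℝ)) * this

/-! ### Minkowski's integral inequality -/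

/-- **Minkowski's integral inequality**. It follows from Hölder's inequality with respect to the
outer variable, with weight the inner `L^p` norm. -/
theorem lintegral_lintegral_rpow_le {α β : Type*} [MeasurableSpace α] [MeasurableSpace β]
    {μ : Measure α} {ν : Measure β} [SFinite μ] [SFinite ν] {g : α → β → ℝ≥0∞}
    (hg : Measurable (Function.uncurry g)) {p : ℝ} (hp : 1 ≤ p) :
    (∫⁻ b, (∫⁻ a, g a b ∂μ) ^ p ∂ν) ^ (1 / p) ≤
      ∫⁻ a, (∫⁻ b, g a b ^ p ∂ν) ^ (1 / p) ∂μ := by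
  have hp0 : 0 < p := by linarith
  have hgs : Measurable fun q : β × α => g q.2 q.1 := hg.comp measurable_swap
  rcases hp.eq_or_lt with rfl | hp1
  · simp only [ENNReal.rpow_one, div_one]
    rw [lintegral_lintegral_swap hgs.aemeasurable]
  set w : α → ℝ≥0∞ := fun a => (∫⁻ b, g a b ^ p ∂ν) ^ (1 / p) with hw
  have hwm : Measurable w :=
    (Measurable.lintegral_prod_right' (f := fun q : α × β => g q.1 q.2 ^ p)
      (hg.pow_const p)).pow_const _
  set V : ℝ≥0∞ := ∫⁻ a, w a ∂μ with hV
  rcases eq_or_ne V ⊤ with hVt | hVt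
  · rw [hVt]; exact le_top
  have hpq := Real.HolderConjugate.conjExponent hp1
  set q := Real.conjExponent p
  have hq0 : 0 < q := hpq.symm.pos
  have hwp : ∀ a, w a ^ p = ∫⁻ b, g a b ^ p ∂ν := by
    intro a
    rw [hw, ← ENNReal.rpow_mul, one_div_mul_cancel hp0.ne', ENNReal.rpow_one]
  -- the factorization `g = (g w^{-1/q}) w^{1/q}`, also where `w = 0` since then `g = 0`
  have hfac : ∀ᵐ a ∂μ, ∀ᵐ b ∂ν, g a b ≤ (g a b * w a ^ (-(1 / q))) * w a ^ (1 / q) := by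
    filter_upwards [ae_lt_top hwm hVt] with a ha
    rcases eq_or_ne (w a) 0 with h0 | h0
    · have h1 : ∫⁻ b, g a b ^ p ∂ν = 0 := by
        rw [← hwp, h0, ENNReal.zero_rpow_of_pos hp0]
      have h2 := (lintegral_eq_zero_iff ((hg.of_uncurry_left).pow_const p)).1 h1
      filter_upwards [h2] with b hb
      have : g a b = 0 := (ENNReal.rpow_eq_zero_iff_of_pos hp0).1 hb
      rw [this]; exact zero_le
    · refine Eventually.of_forall fun b => ?_
      rw [mul_assoc, ← ENNReal.rpow_add _ _ h0 ha.ne]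
      simp
  have hfac' : ∀ᵐ b ∂ν, ∀ᵐ a ∂μ, g a b ≤ (g a b * w a ^ (-(1 / q))) * w a ^ (1 / q) := by
    refine (Measure.ae_ae_comm (μ := μ) (ν := ν) ?_).1 hfac
    exact measurableSet_le hg ((hg.mul ((hwm.comp measurable_fst).pow_const _)).mul
      ((hwm.comp measurable_fst).pow_const _))
  have hold : ∀ᵐ b ∂ν, (∫⁻ a, g a b ∂μ) ^ p ≤
      (∫⁻ a, g a b ^ p * w a ^ (-(p / q)) ∂μ) * V ^ (p / q) := by
    filter_upwards [hfac'] with b hb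
    have h1 : ∫⁻ a, g a b ∂μ ≤
        (∫⁻ a, (g a b * w a ^ (-(1 / q))) ^ p ∂μ) ^ (1 / p) *
        (∫⁻ a, (w a ^ (1 / q)) ^ q ∂μ) ^ (1 / q) :=
      (lintegral_mono_ae hb).trans
        (ENNReal.lintegral_mul_le_Lp_mul_Lq μ hpq
          ((hg.of_uncurry_right).mul (hwm.pow_const _)).aemeasurable
          (hwm.pow_const _).aemeasurable)
    have h2 : ∀ a, (w a ^ (1 / q)) ^ q = w a := fun a => by
      rw [← ENNReal.rpow_mul, one_div_mul_cancel hq0.ne', ENNReal.rpow_one]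
    have h3 : ∀ a, (g a b * w a ^ (-(1 / q))) ^ p = g a b ^ p * w a ^ (-(p / q)) := fun a => by
      rw [ENNReal.mul_rpow_of_nonneg _ _ hp0.le, ← ENNReal.rpow_mul]
      congr 2; ring
    simp_rw [h2, h3] at h1
    calc (∫⁻ a, g a b ∂μ) ^ p ≤ ((∫⁻ a, g a b ^ p * w a ^ (-(p / q)) ∂μ) ^ (1 / p) *
          V ^ (1 / q)) ^ p := ENNReal.rpow_le_rpow h1 hp0.le
      _ = _ := by
        rw [ENNReal.mul_rpow_of_nonneg _ _ hp0.le, ← ENNReal.rpow_mul, ← ENNReal.rpow_mul,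
          one_div_mul_cancel hp0.ne', ENNReal.rpow_one]
        congr 2; ring
  have hpq1 : p / q = p - 1 := by
    have := hpq.sub_one_mul_conj
    field_simp
    linarith
  have hwle : ∀ a, w a ^ p * w a ^ (-(p / q)) ≤ w a := by
    intro a
    rcases eq_or_ne (w a) 0 with h0 | h0
    · rw [h0, ENNReal.zero_rpow_of_pos hp0, zero_mul]
    rcases eq_or_ne (w a) ⊤ with ht | ht
    · rw [ht]; exact le_top
    · rw [← ENNReal.rpow_add _ _ h0 ht, hpq1]
      simp
  have hmain : ∫⁻ b, (∫⁻ a, g a b ∂μ) ^ p ∂ν ≤ V ^ p := by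
    calc ∫⁻ b, (∫⁻ a, g a b ∂μ) ^ p ∂ν
        ≤ ∫⁻ b, (∫⁻ a, g a b ^ p * w a ^ (-(p / q)) ∂μ) * V ^ (p / q) ∂ν := lintegral_mono_ae hold
      _ = (∫⁻ b, ∫⁻ a, g a b ^ p * w a ^ (-(p / q)) ∂μ ∂ν) * V ^ (p / q) :=
          lintegral_mul_const' _ _ (ENNReal.rpow_ne_top_of_nonneg (by positivity) hVt)
      _ = (∫⁻ a, ∫⁻ b, g a b ^ p * w a ^ (-(p / q)) ∂ν ∂μ) * V ^ (p / q) := by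
          rw [lintegral_lintegral_swap]
          exact ((hgs.pow_const p).mul ((hwm.comp measurable_snd).pow_const _)).aemeasurable
      _ = (∫⁻ a, w a ^ p * w a ^ (-(p / q)) ∂μ) * V ^ (p / q) := by
          congr 1
          refine lintegral_congr fun a => ?_
          rw [lintegral_mul_const _ ((hg.of_uncurry_left).pow_const p), hwp]
      _ ≤ V * V ^ (p / q) := mul_le_mul_left (lintegral_mono hwle) _
      _ ≤ V ^ p := by
          rcases eq_or_ne V 0 with h0 | h0
          · rw [h0, zero_mul]; exact zero_le
          · nth_rewrite 1 [← ENNReal.rpow_one V]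
            rw [← ENNReal.rpow_add _ _ h0 hVt, hpq1]
            simp
  calc (∫⁻ b, (∫⁻ a, g a b ∂μ) ^ p ∂ν) ^ (1 / p) ≤ (V ^ p) ^ (1 / p) :=
        ENNReal.rpow_le_rpow hmain (by positivity)
    _ = V := by rw [← ENNReal.rpow_mul, mul_one_div_cancel hp0.ne', ENNReal.rpow_one]

section

variable {Ω : Type*} {mΩ : MeasurableSpace Ω} {P : Measure Ω}

theorem eLpNorm_ofReal {p : ℝ} (hp : 1 ≤ p) (f : Ω → ℝ) :
    eLpNorm f (ENNReal.ofReal p) P = (∫⁻ ω, ‖f ω‖ₑ ^ p ∂P) ^ (1 / p) := by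
  have hp0 : 0 < p := by linarith
  rw [eLpNorm_eq_lintegral_rpow_enorm_toReal (by simpa using hp0) ENNReal.ofReal_ne_top,
    ENNReal.toReal_ofReal hp0.le]

/-- Minkowski's inequality for Bochner integrals of real processes. -/
theorem eLpNorm_integral_le [SFinite P] {μ : Measure ℝ} [SFinite μ] {g : ℝ → Ω → ℝ}
    (hg : Measurable (Function.uncurry g)) {p : ℝ} (hp : 1 ≤ p) :
    eLpNorm (fun ω => ∫ q, g q ω ∂μ) (ENNReal.ofReal p) P ≤
      ∫⁻ q, eLpNorm (g q) (ENNReal.ofReal p) P ∂μ := by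
  have hp0 : 0 < p := by linarith
  simp_rw [eLpNorm_ofReal hp]
  refine le_trans ?_ (lintegral_lintegral_rpow_le (g := fun q ω => ‖g q ω‖ₑ) hg.enorm hp)
  gcongr with ω
  exact enorm_integral_le_lintegral_enorm _

theorem measurable_eLpNorm_left [SFinite P] {g : ℝ → Ω → ℝ}
    (hg : Measurable (Function.uncurry g)) {p : ℝ} (hp : 1 ≤ p) :
    Measurable fun q => eLpNorm (g q) (ENNReal.ofReal p) P := by
  simp_rw [eLpNorm_ofReal hp]
  exact (Measurable.lintegral_prod_right' (f := fun x : ℝ × Ω => ‖g x.1 x.2‖ₑ ^ p)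
      (hg.enorm.pow_const p)).pow_const _

/-! ### Independence and orthogonality -/

theorem eLpNorm_mul_of_indepFun {c d : Ω → ℝ} (h : IndepFun c d P)
    (hc : AEStronglyMeasurable c P) (hd : AEStronglyMeasurable d P) {p : ℝ} (hp : 1 ≤ p) :
    eLpNorm (fun ω => c ω * d ω) (ENNReal.ofReal p) P =
      eLpNorm c (ENNReal.ofReal p) P * eLpNorm d (ENNReal.ofReal p) P := by
  have hp0 : 0 < p := by linarith
  simp_rw [eLpNorm_ofReal hp]
  rw [← ENNReal.mul_rpow_of_nonneg _ _ (by positivity)]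
  congr 1
  have hm : Measurable fun x : ℝ => ‖x‖ₑ ^ p := (measurable_enorm).pow_const p
  have := lintegral_mul_eq_lintegral_mul_lintegral_of_indepFun''
    (hm.comp_aemeasurable hc.aemeasurable) (hm.comp_aemeasurable hd.aemeasurable)
    (h.comp hm hm)
  simp only [Function.comp_apply] at this
  rw [← this]
  refine lintegral_congr fun ω => ?_
  rw [enorm_mul, ENNReal.mul_rpow_of_nonneg _ _ hp0.le]

theorem eLpNorm_mul_of_indepFun_two {c d : Ω → ℝ} (h : IndepFun c d P)
    (hc : AEStronglyMeasurable c P) (hd : AEStronglyMeasurable d P) :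
    eLpNorm (fun ω => c ω * d ω) 2 P = eLpNorm c 2 P * eLpNorm d 2 P := by
  have := eLpNorm_mul_of_indepFun h hc hd (p := 2) (by norm_num)
  rwa [show ENNReal.ofReal 2 = 2 by norm_num] at this

theorem memLp_mul_of_indepFun {c d : Ω → ℝ} (h : IndepFun c d P)
    (hc : MemLp c 2 P) (hd : MemLp d 2 P) : MemLp (fun ω => c ω * d ω) 2 P := by
  refine ⟨hc.1.mul hd.1, ?_⟩
  rw [eLpNorm_mul_of_indepFun_two h hc.1 hd.1]
  exact ENNReal.mul_lt_top hc.2 hd.2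

theorem sq_eLpNorm_sum_of_orthogonal {ι : Type*} (s : Finset ι) (d : ι → Ω → ℝ)
    (hd : ∀ i ∈ s, MemLp (d i) 2 P)
    (ho : ∀ i ∈ s, ∀ j ∈ s, i ≠ j → ∫ ω, d i ω * d j ω ∂P = 0) :
    eLpNorm (fun ω => ∑ i ∈ s, d i ω) 2 P ^ 2 = ∑ i ∈ s, eLpNorm (d i) 2 P ^ 2 := by
  have hint : ∀ i ∈ s, ∀ j ∈ s, Integrable (fun ω => d i ω * d j ω) P :=
    fun i hi j hj => (hd i hi).integrable_mul (hd j hj)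
  rw [sq_eLpNorm_two (memLp_finsetSum s hd)]
  rw [Finset.sum_congr rfl fun i hi => sq_eLpNorm_two (hd i hi),
    ← ENNReal.ofReal_sum_of_nonneg fun i _ => integral_nonneg fun ω => sq_nonneg _]
  congr 1
  simp_rw [sq, Finset.sum_mul_sum]
  rw [integral_finsetSum _ fun i hi => integrable_finsetSum _ fun j hj => hint i hi j hj]
  refine Finset.sum_congr rfl fun i hi => ?_
  rw [integral_finsetSum _ fun j hj => hint i hi j hj]
  exact Finset.sum_eq_single_of_mem i hi fun j hj hji => ho i hi j hj hji.symm

end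

/-! ### Time integrals of adapted processes -/

/-- An integral of random variables measurable with respect to a σ-algebra `m` (up to null sets)
is again `m`-measurable up to null sets, without joint measurability for `m`: the difference from
the conditional expectation is orthogonal to its own sign. -/
theorem aestronglyMeasurable_integral_of_ae {Ω : Type*} {m mΩ : MeasurableSpace Ω}
    {P : Measure Ω} (hm : m ≤ mΩ)
    [IsFiniteMeasure P] {μ : Measure ℝ} [SFinite μ] {g : ℝ → Ω → ℝ}
    (hg : Integrable (Function.uncurry g) (μ.prod P))
    (had : ∀ᵐ q ∂μ, AEStronglyMeasurable[m] (g q) P) :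
    AEStronglyMeasurable[m] (fun ω => ∫ q, g q ω ∂μ) P := by
  set G : Ω → ℝ := fun ω => ∫ q, g q ω ∂μ with hG
  have hGi : Integrable G P := Integrable.integral_prod_right (f := Function.uncurry g) hg
  set h : Ω → ℝ := P[G | m] with hh
  have hhi : Integrable h P := integrable_condExp
  have hDi : Integrable (fun ω => G ω - h ω) P := hGi.sub hhi
  -- the sign of `G - h`, to be tested against `G - h` itself
  let φ : Ω → ℝ := fun ω => if 0 ≤ hDi.1.mk _ ω then 1 else -1
  have hφm : Measurable φ :=
    Measurable.ite (measurableSet_le measurable_const hDi.1.stronglyMeasurable_mk.measurable)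
      measurable_const measurable_const
  have hφb : ∀ ω, |φ ω| ≤ 1 := fun ω => by simp only [φ]; split_ifs <;> simp
  have hφi : Integrable φ P :=
    Integrable.of_bound hφm.aestronglyMeasurable 1 (Eventually.of_forall hφb)
  set ψ : Ω → ℝ := P[φ | m] with hψ
  have hψb : ∀ᵐ ω ∂P, |ψ ω| ≤ 1 :=
    ae_bdd_abs_condExp_of_ae_bdd_abs (R := (1 : ℝ)) (Eventually.of_forall hφb)
  have hψm : AEStronglyMeasurable[m] ψ P := stronglyMeasurable_condExp.aestronglyMeasurable
  have hψm' : AEStronglyMeasurable ψ P := hψm.mono hm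
  have mulφ : ∀ k : Ω → ℝ, Integrable k P → Integrable (fun ω => k ω * φ ω) P := fun k hk =>
    hk.mul_bdd (c := 1) hφm.aestronglyMeasurable (Eventually.of_forall hφb)
  have mulψ : ∀ k : Ω → ℝ, Integrable k P → Integrable (fun ω => k ω * ψ ω) P := fun k hk =>
    hk.mul_bdd (c := 1) hψm' hψb
  have C1 : ∀ k : Ω → ℝ, Integrable k P → AEStronglyMeasurable[m] k P →
      ∫ ω, k ω * φ ω ∂P = ∫ ω, k ω * ψ ω ∂P := by
    intro k hk hkm
    rw [← integral_condExp hm (f := fun ω => k ω * φ ω)]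
    exact integral_congr_ae (condExp_mul_of_aestronglyMeasurable_left hkm (mulφ k hk) hφi)
  have C2 : ∫ ω, G ω * ψ ω ∂P = ∫ ω, h ω * ψ ω ∂P := by
    rw [← integral_condExp hm (f := fun ω => G ω * ψ ω)]
    exact integral_congr_ae (condExp_mul_of_aestronglyMeasurable_right hψm (mulψ G hGi) hGi)
  have C3 : ∫ ω, G ω * φ ω ∂P = ∫ ω, G ω * ψ ω ∂P := by
    have e : ∀ χ : Ω → ℝ, AEStronglyMeasurable χ P → (∀ᵐ ω ∂P, |χ ω| ≤ 1) →
        ∫ ω, G ω * χ ω ∂P = ∫ q, ∫ ω, g q ω * χ ω ∂P ∂μ := by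
      intro χ hχ hχb
      have : Integrable (fun x : ℝ × Ω => g x.1 x.2 * χ x.2) (μ.prod P) := by
        refine Integrable.mul_bdd (c := 1) hg hχ.comp_snd ?_
        exact (Measure.quasiMeasurePreserving_snd (μ := μ) (ν := P)).ae hχb
      rw [integral_integral_swap this]
      exact integral_congr_ae (Eventually.of_forall fun ω => (integral_mul_const _ _).symm)
    rw [e φ hφm.aestronglyMeasurable (Eventually.of_forall hφb), e ψ hψm' hψb]
    refine integral_congr_ae ?_
    filter_upwards [had, hg.prod_right_ae] with q hq hqi
    exact C1 (g q) hqi hq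
  have C4 : ∫ ω, (G ω - h ω) * φ ω ∂P = 0 := by
    simp_rw [sub_mul]
    rw [integral_sub (mulφ G hGi) (mulφ h hhi), C3, C2,
      C1 h hhi stronglyMeasurable_condExp.aestronglyMeasurable, sub_self]
  have C5 : ∫ ω, |G ω - h ω| ∂P = 0 := by
    rw [← C4]
    refine integral_congr_ae ?_
    filter_upwards [hDi.1.ae_eq_mk] with ω hω
    simp only [φ]
    split_ifs with h0
    · rw [← hω] at h0; rw [abs_of_nonneg h0, mul_one]
    · rw [← hω] at h0; rw [abs_of_neg (not_le.1 h0), mul_neg_one]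
  have C6 := (integral_eq_zero_iff_of_nonneg (fun ω => abs_nonneg _) hDi.abs).1 C5
  have C7 : h =ᵐ[P] G := by
    filter_upwards [C6] with ω hω
    have : G ω - h ω = 0 := abs_eq_zero.1 hω
    linarith
  exact (stronglyMeasurable_condExp.aestronglyMeasurable).congr C7

/-! ### A continuous version of the Brownian motion, in real time -/

/-- `B` is a jointly measurable version of `W`, indexed by real times, all of whose paths are
continuous. It is adapted up to null sets only, since the filtration need not be complete. -/
structure IsContinuousVersion {Ω : Type*} [mΩ : MeasurableSpace Ω] (𝓕 : Filtration ℝ≥0 mΩ)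
    (P : Measure Ω) (W : ℝ≥0 → Ω → ℝ) (B : ℝ → Ω → ℝ) : Prop where
  cont : ∀ ω, Continuous fun t => B t ω
  meas : Measurable (Function.uncurry B)
  ae_eq : ∀ᵐ ω ∂P, ∀ t : ℝ≥0, W t ω = B t ω
  adapted : ∀ t, 0 ≤ t → AEStronglyMeasurable[𝓕 t.toNNReal] (B t) P
  indep : ∀ s t, 0 ≤ s → s ≤ t → ∀ c : Ω → ℝ, AEStronglyMeasurable[𝓕 s.toNNReal] c P →
    IndepFun c (fun ω => B t ω - B s ω) P
  law : ∀ s t, 0 ≤ s → s ≤ t →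
    HasLaw (fun ω => B t ω - B s ω) (gaussianReal 0 (t - s).toNNReal) P

variable {Ω : Type*} {mΩ : MeasurableSpace Ω} {𝓕 : Filtration ℝ≥0 mΩ} {P : Measure Ω}
  {W : ℝ≥0 → Ω → ℝ} {B : ℝ → Ω → ℝ}

/-- The paths of `W` are replaced by `0` on a measurable null set that contains every `ω` with a
discontinuous path. -/
theorem exists_isContinuousVersion (hW : IsFilteredBrownian 𝓕 P W) :
    ∃ B : ℝ → Ω → ℝ, IsContinuousVersion 𝓕 P W B := by
  classical
  set N : Set Ω := toMeasurable P {ω | ¬ Continuous (W · ω)} with hN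
  have hN0 : P N = 0 := by
    rw [hN, measure_toMeasurable]; exact hW.brownian.cont
  have hNm : MeasurableSet N := measurableSet_toMeasurable _ _
  have hNc : ∀ ω, ω ∉ N → Continuous (W · ω) := fun ω hω => by
    by_contra h
    exact hω (subset_toMeasurable _ _ h)
  have hae : ∀ᵐ ω ∂P, ω ∉ N := measure_eq_zero_iff_ae_notMem.1 hN0
  let B : ℝ → Ω → ℝ := fun t ω => if ω ∈ N then 0 else W t.toNNReal ω
  have hBW : ∀ t : ℝ, B t =ᵐ[P] W t.toNNReal := fun t => by
    filter_upwards [hae] with ω hω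
    simp [B, hω]
  have hcont : ∀ ω, Continuous fun t => B t ω := by
    intro ω
    by_cases hω : ω ∈ N
    · simp only [B, hω, if_true]; exact continuous_const
    · simp only [B, hω, if_false]
      exact (hNc ω hω).comp continuous_real_toNNReal
  have hinc : ∀ s t : ℝ, (fun ω => B t ω - B s ω) =ᵐ[P]
      fun ω => W t.toNNReal ω - W s.toNNReal ω := fun s t => by
    filter_upwards [hBW s, hBW t] with ω h1 h2
    rw [h1, h2]
  refine ⟨B, hcont, ?_, ?_, ?_, ?_, ?_⟩
  · refine measurable_uncurry_of_continuous_of_measurable hcont fun t => ?_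
    exact Measurable.ite hNm measurable_const ((hW.adapted _).mono (𝓕.le _) le_rfl)
  · filter_upwards [hae] with ω hω t
    simp [B, hω]
  · intro t _
    exact (hW.adapted _).stronglyMeasurable.aestronglyMeasurable.congr (hBW t).symm
  · intro s t hs hst c hc
    have h1 := hW.indep_increments s.toNNReal t.toNNReal (Real.toNNReal_le_toNNReal hst)
    have h2 : IndepFun (hc.mk c) (fun ω => W t.toNNReal ω - W s.toNNReal ω) P :=
      indep_of_indep_of_le_left h1.symm hc.stronglyMeasurable_mk.measurable.comap_le
    exact h2.congr hc.ae_eq_mk.symm (hinc s t).symm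
  · intro s t hs hst
    have h1 := hW.brownian.toIsPreBrownianReal.hasLaw_sub t.toNNReal s.toNNReal
    have h2 : nndist ((t.toNNReal : ℝ≥0) : ℝ) (s.toNNReal : ℝ) = (t - s).toNNReal := by
      rw [Real.coe_toNNReal _ hs, Real.coe_toNNReal _ (hs.trans hst)]
      apply NNReal.coe_injective
      rw [coe_nndist, Real.coe_toNNReal _ (by linarith), Real.dist_eq,
        abs_of_nonneg (by linarith)]
    have h3 := h1.congr (hinc s t)
    convert h3 using 2
    exact h2.symm

namespace IsContinuousVersion

theorem measurable_apply (hB : IsContinuousVersion 𝓕 P W B) (t : ℝ) : Measurable (B t) :=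
  hB.meas.of_uncurry_left

theorem eLpNorm_comp_increment (hB : IsContinuousVersion 𝓕 P W B) {s t : ℝ} (hs : 0 ≤ s)
    (hst : s ≤ t) {g : ℝ → ℝ} (hg : Measurable g) (p : ℝ≥0∞) :
    eLpNorm (fun ω => g (B t ω - B s ω)) p P =
      eLpNorm g p (gaussianReal 0 (t - s).toNNReal) := by
  have hl := hB.law s t hs hst
  rw [← hl.map_eq, eLpNorm_map_measure hg.aestronglyMeasurable hl.aemeasurable]
  rfl

theorem memLp_comp_increment (hB : IsContinuousVersion 𝓕 P W B) {s t : ℝ} (hs : 0 ≤ s)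
    (hst : s ≤ t) {g : ℝ → ℝ} (hg : Measurable g) {p : ℝ≥0∞}
    (h : MemLp g p (gaussianReal 0 (t - s).toNNReal)) :
    MemLp (fun ω => g (B t ω - B s ω)) p P := by
  refine ⟨(hg.comp ((hB.measurable_apply t).sub (hB.measurable_apply s))).aestronglyMeasurable, ?_⟩
  rw [hB.eLpNorm_comp_increment hs hst hg]
  exact h.2

theorem memLp_increment (hB : IsContinuousVersion 𝓕 P W B) {s t : ℝ} (hs : 0 ≤ s) (hst : s ≤ t) :
    MemLp (fun ω => B t ω - B s ω) 2 P :=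
  hB.memLp_comp_increment hs hst measurable_id (memLp_id_gaussianReal 2)

theorem integral_comp_increment (hB : IsContinuousVersion 𝓕 P W B) {s t : ℝ} (hs : 0 ≤ s)
    (hst : s ≤ t) {g : ℝ → ℝ} (hg : Measurable g) :
    ∫ ω, g (B t ω - B s ω) ∂P = ∫ x, g x ∂gaussianReal 0 (t - s).toNNReal :=
  (hB.law s t hs hst).integral_comp hg.aestronglyMeasurable

theorem integral_mul_comp_increment (hB : IsContinuousVersion 𝓕 P W B) {s t : ℝ} (hs : 0 ≤ s)
    (hst : s ≤ t) {g : ℝ → ℝ} (hg : Measurable g) {c : Ω → ℝ}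
    (hc : AEStronglyMeasurable[𝓕 s.toNNReal] c P) :
    ∫ ω, c ω * g (B t ω - B s ω) ∂P =
      (∫ ω, c ω ∂P) * ∫ x, g x ∂gaussianReal 0 (t - s).toNNReal := by
  rw [← hB.integral_comp_increment hs hst hg]
  exact ((hB.indep s t hs hst c hc).comp measurable_id hg).integral_fun_mul_eq_mul_integral
    (hc.mono (𝓕.le _))
    (hg.comp ((hB.measurable_apply t).sub (hB.measurable_apply s))).aestronglyMeasurable

theorem integral_mul_increment (hB : IsContinuousVersion 𝓕 P W B) {s t : ℝ} (hs : 0 ≤ s)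
    (hst : s ≤ t) {c : Ω → ℝ} (hc : AEStronglyMeasurable[𝓕 s.toNNReal] c P) :
    ∫ ω, c ω * (B t ω - B s ω) ∂P = 0 := by
  have := hB.integral_mul_comp_increment hs hst measurable_id hc
  simpa [integral_id_gaussianReal] using this

theorem integral_mul_sq_increment (hB : IsContinuousVersion 𝓕 P W B) {s t : ℝ} (hs : 0 ≤ s)
    (hst : s ≤ t) {c : Ω → ℝ} (hc : AEStronglyMeasurable[𝓕 s.toNNReal] c P) :
    ∫ ω, c ω * (B t ω - B s ω) ^ 2 ∂P = (∫ ω, c ω ∂P) * (t - s) := by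
  have e := hB.integral_mul_comp_increment hs hst (measurable_id.pow_const 2) hc
  simp only [id] at e
  rw [e]
  have a := variance_fun_id_gaussianReal (μ := 0) (v := (t - s).toNNReal)
  rw [variance_eq_integral measurable_id'.aemeasurable] at a
  have b : ∫ x : ℝ, x ^ 2 ∂gaussianReal 0 (t - s).toNNReal = t - s := by
    simpa [Real.coe_toNNReal _ (sub_nonneg.2 hst)] using a
  rw [b]

theorem adapted_of_le (hB : IsContinuousVersion 𝓕 P W B) {s t : ℝ} (hs : 0 ≤ s) (hst : s ≤ t) :
    AEStronglyMeasurable[𝓕 t.toNNReal] (B s) P :=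
  (hB.adapted s hs).mono (𝓕.mono (Real.toNNReal_le_toNNReal hst))

end IsContinuousVersion

/-! ### Itô isometry for elementary integrals -/

/-- A random weight on a time interval `(s,t]`, known at time `s` and bounded. -/
structure IsBlock (𝓕 : Filtration ℝ≥0 mΩ) (P : Measure Ω) (s t : ℝ) (c : Ω → ℝ) : Prop where
  nonneg : 0 ≤ s
  le : s ≤ t
  adapted : AEStronglyMeasurable[𝓕 s.toNNReal] c P
  bounded : ∃ K : ℝ, ∀ ω, |c ω| ≤ K

theorem IsBlock.memLp [IsFiniteMeasure P] {s t : ℝ} {c : Ω → ℝ} (h : IsBlock 𝓕 P s t c)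
    (p : ℝ≥0∞) : MemLp c p P := by
  obtain ⟨K, hK⟩ := h.bounded
  exact MemLp.of_bound (h.adapted.mono (𝓕.le _)) K (Eventually.of_forall hK)

theorem IsBlock.memLp_mul {s t : ℝ} {c d : Ω → ℝ} (h : IsBlock 𝓕 P s t c) {p : ℝ≥0∞}
    (hd : MemLp d p P) : MemLp (fun ω => c ω * d ω) p P := by
  obtain ⟨K, hK⟩ := h.bounded
  refine (hd.const_mul K).mono ((h.adapted.mono (𝓕.le _)).mul hd.1) (Eventually.of_forall fun ω => ?_)
  rw [norm_mul, norm_mul]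
  gcongr
  exact (hK ω).trans (le_abs_self K)

/-- Increments of the Brownian motion over two intervals, with weights known at the beginning of
each, are correlated through the overlap of the intervals only. -/
theorem integral_block_mul_block (hB : IsContinuousVersion 𝓕 P W B)
    {s t s' t' : ℝ} {c c' : Ω → ℝ} (h : IsBlock 𝓕 P s t c) (h' : IsBlock 𝓕 P s' t' c') :
    ∫ ω, (c ω * (B t ω - B s ω)) * (c' ω * (B t' ω - B s' ω)) ∂P =
      (∫ ω, c ω * c' ω ∂P) * max 0 (min t t' - max s s') := by
  -- with `s ≤ s'`, the increments are split at `s'` and at the smaller of the right end points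
  wlog hss : s ≤ s' generalizing s t s' t' c c'
  · have := this h' h (le_of_not_ge hss)
    rw [min_comm t, max_comm s]
    simp_rw [mul_comm (c _) (c' _)]
    rw [← this]
    exact integral_congr_ae (Eventually.of_forall fun ω => mul_comm _ _)
  have hs := h.nonneg
  have hs' := h'.nonneg
  have hc : AEStronglyMeasurable[𝓕 s'.toNNReal] c P :=
    h.adapted.mono (𝓕.mono (Real.toNNReal_le_toNNReal hss))
  have hk : AEStronglyMeasurable[𝓕 s'.toNNReal] (fun ω => c ω * c' ω) P := hc.mul h'.adapted
  have hint : ∀ a b a' b', 0 ≤ a → a ≤ b → 0 ≤ a' → a' ≤ b' →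
      Integrable (fun ω => (c ω * (B b ω - B a ω)) * (c' ω * (B b' ω - B a' ω))) P :=
    fun a b a' b' h1 h2 h3 h4 => (h.memLp_mul (hB.memLp_increment h1 h2)).integrable_mul
      (h'.memLp_mul (hB.memLp_increment h3 h4))
  rw [max_eq_right hss]
  rcases le_total t s' with hts | hts
  · have e : min t t' - s' ≤ 0 := by linarith [min_le_left t t']
    rw [max_eq_left e, mul_zero]
    have m : AEStronglyMeasurable[𝓕 s'.toNNReal]
        (fun ω => c ω * (B t ω - B s ω) * c' ω) P :=
      (hc.mul ((hB.adapted_of_le (hs.trans h.le) hts).sub (hB.adapted_of_le hs hss))).mul h'.adapted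
    rw [← hB.integral_mul_increment hs' h'.le m]
    exact integral_congr_ae (Eventually.of_forall fun ω => by ring)
  have z1 : ∀ r, s' ≤ r → ∫ ω, (c ω * (B s' ω - B s ω)) * (c' ω * (B r ω - B s' ω)) ∂P = 0 := by
    intro r hr
    have m : AEStronglyMeasurable[𝓕 s'.toNNReal]
        (fun ω => c ω * (B s' ω - B s ω) * c' ω) P :=
      (hc.mul ((hB.adapted_of_le hs' le_rfl).sub (hB.adapted_of_le hs hss))).mul h'.adapted
    rw [← hB.integral_mul_increment hs' hr m]
    exact integral_congr_ae (Eventually.of_forall fun ω => by ring)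
  have z2 : ∀ r, s' ≤ r → ∫ ω, (c ω * (B r ω - B s' ω)) * (c' ω * (B r ω - B s' ω)) ∂P =
      (∫ ω, c ω * c' ω ∂P) * (r - s') := by
    intro r hr
    rw [← hB.integral_mul_sq_increment hs' hr hk]
    exact integral_congr_ae (Eventually.of_forall fun ω => by ring)
  have z3 : ∀ r r', s' ≤ r → r ≤ r' →
      ∫ ω, (c ω * c' ω * (B r ω - B s' ω)) * (B r' ω - B r ω) ∂P = 0 := by
    intro r r' hr hr'
    refine hB.integral_mul_increment (hs'.trans hr) hr' ?_
    exact (hk.mono (𝓕.mono (Real.toNNReal_le_toNNReal hr))).mul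
      ((hB.adapted_of_le (hs'.trans hr) le_rfl).sub (hB.adapted_of_le hs' hr))
  rcases le_total t t' with htt | htt
  · rw [min_eq_left htt, max_eq_right (by linarith)]
    have e : ∀ ω, (c ω * (B t ω - B s ω)) * (c' ω * (B t' ω - B s' ω)) =
        (c ω * (B s' ω - B s ω)) * (c' ω * (B t' ω - B s' ω)) +
        (c ω * (B t ω - B s' ω)) * (c' ω * (B t ω - B s' ω)) +
        (c ω * (B t ω - B s' ω)) * (c' ω * (B t' ω - B t ω)) := fun ω => by ring
    simp_rw [e]
    have i1 := hint s s' s' t' hs hss hs' h'.le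
    have i2 := hint s' t s' t hs' hts hs' hts
    have i3 := hint s' t t t' hs' hts (hs'.trans hts) htt
    have e3 := z3 t t' hts htt
    have e3' : ∫ ω, (c ω * (B t ω - B s' ω)) * (c' ω * (B t' ω - B t ω)) ∂P = 0 := by
      rw [← e3]
      exact integral_congr_ae (Eventually.of_forall fun ω => by ring)
    rw [integral_add (by exact i1.add i2) i3, integral_add i1 i2, z1 _ h'.le, z2 _ hts, e3']
    ring
  · rw [min_eq_right htt, max_eq_right (by linarith [h'.le])]
    have e : ∀ ω, (c ω * (B t ω - B s ω)) * (c' ω * (B t' ω - B s' ω)) =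
        (c ω * (B s' ω - B s ω)) * (c' ω * (B t' ω - B s' ω)) +
        (c ω * (B t' ω - B s' ω)) * (c' ω * (B t' ω - B s' ω)) +
        (c ω * (B t ω - B t' ω)) * (c' ω * (B t' ω - B s' ω)) := fun ω => by ring
    simp_rw [e]
    have i1 := hint s s' s' t' hs hss hs' h'.le
    have i2 := hint s' t' s' t' hs' h'.le hs' h'.le
    have i3 := hint t' t s' t' (hs'.trans h'.le) htt hs' h'.le
    have e3 := z3 t' t h'.le htt
    have e3' : ∫ ω, (c ω * (B t ω - B t' ω)) * (c' ω * (B t' ω - B s' ω)) ∂P = 0 := by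
      rw [← e3]
      exact integral_congr_ae (Eventually.of_forall fun ω => by ring)
    rw [integral_add (by exact i1.add i2) i3, integral_add i1 i2, z1 _ h'.le, z2 _ h'.le, e3']
    ring

theorem integral_indicator_mul_indicator (s t s' t' x y : ℝ) :
    Integrable (fun r => (Ioc s t).indicator (fun _ => x) r * (Ioc s' t').indicator (fun _ => y) r) ∧
    ∫ r, (Ioc s t).indicator (fun _ => x) r * (Ioc s' t').indicator (fun _ => y) r =
      x * y * max 0 (min t t' - max s s') := by
  have e : (fun r => (Ioc s t).indicator (fun _ => x) r * (Ioc s' t').indicator (fun _ => y) r) =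
      (Ioc (max s s') (min t t')).indicator fun _ => x * y := by
    ext r
    rw [← Ioc_inter_Ioc, ← inter_indicator_mul]
  rw [e]
  refine ⟨(integrable_indicator_iff measurableSet_Ioc).2 continuous_const.integrableOn_Ioc, ?_⟩
  rw [integral_indicator measurableSet_Ioc, setIntegral_const, Real.volume_real_Ioc, smul_eq_mul,
    max_comm, mul_comm]

/-- **Itô isometry** for a finite family of weighted intervals, which may overlap. -/
theorem ito_isometry_blocks [IsFiniteMeasure P] (hB : IsContinuousVersion 𝓕 P W B) {ι : Type*}
    (A : Finset ι) {s t : ι → ℝ} {c : ι → Ω → ℝ} (h : ∀ i ∈ A, IsBlock 𝓕 P (s i) (t i) (c i)) :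
    eLpNorm (fun ω => ∑ i ∈ A, c i ω * (B (t i) ω - B (s i) ω)) 2 P ^ 2 =
      ∫⁻ r, eLpNorm (fun ω => ∑ i ∈ A, (Ioc (s i) (t i)).indicator (fun _ => c i ω) r) 2 P ^ 2 := by
  have hm : ∀ i ∈ A, MemLp (fun ω => c i ω * (B (t i) ω - B (s i) ω)) 2 P := fun i hi =>
    (h i hi).memLp_mul (hB.memLp_increment (h i hi).nonneg (h i hi).le)
  have ind : ∀ i r ω, (Ioc (s i) (t i)).indicator (fun _ => c i ω) r =
      (Ioc (s i) (t i)).indicator (fun _ => (1 : ℝ)) r * c i ω := by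
    intro i r ω
    by_cases hr : r ∈ Ioc (s i) (t i)
    · simp [indicator_of_mem hr]
    · simp [indicator_of_notMem hr]
  have hm' : ∀ r, ∀ i ∈ A, MemLp (fun ω => (Ioc (s i) (t i)).indicator (fun _ => c i ω) r) 2 P := by
    intro r i hi
    rw [show (fun ω => (Ioc (s i) (t i)).indicator (fun _ => c i ω) r) = _ from
      funext (ind i r)]
    exact ((h i hi).memLp 2).const_mul _
  have hsq : ∀ r, ∫ ω, (∑ i ∈ A, (Ioc (s i) (t i)).indicator (fun _ => c i ω) r) ^ 2 ∂P =
      ∑ i ∈ A, ∑ j ∈ A, (∫ ω, c i ω * c j ω ∂P) *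
        ((Ioc (s i) (t i)).indicator (fun _ => (1 : ℝ)) r *
          (Ioc (s j) (t j)).indicator (fun _ => (1 : ℝ)) r) := by
    intro r
    simp_rw [sq, Finset.sum_mul_sum]
    have hi2 : ∀ i ∈ A, ∀ j ∈ A, Integrable (fun ω =>
        (Ioc (s i) (t i)).indicator (fun _ => c i ω) r *
          (Ioc (s j) (t j)).indicator (fun _ => c j ω) r) P := fun i hi j hj =>
      (hm' r i hi).integrable_mul (hm' r j hj)
    rw [integral_finsetSum _ fun i hi => integrable_finsetSum _ fun j hj => hi2 i hi j hj]
    refine Finset.sum_congr rfl fun i hi => ?_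
    rw [integral_finsetSum _ fun j hj => hi2 i hi j hj]
    refine Finset.sum_congr rfl fun j hj => ?_
    rw [← integral_mul_const]
    refine integral_congr_ae (Eventually.of_forall fun ω => ?_)
    simp only [ind]
    ring
  have hI : ∀ i ∈ A, ∀ j ∈ A, Integrable fun r => (∫ ω, c i ω * c j ω ∂P) *
        ((Ioc (s i) (t i)).indicator (fun _ => (1 : ℝ)) r *
          (Ioc (s j) (t j)).indicator (fun _ => (1 : ℝ)) r) := fun i _ j _ =>
    (integral_indicator_mul_indicator _ _ _ _ 1 1).1.const_mul _
  rw [sq_eLpNorm_two (memLp_finsetSum A hm)]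
  simp_rw [fun r => sq_eLpNorm_two (memLp_finsetSum A (hm' r)), hsq]
  rw [← ofReal_integral_eq_lintegral_ofReal
    (integrable_finsetSum _ fun i hi => integrable_finsetSum _ fun j hj => hI i hi j hj)
    (Eventually.of_forall fun r => by
      rw [Pi.zero_apply]; beta_reduce; rw [← hsq r]; exact integral_nonneg fun ω => sq_nonneg _)]
  congr 1
  rw [integral_finsetSum _ fun i hi => integrable_finsetSum _ fun j hj => hI i hi j hj]
  simp_rw [sq, Finset.sum_mul_sum]
  have hi2 : ∀ i ∈ A, ∀ j ∈ A, Integrable (fun ω =>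
      (c i ω * (B (t i) ω - B (s i) ω)) * (c j ω * (B (t j) ω - B (s j) ω))) P :=
    fun i hi j hj => (hm i hi).integrable_mul (hm j hj)
  rw [integral_finsetSum _ fun i hi => integrable_finsetSum _ fun j hj => hi2 i hi j hj]
  refine Finset.sum_congr rfl fun i hi => ?_
  rw [integral_finsetSum _ fun j hj => hi2 i hi j hj, integral_finsetSum _ fun j hj => hI i hi j hj]
  refine Finset.sum_congr rfl fun j hj => ?_
  rw [integral_block_mul_block hB (h i hi) (h j hj), integral_const_mul,
    (integral_indicator_mul_indicator _ _ _ _ 1 1).2]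
  ring

namespace SimpleAdapted

theorem measurable_uncurry_value (S : SimpleAdapted 𝓕) :
    Measurable fun q : ℝ × Ω => S.value q.1 q.2 := by
  unfold SimpleAdapted.value
  refine Finset.measurable_sum _ fun i _ => ?_
  have : (fun q : ℝ × Ω => (Ioc (S.time i : ℝ) (S.time (i + 1) : ℝ)).indicator
      (fun _ => S.coeff i q.2) q.1) =
      (Prod.fst ⁻¹' Ioc (S.time i : ℝ) (S.time (i + 1) : ℝ)).indicator
        fun q : ℝ × Ω => S.coeff i q.2 := by
    ext q
    simp only [indicator, mem_preimage]
  rw [this]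
  exact (((S.measurable i).mono (𝓕.le _) le_rfl).comp measurable_snd).indicator
    (measurable_fst measurableSet_Ioc)

/-- The coefficients relevant up to time `t`. -/
noncomputable def stopCoeff (S : SimpleAdapted 𝓕) (t : ℝ) (i : ℕ) (ω : Ω) : ℝ :=
  if (S.time i : ℝ) ≤ t then S.coeff i ω else 0

theorem isBlock (S : SimpleAdapted 𝓕) {t : ℝ} (ht : 0 ≤ t) (i : ℕ) :
    IsBlock 𝓕 P (min (S.time i) t) (min (S.time (i + 1)) t) (S.stopCoeff t i) := by
  refine ⟨le_min (S.time i).2 ht, ?_, ?_, ?_⟩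
  · exact min_le_min_right _ (by exact_mod_cast S.mono (Nat.le_succ i))
  · unfold stopCoeff
    by_cases h : (S.time i : ℝ) ≤ t
    · rw [min_eq_left h, Real.toNNReal_coe]
      simp only [h, if_true]
      exact (S.measurable i).stronglyMeasurable.aestronglyMeasurable
    · simp only [h, if_false]
      exact aestronglyMeasurable_const
  · obtain ⟨K, hK⟩ := S.bounded i
    refine ⟨K, fun ω => ?_⟩
    unfold stopCoeff
    split_ifs
    · exact hK ω
    · rw [abs_zero]; exact (abs_nonneg _).trans (hK ω)

/-- The elementary integral in terms of the same blocks, and of the continuous version of `W`. -/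
theorem integral_eq_sum (S : SimpleAdapted 𝓕) {t : ℝ} (ht : 0 ≤ t) {ω : Ω}
    (hω : ∀ t : ℝ≥0, W t ω = B t ω) :
    S.integral W t ω = ∑ i ∈ Finset.range S.N,
      S.stopCoeff t i ω * (B (min (S.time (i + 1)) t) ω - B (min (S.time i) t) ω) := by
  unfold SimpleAdapted.integral
  refine Finset.sum_congr rfl fun i _ => ?_
  rw [hω, hω, NNReal.coe_min, NNReal.coe_min, Real.coe_toNNReal _ ht]
  unfold stopCoeff
  split_ifs with h
  · rfl
  · have h1 : t ≤ S.time i := (not_le.1 h).le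
    have h2 : t ≤ S.time (i + 1) := h1.trans (by exact_mod_cast S.mono (Nat.le_succ i))
    rw [min_eq_right h1, min_eq_right h2]; simp

/-- Up to time `t`, a simple process is a sum of blocks on the intervals cut off at `t`. -/
theorem value_eq_sum (S : SimpleAdapted 𝓕) {t r : ℝ} (hr : r ≤ t) (ω : Ω) :
    S.value r ω = ∑ i ∈ Finset.range S.N,
      (Ioc (min (S.time i : ℝ) t) (min (S.time (i + 1) : ℝ) t)).indicator
        (fun _ => S.stopCoeff t i ω) r := by
  unfold SimpleAdapted.value
  refine Finset.sum_congr rfl fun i _ => ?_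
  unfold stopCoeff
  by_cases h : r ∈ Ioc (S.time i : ℝ) (S.time (i + 1) : ℝ)
  · have h1 : (S.time i : ℝ) ≤ t := h.1.le.trans hr
    rw [indicator_of_mem h, indicator_of_mem, if_pos h1]
    exact ⟨by rw [min_eq_left h1]; exact h.1, le_min h.2 hr⟩
  · rw [indicator_of_notMem h]
    symm
    rw [indicator_apply_eq_zero]
    intro h'
    split_ifs with h1
    · exact absurd ⟨by rw [min_eq_left h1] at h'; exact h'.1, h'.2.trans (min_le_left _ _)⟩ h
    · rfl

end SimpleAdapted

theorem sq_eLpNorm_prod {μ : Measure ℝ} [SFinite μ] [SFinite P] {H : ℝ → Ω → ℝ}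
    (hH : AEStronglyMeasurable (fun q : ℝ × Ω => H q.1 q.2) (μ.prod P)) :
    eLpNorm (fun q : ℝ × Ω => H q.1 q.2) 2 (μ.prod P) ^ 2 =
      ∫⁻ r, eLpNorm (H r) 2 P ^ 2 ∂μ := by
  rw [sq_eLpNorm_eq_lintegral, lintegral_prod _ (hH.enorm.pow_const 2)]
  simp_rw [sq_eLpNorm_eq_lintegral]

/-- **Itô isometry** for the difference of two elementary integrals. -/
theorem ito_isometry_sub [IsFiniteMeasure P] (hB : IsContinuousVersion 𝓕 P W B)
    (S S' : SimpleAdapted 𝓕) {t : ℝ} (ht : 0 ≤ t) :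
    eLpNorm (fun ω => S.integral W t ω - S'.integral W t ω) 2 P =
      eLpNorm (fun q : ℝ × Ω => S.value q.1 q.2 - S'.value q.1 q.2) 2 ((timeMeasure t).prod P) := by
  let s : ℕ ⊕ ℕ → ℝ := Sum.elim (fun i => min (S.time i : ℝ) t) (fun i => min (S'.time i : ℝ) t)
  let s' : ℕ ⊕ ℕ → ℝ :=
    Sum.elim (fun i => min (S.time (i + 1) : ℝ) t) (fun i => min (S'.time (i + 1) : ℝ) t)
  let c : ℕ ⊕ ℕ → Ω → ℝ := Sum.elim (S.stopCoeff t) (fun i ω => -S'.stopCoeff t i ω)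
  let A : Finset (ℕ ⊕ ℕ) := (Finset.range S.N).disjSum (Finset.range S'.N)
  have hbl : ∀ i ∈ A, IsBlock 𝓕 P (s i) (s' i) (c i) := by
    rintro (i | i) -
    · exact S.isBlock ht i
    · have := S'.isBlock (P := P) ht i
      refine ⟨this.nonneg, this.le, this.adapted.neg, ?_⟩
      obtain ⟨K, hK⟩ := this.bounded
      exact ⟨K, fun ω => by simpa [c] using hK ω⟩
  have h1 := ito_isometry_blocks hB A hbl
  have e1 : (fun ω => S.integral W t ω - S'.integral W t ω) =ᵐ[P]
      fun ω => ∑ i ∈ A, c i ω * (B (s' i) ω - B (s i) ω) := by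
    filter_upwards [hB.ae_eq] with ω hω
    rw [S.integral_eq_sum ht hω, S'.integral_eq_sum ht hω, Finset.sum_disjSum]
    simp only [s, s', c, Sum.elim_inl, Sum.elim_inr, neg_mul, Finset.sum_neg_distrib, sub_eq_add_neg]
  rw [← eLpNorm_congr_ae e1] at h1
  have e2 : ∀ r, r ∈ Ioc 0 t →
      (fun ω => ∑ i ∈ A, (Ioc (s i) (s' i)).indicator (fun _ => c i ω) r) =
      fun ω => S.value r ω - S'.value r ω := by
    intro r hr
    ext ω
    rw [S.value_eq_sum hr.2, S'.value_eq_sum hr.2, Finset.sum_disjSum]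
    simp only [s, s', c, Sum.elim_inl, Sum.elim_inr, sub_eq_add_neg]
    rw [← Finset.sum_neg_distrib]
    congr 1
    refine Finset.sum_congr rfl fun i _ => ?_
    exact congrFun (indicator_neg' _ (fun _ => S'.stopCoeff t i ω)) r
  have e3 : ∀ r, r ∉ Ioc 0 t →
      (fun ω => ∑ i ∈ A, (Ioc (s i) (s' i)).indicator (fun _ => c i ω) r) = fun _ => 0 := by
    intro r hr
    ext ω
    refine Finset.sum_eq_zero fun i hi => indicator_of_notMem (fun h => hr ?_) _
    refine ⟨lt_of_le_of_lt (hbl i hi).nonneg h.1, h.2.trans ?_⟩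
    rcases i with i | i
    · exact min_le_right _ _
    · exact min_le_right _ _
  have e4 : ∫⁻ r, eLpNorm (fun ω => ∑ i ∈ A, (Ioc (s i) (s' i)).indicator (fun _ => c i ω) r) 2 P ^ 2
      = ∫⁻ r in Ioc 0 t, eLpNorm (fun ω => S.value r ω - S'.value r ω) 2 P ^ 2 := by
    rw [← lintegral_indicator measurableSet_Ioc]
    refine lintegral_congr fun r => ?_
    by_cases hr : r ∈ Ioc 0 t
    · rw [indicator_of_mem hr, e2 r hr]
    · rw [indicator_of_notMem hr, e3 r hr]; simp
  rw [e4, ← restrict_Ioo_eq_restrict_Ioc,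
    ← sq_eLpNorm_prod (μ := timeMeasure t)
      (S.measurable_uncurry_value.sub S'.measurable_uncurry_value).aestronglyMeasurable] at h1
  exact (ENNReal.pow_right_strictMono two_ne_zero).injective h1

/-! ### Uniqueness of solutions -/

/-- Grönwall's inequality for functions that are integrable only. -/
theorem eq_zero_of_le_mul_lintegral {T : ℝ} {φ : ℝ → ℝ≥0∞} (hφ : AEMeasurable φ (timeMeasure T))
    (hfin : ∫⁻ t in Ioo 0 T, φ t < ⊤) {Λ : ℝ} (hΛ : 0 < Λ)
    (h : ∀ t ∈ Icc 0 T, φ t ≤ ENNReal.ofReal Λ * ∫⁻ s in Ioo 0 t, φ s) :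
    ∀ t ∈ Icc 0 T, φ t = 0 := by
  -- with the weight `exp(-2Λt)` the inequality becomes a contraction with factor `1/2`
  let w : ℝ → ℝ≥0∞ := fun t => ENNReal.ofReal (Real.exp (-(2 * Λ) * t))
  have hwm : Measurable w := by fun_prop
  have hw1 : ∀ t, 0 ≤ t → w t ≤ 1 := fun t ht => by
    rw [← ENNReal.ofReal_one]
    refine ENNReal.ofReal_le_ofReal (Real.exp_le_one_iff.2 ?_)
    nlinarith
  set K := ∫⁻ t in Ioo 0 T, w t * φ t with hK
  have hKfin : K < ⊤ := by
    refine lt_of_le_of_lt (setLIntegral_mono' measurableSet_Ioo fun t ht => ?_) hfin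
    calc w t * φ t ≤ 1 * φ t := mul_le_mul_left (hw1 t ht.1.le) _
      _ = φ t := one_mul _
  have tail : ∀ s, ENNReal.ofReal Λ * ∫⁻ t in Ioi s, w t = w s / 2 := by
    intro s
    have h1 := integral_exp_mul_Ioi (a := -(2 * Λ)) (by linarith) s
    have h2 := integrableOn_exp_mul_Ioi (a := -(2 * Λ)) (by linarith) s
    rw [← ofReal_integral_eq_lintegral_ofReal h2 (Eventually.of_forall fun _ => (Real.exp_pos _).le),
      h1, ← ENNReal.ofReal_mul hΛ.le]
    have : Λ * (-Real.exp (-(2 * Λ) * s) / -(2 * Λ)) = Real.exp (-(2 * Λ) * s) / 2 := by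
      field_simp
    rw [this, ENNReal.ofReal_div_of_pos two_pos]
    simp [w]
  have hK2 : K ≤ K / 2 := by
    have hG : AEMeasurable (Function.uncurry fun t s : ℝ =>
        (Iio t).indicator (fun s => w t * (ENNReal.ofReal Λ * φ s)) s)
        ((timeMeasure T).prod (timeMeasure T)) := by
      have : (Function.uncurry fun t s : ℝ =>
        (Iio t).indicator (fun s => w t * (ENNReal.ofReal Λ * φ s)) s) =
        {q : ℝ × ℝ | q.2 < q.1}.indicator fun q => w q.1 * (ENNReal.ofReal Λ * φ q.2) := by
        ext ⟨t, s⟩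
        by_cases hs : s < t
        · simp [Function.uncurry, hs]
        · simp [Function.uncurry, hs]
      rw [this]
      refine AEMeasurable.indicator ?_ (measurableSet_lt measurable_snd measurable_fst)
      exact (hwm.comp measurable_fst).aemeasurable.mul (hφ.comp_snd.const_mul _)
    calc K ≤ ∫⁻ t in Ioo 0 T, ∫⁻ s in Ioo 0 T,
          (Iio t).indicator (fun s => w t * (ENNReal.ofReal Λ * φ s)) s := by
          refine setLIntegral_mono' measurableSet_Ioo fun t ht => ?_
          rw [lintegral_indicator measurableSet_Iio, Measure.restrict_restrict measurableSet_Iio]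
          have : Iio t ∩ Ioo 0 T = Ioo 0 t := by
            ext s; simp only [mem_inter_iff, mem_Iio, mem_Ioo]
            constructor
            · rintro ⟨a, b, c⟩; exact ⟨b, a⟩
            · rintro ⟨a, b⟩; exact ⟨b, a, b.trans ht.2⟩
          rw [this, lintegral_const_mul' _ _ ENNReal.ofReal_ne_top,
            lintegral_const_mul' _ _ ENNReal.ofReal_ne_top]
          exact mul_le_mul_right (h t ⟨ht.1.le, ht.2.le⟩) _
      _ = ∫⁻ s in Ioo 0 T, ∫⁻ t in Ioo 0 T,
          (Iio t).indicator (fun s => w t * (ENNReal.ofReal Λ * φ s)) s :=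
          lintegral_lintegral_swap hG
      _ ≤ ∫⁻ s in Ioo 0 T, φ s * (ENNReal.ofReal Λ * ∫⁻ t in Ioi s, w t) := by
          refine lintegral_mono_ae ?_
          filter_upwards [ae_lt_top' hφ hfin.ne] with s hs
          calc ∫⁻ t in Ioo 0 T, (Iio t).indicator (fun s => w t * (ENNReal.ofReal Λ * φ s)) s
              ≤ ∫⁻ t, (Iio t).indicator (fun s => w t * (ENNReal.ofReal Λ * φ s)) s :=
                setLIntegral_le_lintegral _ _
            _ = ∫⁻ t, (Ioi s).indicator (fun t => (ENNReal.ofReal Λ * φ s) * w t) t := by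
                refine lintegral_congr fun t => ?_
                by_cases hst : s < t
                · simp [hst, mul_comm]
                · simp [hst]
            _ = φ s * (ENNReal.ofReal Λ * ∫⁻ t in Ioi s, w t) := by
                rw [lintegral_indicator measurableSet_Ioi, lintegral_const_mul _ hwm]
                ring
      _ = K / 2 := by
          simp_rw [tail]
          rw [hK, ENNReal.div_eq_inv_mul, ← lintegral_const_mul' _ _ (by simp)]
          refine lintegral_congr fun s => ?_
          rw [ENNReal.div_eq_inv_mul]; ring
  have hK0 : K = 0 := by
    by_contra hne
    exact absurd hK2 (not_le.2 (ENNReal.half_lt_self hne hKfin.ne))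
  have hae : ∀ᵐ t ∂timeMeasure T, φ t = 0 := by
    have := (lintegral_eq_zero_iff' (hwm.aemeasurable.mul hφ)).1 hK0
    filter_upwards [this] with t ht
    have h1 : w t * φ t = 0 := ht
    rcases mul_eq_zero.1 h1 with h2 | h2
    · exact absurd h2 (by simp [w, Real.exp_pos])
    · exact h2
  intro t ht
  have h0 : ∫⁻ s in Ioo 0 t, φ s = 0 := by
    have : timeMeasure t ≤ timeMeasure T := Measure.restrict_mono (Ioo_subset_Ioo_right ht.2) le_rfl
    rw [lintegral_congr_ae (g := fun _ => 0) (this.absolutelyContinuous hae)]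
    simp
  have := h t ht
  rw [h0, mul_zero] at this
  exact le_antisymm this zero_le

theorem add_sq_le_four_mul (a b : ℝ≥0∞) : (a + b) ^ 2 ≤ 4 * (a ^ 2 + b ^ 2) := by
  calc (a + b) ^ 2 ≤ (2 * max a b) ^ 2 := by
        gcongr
        rw [two_mul]
        exact add_le_add (le_max_left _ _) (le_max_right _ _)
    _ = 4 * (max a b) ^ 2 := by rw [mul_pow]; norm_num
    _ ≤ 4 * (a ^ 2 + b ^ 2) := by
        gcongr
        rcases le_total a b with h | h
        · rw [max_eq_right h]; exact le_add_self
        · rw [max_eq_left h]; exact le_self_add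

theorem sq_lintegral_le {α : Type*} {mα : MeasurableSpace α} {μ : Measure α} {f : α → ℝ≥0∞}
    (hf : AEMeasurable f μ) : (∫⁻ x, f x ∂μ) ^ 2 ≤ μ univ * ∫⁻ x, f x ^ 2 ∂μ := by
  have h := ENNReal.lintegral_mul_le_Lp_mul_Lq μ (Real.HolderConjugate.two_two) hf
    (aemeasurable_const (b := (1 : ℝ≥0∞)))
  simp only [Pi.mul_apply, mul_one, ENNReal.one_rpow, lintegral_one] at h
  have e : ∀ x : ℝ≥0∞, (x ^ (1 / (2 : ℝ))) ^ 2 = x := fun x => by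
    rw [← ENNReal.rpow_natCast, ← ENNReal.rpow_mul]; norm_num
  calc (∫⁻ x, f x ∂μ) ^ 2 ≤ ((∫⁻ x, f x ^ (2 : ℝ) ∂μ) ^ (1 / (2 : ℝ)) * μ univ ^ (1 / (2 : ℝ))) ^ 2 :=
        by gcongr
    _ = _ := by
        rw [mul_pow, e, e, mul_comm]
        simp

theorem exists_ae_abs_le {T : ℝ} {a : ℝ → ℝ} (ha : MemLp a ⊤ (timeMeasure T)) :
    ∃ K : ℝ, 0 < K ∧ ∀ᵐ s ∂timeMeasure T, |a s| ≤ K := by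
  refine ⟨(eLpNorm a ⊤ (timeMeasure T)).toReal + 1, by positivity, ?_⟩
  filter_upwards [ae_le_eLpNormEssSup (f := a) (μ := timeMeasure T)] with s hs
  have h1 : ‖a s‖ₑ ≤ eLpNorm a ⊤ (timeMeasure T) := by rwa [eLpNorm_exponent_top]
  have h2 := ENNReal.toReal_mono ha.2.ne h1
  rw [toReal_enorm, Real.norm_eq_abs] at h2
  linarith

theorem timeMeasure_mono {s t : ℝ} (h : s ≤ t) : timeMeasure s ≤ timeMeasure t :=
  Measure.restrict_mono (Ioo_subset_Ioo_right h) le_rfl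

theorem timeMeasure_prod_mono [SFinite P] {s t : ℝ} (h : s ≤ t) :
    (timeMeasure s).prod P ≤ (timeMeasure t).prod P :=
  Measure.prod_mono (timeMeasure_mono h) le_rfl

theorem timeMeasure_eq_Ioc (t : ℝ) : volume.restrict (Ioc 0 t) = timeMeasure t :=
  restrict_Ioo_eq_restrict_Ioc.symm

theorem aemeasurable_sq_eLpNorm [SFinite P] {μ : Measure ℝ} [SFinite μ] {H : ℝ → Ω → ℝ}
    (hH : AEStronglyMeasurable (fun q : ℝ × Ω => H q.1 q.2) (μ.prod P)) :
    AEMeasurable (fun t => eLpNorm (H t) 2 P ^ 2) μ := by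
  simp_rw [sq_eLpNorm_eq_lintegral]
  exact AEMeasurable.lintegral_prod_right' (f := fun q : ℝ × Ω => ‖H q.1 q.2‖ₑ ^ 2)
    (hH.enorm.pow_const 2)

theorem SimpleAdapted.aestronglyMeasurable_integral (hB : IsContinuousVersion 𝓕 P W B)
    (S : SimpleAdapted 𝓕) (t : ℝ) : AEStronglyMeasurable (S.integral W t) P := by
  have hW : ∀ r, AEStronglyMeasurable (W r) P := fun r => by
    refine (hB.measurable_apply r).aestronglyMeasurable.congr ?_
    filter_upwards [hB.ae_eq] with ω hω
    exact (hω r).symm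
  have : S.integral W t = fun ω => ∑ i ∈ Finset.range S.N, S.coeff i ω *
      (W (min (S.time (i + 1)) t.toNNReal) ω - W (min (S.time i) t.toNNReal) ω) := rfl
  rw [this]
  refine Finset.aestronglyMeasurable_fun_sum _ fun i _ => ?_
  exact ((S.measurable i).mono (𝓕.le _) le_rfl).aestronglyMeasurable.mul ((hW _).sub (hW _))

/-- Itô integrals depend on their integrands in a contractive way. -/
theorem IsItoIntegral.norm_sub_le [IsProbabilityMeasure P] (hB : IsContinuousVersion 𝓕 P W B)
    {T : ℝ} {H H' I I' : ℝ → Ω → ℝ}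
    (hH : AEStronglyMeasurable (fun q : ℝ × Ω => H q.1 q.2) ((timeMeasure T).prod P))
    (hH' : AEStronglyMeasurable (fun q : ℝ × Ω => H' q.1 q.2) ((timeMeasure T).prod P))
    (h : IsItoIntegral 𝓕 P W T H I) (h' : IsItoIntegral 𝓕 P W T H' I') {t : ℝ} (ht : t ∈ Icc 0 T) :
    eLpNorm (fun ω => I t ω - I' t ω) 2 P ≤
      eLpNorm (fun q : ℝ × Ω => H q.1 q.2 - H' q.1 q.2) 2 ((timeMeasure t).prod P) := by
  obtain ⟨S, hS, hSI⟩ := h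
  obtain ⟨S', hS', hSI'⟩ := h'
  obtain ⟨hIm, hIt⟩ := hSI t ht
  obtain ⟨hIm', hIt'⟩ := hSI' t ht
  have hle := timeMeasure_prod_mono (P := P) ht.2
  have key : ∀ n, eLpNorm (fun ω => I t ω - I' t ω) 2 P ≤
      eLpNorm (fun q : ℝ × Ω => H q.1 q.2 - H' q.1 q.2) 2 ((timeMeasure t).prod P) +
      ((eLpNorm (fun q : ℝ × Ω => H q.1 q.2 - (S n).value q.1 q.2) 2 ((timeMeasure T).prod P) +
      eLpNorm (fun q : ℝ × Ω => H' q.1 q.2 - (S' n).value q.1 q.2) 2 ((timeMeasure T).prod P)) +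
      (eLpNorm (fun ω => I t ω - (S n).integral W t ω) 2 P +
      eLpNorm (fun ω => I' t ω - (S' n).integral W t ω) 2 P)) := by
    intro n
    have mS := (S n).aestronglyMeasurable_integral hB t
    have mS' := (S' n).aestronglyMeasurable_integral hB t
    have m1 := hIm.sub mS
    have m2 := hIm'.sub mS'
    have mv : AEStronglyMeasurable (fun q : ℝ × Ω => (S n).value q.1 q.2)
        ((timeMeasure T).prod P) := (S n).measurable_uncurry_value.aestronglyMeasurable
    have mv' : AEStronglyMeasurable (fun q : ℝ × Ω => (S' n).value q.1 q.2)
        ((timeMeasure T).prod P) := (S' n).measurable_uncurry_value.aestronglyMeasurable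
    have e1 : (fun ω => I t ω - I' t ω) = (fun ω => (S n).integral W t ω - (S' n).integral W t ω) +
        ((I t - (S n).integral W t) - (I' t - (S' n).integral W t)) := by
      ext ω; simp only [Pi.add_apply, Pi.sub_apply]; ring
    have e2 : (fun q : ℝ × Ω => (S n).value q.1 q.2 - (S' n).value q.1 q.2) =
        (fun q : ℝ × Ω => H q.1 q.2 - H' q.1 q.2) -
        ((fun q : ℝ × Ω => H q.1 q.2 - (S n).value q.1 q.2) -
          (fun q : ℝ × Ω => H' q.1 q.2 - (S' n).value q.1 q.2)) := by
      ext q; simp only [Pi.sub_apply]; ring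
    have b1 : eLpNorm (fun ω => I t ω - I' t ω) 2 P ≤
        eLpNorm (fun ω => (S n).integral W t ω - (S' n).integral W t ω) 2 P +
        (eLpNorm (I t - (S n).integral W t) 2 P + eLpNorm (I' t - (S' n).integral W t) 2 P) := by
      rw [e1]
      exact (eLpNorm_add_le (mS.sub mS') (m1.sub m2) one_le_two).trans
        (add_le_add le_rfl (eLpNorm_sub_le m1 m2 one_le_two))
    have b2 : eLpNorm (fun q : ℝ × Ω => (S n).value q.1 q.2 - (S' n).value q.1 q.2) 2
        ((timeMeasure t).prod P) ≤
        eLpNorm (fun q : ℝ × Ω => H q.1 q.2 - H' q.1 q.2) 2 ((timeMeasure t).prod P) +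
        (eLpNorm (fun q : ℝ × Ω => H q.1 q.2 - (S n).value q.1 q.2) 2 ((timeMeasure t).prod P) +
        eLpNorm (fun q : ℝ × Ω => H' q.1 q.2 - (S' n).value q.1 q.2) 2
          ((timeMeasure t).prod P)) := by
      rw [e2]
      have n1 := (hH.sub mv).mono_measure hle
      have n2 := (hH'.sub mv').mono_measure hle
      exact (eLpNorm_sub_le ((hH.sub hH').mono_measure hle) (n1.sub n2) one_le_two).trans
        (add_le_add le_rfl (eLpNorm_sub_le n1 n2 one_le_two))
    rw [ito_isometry_sub hB _ _ ht.1] at b1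
    refine b1.trans ((add_le_add b2 le_rfl).trans ?_)
    rw [add_assoc]
    gcongr
    · exact le_rfl
    · exact le_rfl
  have hlim : Tendsto (fun n =>
      eLpNorm (fun q : ℝ × Ω => H q.1 q.2 - H' q.1 q.2) 2 ((timeMeasure t).prod P) +
      ((eLpNorm (fun q : ℝ × Ω => H q.1 q.2 - (S n).value q.1 q.2) 2 ((timeMeasure T).prod P) +
      eLpNorm (fun q : ℝ × Ω => H' q.1 q.2 - (S' n).value q.1 q.2) 2 ((timeMeasure T).prod P)) +
      (eLpNorm (fun ω => I t ω - (S n).integral W t ω) 2 P +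
      eLpNorm (fun ω => I' t ω - (S' n).integral W t ω) 2 P))) atTop
      (𝓝 (eLpNorm (fun q : ℝ × Ω => H q.1 q.2 - H' q.1 q.2) 2 ((timeMeasure t).prod P) +
        ((0 + 0) + (0 + 0)))) :=
    tendsto_const_nhds.add ((hS.add hS').add (hIt.add hIt'))
  rw [add_zero, add_zero, add_zero] at hlim
  exact ge_of_tendsto' hlim key

theorem ofReal_two : ENNReal.ofReal 2 = 2 := by norm_num

/-- **Uniqueness of solutions**, by the Itô isometry and Grönwall's inequality for `E|X - X'|²`. -/
theorem IsSolution.ae_eq [IsProbabilityMeasure P] (hB : IsContinuousVersion 𝓕 P W B) {T : ℝ}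
    {a : ℝ → ℝ} (ha : MemLp a ⊤ (timeMeasure T)) {X₀ : Ω → ℝ} {f X X' : ℝ → Ω → ℝ}
    (hX : IsSolution 𝓕 P W T a X₀ f X) (hX' : IsSolution 𝓕 P W T a X₀ f X') :
    ∀ t ∈ Icc 0 T, X t =ᵐ[P] X' t := by
  obtain ⟨K, hK, haK⟩ := exists_ae_abs_le ha
  obtain ⟨I, hI, hIe⟩ := hX.equation
  obtain ⟨I', hI', hIe'⟩ := hX'.equation
  set D : ℝ → Ω → ℝ := fun t ω => X t ω - X' t ω with hD
  have hDm : AEStronglyMeasurable (fun q : ℝ × Ω => D q.1 q.2) ((timeMeasure T).prod P) :=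
    hX.mem.measurable.sub hX'.mem.measurable
  have hDt : ∀ t ∈ Icc 0 T, AEStronglyMeasurable (D t) P := fun t ht =>
    ((hX.mem.adapted t ht).mono (𝓕.le _)).sub ((hX'.mem.adapted t ht).mono (𝓕.le _))
  let φ : ℝ → ℝ≥0∞ := fun t => eLpNorm (D t) 2 P ^ 2
  have hφ : AEMeasurable φ (timeMeasure T) := aemeasurable_sq_eLpNorm hDm
  have hfin : ∫⁻ t in Ioo 0 T, φ t < ⊤ := by
    have b : ∀ t ∈ Ioo 0 T, φ t ≤ 4 * (eLpNorm (X t) 2 P ^ 2 + eLpNorm (X' t) 2 P ^ 2) := by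
      intro t ht
      have ht' : t ∈ Icc 0 T := ⟨ht.1.le, ht.2.le⟩
      refine le_trans ?_ (add_sq_le_four_mul _ _)
      refine pow_le_pow_left' ?_ 2
      exact eLpNorm_sub_le ((hX.mem.adapted t ht').mono (𝓕.le _))
        ((hX'.mem.adapted t ht').mono (𝓕.le _)) one_le_two
    refine lt_of_le_of_lt (setLIntegral_mono' measurableSet_Ioo b) ?_
    rw [lintegral_const_mul' _ _ (by simp),
      lintegral_add_left' (aemeasurable_sq_eLpNorm hX.mem.measurable)]
    have n1 := hX.mem.norm_lt_top
    have n2 := hX'.mem.norm_lt_top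
    rw [ofReal_two] at n1 n2
    exact ENNReal.mul_lt_top (by simp) (ENNReal.add_lt_top.2 ⟨n1, n2⟩)
  have hmain : ∀ t ∈ Icc 0 T,
      φ t ≤ ENNReal.ofReal (4 * (K ^ 2 * (|T| + 1))+ 4) * ∫⁻ s in Ioo 0 t, φ s := by
    intro t ht
    have hle := timeMeasure_prod_mono (P := P) ht.2
    have hDm' := hDm.mono_measure hle
    have hpt : ∀ᵐ ω ∂P, ‖D t ω‖ₑ ^ 2 ≤
        4 * (ENNReal.ofReal (K ^ 2 * (|T| + 1)) * (∫⁻ s in Ioo 0 t, ‖D s ω‖ₑ ^ 2) +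
          ‖I t ω - I' t ω‖ₑ ^ 2) := by
      have hsec : ∀ᵐ ω ∂P, AEStronglyMeasurable (fun s => D s ω) (timeMeasure t) := by
        have := hDm'.prod_swap.prodMk_left
        filter_upwards [this] with ω hω
        exact hω
      filter_upwards [hIe t ht, hIe' t ht, hX.integrable_drift, hX'.integrable_drift, hsec]
        with ω h1 h2 h3 h4 h5
      have i3 : Integrable (fun s => a s * X s ω + f s ω) (volume.restrict (Ioc 0 t)) := by
        rw [timeMeasure_eq_Ioc]; exact h3.mono_measure (timeMeasure_mono ht.2)
      have i4 : Integrable (fun s => a s * X' s ω + f s ω) (volume.restrict (Ioc 0 t)) := by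
        rw [timeMeasure_eq_Ioc]; exact h4.mono_measure (timeMeasure_mono ht.2)
      have e : D t ω = (∫ s in Ioo 0 t, a s * D s ω) + (I t ω - I' t ω) := by
        simp only [hD]
        rw [h1, h2, intervalIntegral.integral_of_le ht.1, intervalIntegral.integral_of_le ht.1,
          ← integral_Ioc_eq_integral_Ioo]
        have : ∫ s in Ioc 0 t, a s * (X s ω - X' s ω) = (∫ s in Ioc 0 t, (a s * X s ω + f s ω)) -
            ∫ s in Ioc 0 t, (a s * X' s ω + f s ω) := by
          rw [← integral_sub i3 i4]
          refine integral_congr_ae (Eventually.of_forall fun s => ?_)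
          simp only; ring
        rw [this]; ring
      have b1 : ‖∫ s in Ioo 0 t, a s * D s ω‖ₑ ≤
          ENNReal.ofReal K * ∫⁻ s in Ioo 0 t, ‖D s ω‖ₑ := by
        rw [← lintegral_const_mul' _ _ ENNReal.ofReal_ne_top]
        refine (enorm_integral_le_lintegral_enorm _).trans (lintegral_mono_ae ?_)
        filter_upwards [(timeMeasure_mono ht.2).absolutelyContinuous haK] with s hs
        rw [enorm_mul]
        gcongr
        rw [Real.enorm_eq_ofReal_abs]
        exact ENNReal.ofReal_le_ofReal hs
      rw [e]
      calc ‖(∫ s in Ioo 0 t, a s * D s ω) + (I t ω - I' t ω)‖ₑ ^ 2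
          ≤ (ENNReal.ofReal K * (∫⁻ s in Ioo 0 t, ‖D s ω‖ₑ) + ‖I t ω - I' t ω‖ₑ) ^ 2 := by
            gcongr
            exact (enorm_add_le _ _).trans (add_le_add b1 le_rfl)
        _ ≤ 4 * ((ENNReal.ofReal K * (∫⁻ s in Ioo 0 t, ‖D s ω‖ₑ)) ^ 2 +
            ‖I t ω - I' t ω‖ₑ ^ 2) := add_sq_le_four_mul _ _
        _ ≤ _ := by
            gcongr
            rw [mul_pow, ENNReal.ofReal_mul (by positivity), ENNReal.ofReal_pow hK.le, mul_assoc]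
            gcongr
            refine (sq_lintegral_le h5.enorm).trans ?_
            gcongr
            simp only [Measure.restrict_apply MeasurableSet.univ, univ_inter, Real.volume_Ioo]
            refine ENNReal.ofReal_le_ofReal ?_
            have := le_abs_self T
            linarith [ht.2]
    have hlim := hI.norm_sub_le hB hX.mem.measurable hX'.mem.measurable hI' ht
    have hsqD : eLpNorm (fun q : ℝ × Ω => X q.1 q.2 - X' q.1 q.2) 2 ((timeMeasure t).prod P) ^ 2 =
        ∫⁻ s in Ioo 0 t, φ s := sq_eLpNorm_prod (H := D) hDm'
    have hmI : AEStronglyMeasurable (fun ω => I t ω - I' t ω) P := by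
      obtain ⟨_, _, h1⟩ := hI
      obtain ⟨_, _, h2⟩ := hI'
      exact (h1 t ht).1.sub (h2 t ht).1
    have hsw : ∫⁻ ω, (∫⁻ s in Ioo 0 t, ‖D s ω‖ₑ ^ 2) ∂P = ∫⁻ s in Ioo 0 t, φ s := by
      rw [lintegral_lintegral_swap (hDm'.prod_swap.enorm.pow_const 2)]
      refine lintegral_congr fun s => ?_
      exact (sq_eLpNorm_eq_lintegral P (D s)).symm
    calc φ t = ∫⁻ ω, ‖D t ω‖ₑ ^ 2 ∂P := sq_eLpNorm_eq_lintegral _ _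
      _ ≤ ∫⁻ ω, 4 * (ENNReal.ofReal (K ^ 2 * (|T| + 1)) * (∫⁻ s in Ioo 0 t, ‖D s ω‖ₑ ^ 2) +
          ‖I t ω - I' t ω‖ₑ ^ 2) ∂P := lintegral_mono_ae hpt
      _ = 4 * (ENNReal.ofReal (K ^ 2 * (|T| + 1)) * (∫⁻ s in Ioo 0 t, φ s) +
          eLpNorm (fun ω => I t ω - I' t ω) 2 P ^ 2) := by
          rw [lintegral_const_mul' _ _ (by simp), lintegral_add_right' _ (hmI.enorm.pow_const 2),
            lintegral_const_mul' _ _ ENNReal.ofReal_ne_top, hsw, ← sq_eLpNorm_eq_lintegral]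
      _ ≤ 4 * (ENNReal.ofReal (K ^ 2 * (|T| + 1)) * (∫⁻ s in Ioo 0 t, φ s) +
          ∫⁻ s in Ioo 0 t, φ s) := by
          gcongr
          rw [← hsqD]
          gcongr
      _ = _ := by
          rw [ENNReal.ofReal_add (by positivity) (by norm_num), ENNReal.ofReal_mul (p := 4) (by norm_num)]
          rw [show ENNReal.ofReal 4 = 4 by norm_num]
          ring
  intro t ht
  have h0 := eq_zero_of_le_mul_lintegral hφ hfin (by positivity) hmain t ht
  have h1 : eLpNorm (D t) 2 P = 0 := by simpa [φ] using h0
  have h2 := (eLpNorm_eq_zero_iff (hDt t ht) two_ne_zero).1 h1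
  filter_upwards [h2] with ω hω
  have : X t ω - X' t ω = 0 := hω
  linarith

/-! ### The explicit solution -/

/-- Forcing terms: jointly measurable processes, adapted at almost every time, whose
`L^p(Ω)`-norm is integrable in time. -/
structure IsForcing (𝓕 : Filtration ℝ≥0 mΩ) (P : Measure Ω) (T p : ℝ) (f : ℝ → Ω → ℝ) :
    Prop where
  meas : Measurable (Function.uncurry f)
  adapted : ∀ᵐ t ∂timeMeasure T, AEStronglyMeasurable[𝓕 t.toNNReal] (f t) P
  finite : ∫⁻ t in Ioo 0 T, eLpNorm (f t) (ENNReal.ofReal p) P < ⊤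

theorem IsForcing.mono_exponent [IsProbabilityMeasure P] {T p q : ℝ} {f : ℝ → Ω → ℝ}
    (hf : IsForcing 𝓕 P T p f) (hqp : q ≤ p) : IsForcing 𝓕 P T q f :=
  ⟨hf.meas, hf.adapted, lt_of_le_of_lt (lintegral_mono fun _ =>
    eLpNorm_le_eLpNorm_of_exponent_le (ENNReal.ofReal_le_ofReal hqp)
      (hf.meas.of_uncurry_left).aestronglyMeasurable) hf.finite⟩

theorem IsForcing.integrable_prod [IsProbabilityMeasure P] {T p : ℝ} {f : ℝ → Ω → ℝ}
    (hf : IsForcing 𝓕 P T p f) (hp : 1 ≤ p) :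
    Integrable (Function.uncurry f) ((timeMeasure T).prod P) := by
  refine ⟨hf.meas.aestronglyMeasurable, ?_⟩
  have h := (hf.mono_exponent hp).finite
  rw [hasFiniteIntegral_iff_enorm, lintegral_prod _ hf.meas.enorm.aemeasurable]
  simpa [eLpNorm_one_eq_lintegral_enorm, Function.uncurry] using h

theorem IsForcing.ae_integrable [IsProbabilityMeasure P] {T p : ℝ} {f : ℝ → Ω → ℝ}
    (hf : IsForcing 𝓕 P T p f) (hp : 1 ≤ p) :
    ∀ᵐ ω ∂P, Integrable (fun t => f t ω) (timeMeasure T) :=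
  (hf.integrable_prod hp).prod_left_ae

/-- The fundamental solution `exp(A(t) - A(s) + B(t) - B(s) - (t-s)/2)`. -/
noncomputable def kernel (A : ℝ → ℝ) (B : ℝ → Ω → ℝ) (s t : ℝ) (ω : Ω) : ℝ :=
  Real.exp (A t - A s + (B t ω - B s ω - (t - s) / 2))

/-- The solution of the linear equation with forcing `f` and drift coefficient `A'`, given by the
variation of constants formula. -/
noncomputable def linSol (A : ℝ → ℝ) (B : ℝ → Ω → ℝ) (f : ℝ → Ω → ℝ) (t : ℝ) (ω : Ω) : ℝ :=
  ∫ s in Ioc 0 t, kernel A B s t ω * f s ω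

theorem kernel_mul_kernel (A : ℝ → ℝ) (B : ℝ → Ω → ℝ) (r s t : ℝ) (ω : Ω) :
    kernel A B r s ω * kernel A B s t ω = kernel A B r t ω := by
  unfold kernel
  rw [← Real.exp_add]; congr 1; ring

theorem kernel_pos (A : ℝ → ℝ) (B : ℝ → Ω → ℝ) (s t : ℝ) (ω : Ω) : 0 < kernel A B s t ω :=
  Real.exp_pos _

theorem kernel_self (A : ℝ → ℝ) (B : ℝ → Ω → ℝ) (t : ℝ) (ω : Ω) : kernel A B t t ω = 1 := by
  simp [kernel]

/-- The kernel splits into a factor depending on `t` and one depending on `s`, so that the solution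
is a continuous factor times a primitive. -/
theorem linSol_eq (A : ℝ → ℝ) (B : ℝ → Ω → ℝ) (f : ℝ → Ω → ℝ) (t : ℝ) (ω : Ω) :
    linSol A B f t ω = kernel A B 0 t ω * ∫ s in Ioc 0 t, kernel A B s 0 ω * f s ω := by
  unfold linSol
  rw [← integral_const_mul]
  refine integral_congr_ae (Eventually.of_forall fun s => ?_)
  simp only
  rw [← mul_assoc, mul_comm (kernel A B 0 t ω), kernel_mul_kernel]

theorem linSol_zero (A : ℝ → ℝ) (B : ℝ → Ω → ℝ) (f : ℝ → Ω → ℝ) (ω : Ω) :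
    linSol A B f 0 ω = 0 := by simp [linSol]

section Kernel

variable {A : ℝ → ℝ} (hA : Continuous A) (hB : IsContinuousVersion 𝓕 P W B)
include hA hB

theorem measurable_kernel : Measurable fun q : (ℝ × ℝ) × Ω => kernel A B q.1.1 q.1.2 q.2 := by
  unfold kernel
  have h1 : Measurable fun q : (ℝ × ℝ) × Ω => B q.1.1 q.2 :=
    hB.meas.comp ((measurable_fst.comp measurable_fst).prodMk measurable_snd)
  have h2 : Measurable fun q : (ℝ × ℝ) × Ω => B q.1.2 q.2 :=
    hB.meas.comp ((measurable_snd.comp measurable_fst).prodMk measurable_snd)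
  have h3 : Measurable fun q : (ℝ × ℝ) × Ω => A q.1.1 :=
    hA.measurable.comp (measurable_fst.comp measurable_fst)
  have h4 : Measurable fun q : (ℝ × ℝ) × Ω => A q.1.2 :=
    hA.measurable.comp (measurable_snd.comp measurable_fst)
  exact Real.measurable_exp.comp ((h4.sub h3).add ((h2.sub h1).sub
    (((measurable_snd.comp measurable_fst).sub (measurable_fst.comp measurable_fst)).div_const 2)))

theorem measurable_kernel_apply (s t : ℝ) : Measurable (kernel A B s t) :=
  (measurable_kernel hA hB).comp (g := fun q : (ℝ × ℝ) × Ω => kernel A B q.1.1 q.1.2 q.2)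
    (f := fun ω => ((s, t), ω)) (measurable_const.prodMk measurable_id)

theorem continuous_kernel_left (t : ℝ) (ω : Ω) : Continuous fun s => kernel A B s t ω := by
  unfold kernel
  have := hB.cont ω
  fun_prop

theorem continuous_kernel_right (s : ℝ) (ω : Ω) : Continuous fun t => kernel A B s t ω := by
  unfold kernel
  have := hB.cont ω
  fun_prop

omit hA in
theorem eLpNorm_kernel_le {T K p : ℝ} (hK : ∀ t ∈ Icc 0 T, |A t| ≤ K) (hp : 1 ≤ p) {s t : ℝ}
    (hs : 0 ≤ s) (hst : s ≤ t) (ht : t ≤ T) :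
    eLpNorm (kernel A B s t) (ENNReal.ofReal p) P ≤
      ENNReal.ofReal (Real.exp (2 * K + (p - 1) * T / 2)) := by
  have hv : ((t - s).toNNReal : ℝ) = t - s := Real.coe_toNNReal _ (sub_nonneg.2 hst)
  have e : kernel A B s t = Real.exp (A t - A s) •
      fun ω => Real.exp ((B t ω - B s ω) - ((t - s).toNNReal : ℝ) / 2) := by
    ext ω
    simp only [kernel, Pi.smul_apply, smul_eq_mul, hv]
    rw [← Real.exp_add]
  rw [e, eLpNorm_const_smul, hB.eLpNorm_comp_increment hs hst
    (g := fun x => Real.exp (x - ((t - s).toNNReal : ℝ) / 2)) (by fun_prop),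
    eLpNorm_exp_gaussianReal _ hp, hv, Real.enorm_eq_ofReal (Real.exp_pos _).le,
    ← ENNReal.ofReal_mul (Real.exp_pos _).le, ← Real.exp_add]
  refine ENNReal.ofReal_le_ofReal (Real.exp_le_exp.2 ?_)
  have h1 := abs_le.1 (hK t ⟨hs.trans hst, ht⟩)
  have h2 := abs_le.1 (hK s ⟨hs, hst.trans ht⟩)
  have h3 : (p - 1) * (t - s) ≤ (p - 1) * T := by
    apply mul_le_mul_of_nonneg_left <;> linarith
  linarith [h1.1, h1.2, h2.1, h2.2]

omit hA in
theorem aestronglyMeasurable_kernel {s t : ℝ} (hs : 0 ≤ s) (hst : s ≤ t) :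
    AEStronglyMeasurable[𝓕 t.toNNReal] (kernel A B s t) P := by
  have h := (hB.adapted_of_le (hs.trans hst) le_rfl).sub (hB.adapted_of_le hs hst)
  exact (Continuous.comp_aestronglyMeasurable (g := fun x : ℝ =>
    Real.exp (A t - A s + (x - (t - s) / 2))) (by fun_prop) h)

omit hA in
theorem indepFun_kernel {s t : ℝ} (hs : 0 ≤ s) (hst : s ≤ t) {c : Ω → ℝ}
    (hc : AEStronglyMeasurable[𝓕 s.toNNReal] c P) : IndepFun c (kernel A B s t) P :=
  (hB.indep s t hs hst c hc).comp (φ := id) (ψ := fun x : ℝ =>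
    Real.exp (A t - A s + (x - (t - s) / 2))) measurable_id (by fun_prop)

/-- The kernel over `[s,t]` is independent of the past of `s`, so its `L^p` norm factors out. -/
theorem eLpNorm_kernel_mul_le {T K p : ℝ} (hK : ∀ t ∈ Icc 0 T, |A t| ≤ K) (hp : 1 ≤ p) {s t : ℝ}
    (hs : 0 ≤ s) (hst : s ≤ t) (ht : t ≤ T) {c : Ω → ℝ}
    (hc : AEStronglyMeasurable[𝓕 s.toNNReal] c P) :
    eLpNorm (fun ω => kernel A B s t ω * c ω) (ENNReal.ofReal p) P ≤
      ENNReal.ofReal (Real.exp (2 * K + (p - 1) * T / 2)) * eLpNorm c (ENNReal.ofReal p) P := by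
  rw [eLpNorm_mul_of_indepFun (indepFun_kernel hB hs hst hc).symm
    (measurable_kernel_apply hA hB s t).aestronglyMeasurable (hc.mono (𝓕.le _)) hp]
  gcongr
  exact eLpNorm_kernel_le hB hK hp hs hst ht

variable {T p : ℝ} {f : ℝ → Ω → ℝ}

theorem measurable_kernel_mul (hf : Measurable (Function.uncurry f)) (t : ℝ) :
    Measurable (Function.uncurry fun s ω => kernel A B s t ω * f s ω) :=
  ((measurable_kernel hA hB).comp
    ((measurable_fst.prodMk measurable_const).prodMk measurable_snd)).mul hf

theorem measurable_linSol (hf : Measurable (Function.uncurry f)) :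
    Measurable (Function.uncurry (linSol A B f)) := by
  have e : Function.uncurry (linSol A B f) = fun x : ℝ × Ω => ∫ s,
      ({q : (ℝ × Ω) × ℝ | 0 < q.2 ∧ q.2 ≤ q.1.1}.indicator
        fun q => kernel A B q.2 q.1.1 q.1.2 * f q.2 q.1.2) (x, s) := by
    ext ⟨t, ω⟩
    simp only [Function.uncurry, linSol]
    rw [← integral_indicator measurableSet_Ioc]
    rfl
  rw [e]
  refine (StronglyMeasurable.integral_prod_right' (f := ({q : (ℝ × Ω) × ℝ | 0 < q.2 ∧
    q.2 ≤ q.1.1}.indicator fun q => kernel A B q.2 q.1.1 q.1.2 * f q.2 q.1.2)) ?_).measurable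
  refine Measurable.stronglyMeasurable (Measurable.indicator ?_ ?_)
  · exact ((measurable_kernel hA hB).comp
      (((measurable_snd.prodMk (measurable_fst.comp measurable_fst)).prodMk
        (measurable_snd.comp measurable_fst)))).mul
      (hf.comp (measurable_snd.prodMk (measurable_snd.comp measurable_fst)))
  · exact (measurableSet_lt measurable_const measurable_snd).inter
      (measurableSet_le measurable_snd (measurable_fst.comp measurable_fst))

theorem integrableOn_kernel_mul {ω : Ω} (hω : Integrable (fun t => f t ω) (timeMeasure T)) (t : ℝ) :
    IntegrableOn (fun s => kernel A B s t ω * f s ω) (Icc 0 T) := by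
  have h1 : IntegrableOn (fun s => f s ω) (Icc 0 T) := by
    rw [integrableOn_Icc_iff_integrableOn_Ioo]; exact hω
  exact h1.continuousOn_mul (continuous_kernel_left hA hB t ω).continuousOn isCompact_Icc

theorem continuousOn_linSol {ω : Ω} (hω : Integrable (fun t => f t ω) (timeMeasure T)) :
    ContinuousOn (fun t => linSol A B f t ω) (Icc 0 T) := by
  simp_rw [linSol_eq]
  exact (continuous_kernel_right hA hB 0 ω).continuousOn.mul
    (intervalIntegral.continuousOn_primitive (integrableOn_kernel_mul hA hB hω 0))

/-- Solving up to time `s` and restarting from there gives the solution at time `t`. -/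
theorem linSol_flow {ω : Ω} (hω : Integrable (fun t => f t ω) (timeMeasure T)) {s t : ℝ}
    (hs : 0 ≤ s) (hst : s ≤ t) (ht : t ≤ T) :
    linSol A B f t ω = kernel A B s t ω * linSol A B f s ω +
      ∫ q in Ioc s t, kernel A B q t ω * f q ω := by
  have hi := integrableOn_kernel_mul hA hB hω t
  have e : kernel A B s t ω * linSol A B f s ω = ∫ q in Ioc 0 s, kernel A B q t ω * f q ω := by
    unfold linSol
    rw [← integral_const_mul]
    refine integral_congr_ae (Eventually.of_forall fun q => ?_)
    simp only
    rw [← mul_assoc, mul_comm (kernel A B s t ω), kernel_mul_kernel]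
  rw [e]
  unfold linSol
  rw [← Ioc_union_Ioc_eq_Ioc hs hst, setIntegral_union (Ioc_disjoint_Ioc_of_le le_rfl)
    measurableSet_Ioc]
  · exact hi.mono_set fun x hx => ⟨hx.1.le, hx.2.trans (hst.trans ht)⟩
  · exact hi.mono_set fun x hx => ⟨hs.trans hx.1.le, hx.2.trans ht⟩

theorem eLpNorm_integral_kernel_le [SFinite P] (hf : IsForcing 𝓕 P T p f) {K : ℝ}
    (hK : ∀ t ∈ Icc 0 T, |A t| ≤ K)
    (hp : 1 ≤ p) {s t : ℝ} (hs : 0 ≤ s) (ht : t ≤ T) :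
    eLpNorm (fun ω => ∫ q in Ioc s t, kernel A B q t ω * f q ω) (ENNReal.ofReal p) P ≤
      ENNReal.ofReal (Real.exp (2 * K + (p - 1) * T / 2)) *
        ∫⁻ q in Ioc s t, eLpNorm (f q) (ENNReal.ofReal p) P := by
  refine (eLpNorm_integral_le (measurable_kernel_mul hA hB hf.meas t) hp).trans ?_
  rw [← lintegral_const_mul' _ _ ENNReal.ofReal_ne_top]
  refine lintegral_mono_ae ?_
  have hle : volume.restrict (Ioc s t) ≤ timeMeasure T := by
    rw [← timeMeasure_eq_Ioc]
    exact Measure.restrict_mono (Ioc_subset_Ioc hs ht) le_rfl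
  filter_upwards [hle.absolutelyContinuous hf.adapted, ae_restrict_mem measurableSet_Ioc]
    with q hq hqm
  exact eLpNorm_kernel_mul_le hA hB hK hp (hs.trans hqm.1.le) hqm.2 ht hq

/-- The a priori estimate for the solution: its `L^p` norm is bounded on `[0,T]` by the
`L¹(0,T; L^p)` norm of the forcing. -/
theorem eLpNorm_linSol_le [SFinite P] (hf : IsForcing 𝓕 P T p f) {K : ℝ}
    (hK : ∀ t ∈ Icc 0 T, |A t| ≤ K)
    (hp : 1 ≤ p) {t : ℝ} (ht : t ≤ T) :
    eLpNorm (linSol A B f t) (ENNReal.ofReal p) P ≤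
      ENNReal.ofReal (Real.exp (2 * K + (p - 1) * T / 2)) *
        ∫⁻ q in Ioo 0 T, eLpNorm (f q) (ENNReal.ofReal p) P := by
  refine (eLpNorm_integral_kernel_le hA hB hf hK hp le_rfl ht).trans ?_
  rw [timeMeasure_eq_Ioc]
  exact mul_le_mul_right (lintegral_mono' (timeMeasure_mono ht) le_rfl) _

omit hB in
theorem exists_abs_le (T : ℝ) : ∃ K, ∀ t ∈ Icc 0 T, |A t| ≤ K := by
  obtain ⟨K, hK⟩ := isCompact_Icc.exists_bound_of_continuousOn (hA.continuousOn (s := Icc 0 T))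
  exact ⟨K, hK⟩

/-- Adaptedness of the solution does not need progressive measurability of the forcing. -/
theorem adapted_linSol [IsProbabilityMeasure P] (hf : IsForcing 𝓕 P T p f) (hp : 1 ≤ p) {t : ℝ}
    (ht : t ≤ T) : AEStronglyMeasurable[𝓕 t.toNNReal] (linSol A B f t) P := by
  obtain ⟨K, hK⟩ := exists_abs_le hA T
  have hle := timeMeasure_mono ht
  have h1 := hf.mono_exponent hp
  have hac := hle.absolutelyContinuous h1.adapted
  have hm : ∀ᵐ s ∂timeMeasure t, s ∈ Ioo 0 t := ae_restrict_mem measurableSet_Ioo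
  have e : linSol A B f t = fun ω => ∫ s, kernel A B s t ω * f s ω ∂timeMeasure t := by
    ext ω
    rw [← timeMeasure_eq_Ioc]; rfl
  rw [e]
  refine aestronglyMeasurable_integral_of_ae (𝓕.le _) ?_ ?_
  · have hmeas := measurable_kernel_mul hA hB hf.meas t
    refine ⟨hmeas.aestronglyMeasurable, ?_⟩
    rw [hasFiniteIntegral_iff_enorm, lintegral_prod _ hmeas.enorm.aemeasurable]
    have hb : ∀ᵐ s ∂timeMeasure t, ∫⁻ ω, ‖kernel A B s t ω * f s ω‖ₑ ∂P ≤
        ENNReal.ofReal (Real.exp (2 * K + (1 - 1) * T / 2)) * eLpNorm (f s) (ENNReal.ofReal 1) P := by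
      filter_upwards [hac, hm] with s hs hsm
      have := eLpNorm_kernel_mul_le hA hB hK le_rfl hsm.1.le hsm.2.le ht hs
      rwa [show eLpNorm (fun ω => kernel A B s t ω * f s ω) (ENNReal.ofReal 1) P =
        ∫⁻ ω, ‖kernel A B s t ω * f s ω‖ₑ ∂P by
          rw [ENNReal.ofReal_one, eLpNorm_one_eq_lintegral_enorm]] at this
    refine lt_of_le_of_lt (lintegral_mono_ae hb) ?_
    rw [lintegral_const_mul' _ _ ENNReal.ofReal_ne_top]
    exact ENNReal.mul_lt_top ENNReal.ofReal_lt_top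
      (lt_of_le_of_lt (lintegral_mono' hle le_rfl) h1.finite)
  · filter_upwards [hac, hm] with s hs hsm
    exact (aestronglyMeasurable_kernel hB hsm.1.le hsm.2.le).mul
      (hs.mono (𝓕.mono (Real.toNNReal_le_toNNReal hsm.2.le)))

theorem memLp_linSol [IsProbabilityMeasure P] (hf : IsForcing 𝓕 P T p f) (hp : 1 ≤ p) {t : ℝ}
    (ht : t ≤ T) : MemLp (linSol A B f t) (ENNReal.ofReal p) P := by
  obtain ⟨K, hK⟩ := exists_abs_le hA T
  refine ⟨(adapted_linSol hA hB hf hp ht).mono (𝓕.le _), ?_⟩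
  exact lt_of_le_of_lt (eLpNorm_linSol_le hA hB hf hK hp ht)
    (ENNReal.mul_lt_top ENNReal.ofReal_lt_top hf.finite)

end Kernel

/-! ### One step of the Euler scheme -/

/-- `L²`-modulus of continuity of the stochastic exponential. -/
noncomputable def expModulus (h : ℝ) : ℝ≥0∞ := ENNReal.ofReal (Real.sqrt (Real.exp h - 1))

theorem expModulus_mono {h h' : ℝ} (hh : h ≤ h') : expModulus h ≤ expModulus h' := by
  unfold expModulus
  gcongr

theorem continuous_expModulus : Continuous expModulus := by
  exact ENNReal.continuous_ofReal.comp (by fun_prop)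

theorem expModulus_zero : expModulus 0 = 0 := by simp [expModulus]

/-- Approximation in `L²` by bounded functions that are measurable for the sub-σ-algebra `m`. -/
theorem exists_simple_approx {Ω : Type*} {m mΩ : MeasurableSpace Ω} {P : Measure Ω} (hm : m ≤ mΩ)
    {c : Ω → ℝ} (hc : MemLp c 2 P) (hcm : AEStronglyMeasurable[m] c P) {ε : ℝ≥0∞} (hε : ε ≠ 0) :
    ∃ d : Ω → ℝ, Measurable[m] d ∧ (∃ K : ℝ, ∀ ω, |d ω| ≤ K) ∧
      eLpNorm (fun ω => c ω - d ω) 2 P ≤ ε := by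
  have hmk := hcm.stronglyMeasurable_mk
  have h1 : MemLp (hcm.mk c) 2 (P.trim hm) := by
    refine ⟨hmk.aestronglyMeasurable, ?_⟩
    rw [eLpNorm_trim hm hmk, ← eLpNorm_congr_ae hcm.ae_eq_mk]
    exact hc.2
  obtain ⟨d, hd, hdm⟩ := @MemLp.exists_simpleFunc_eLpNorm_sub_lt Ω m 2 ℝ _ _ (P.trim hm) h1 (by simp) ε hε
  refine ⟨d, @SimpleFunc.measurable Ω ℝ m _ d, ?_, ?_⟩
  · obtain ⟨K, hK⟩ := @SimpleFunc.exists_forall_norm_le Ω ℝ m _ d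
    exact ⟨K, fun ω => by simpa using hK ω⟩
  · rw [eLpNorm_trim hm (hmk.sub (@SimpleFunc.stronglyMeasurable Ω ℝ m _ d))] at hd
    refine le_trans (le_of_eq (eLpNorm_congr_ae ?_)) hd.le
    filter_upwards [hcm.ae_eq_mk] with ω h
    simp [← h]

section

variable (hB : IsContinuousVersion 𝓕 P W B)
include hB

theorem eLpNorm_kernel_sub_one {s t : ℝ} (hs : 0 ≤ s) (hst : s ≤ t) :
    eLpNorm (fun ω => kernel (fun _ => 0) B s t ω - 1) 2 P = expModulus (t - s) := by
  have hv : ((t - s).toNNReal : ℝ) = t - s := Real.coe_toNNReal _ (sub_nonneg.2 hst)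
  have e : (fun ω => kernel (fun _ => 0) B s t ω - 1) =
      fun ω => Real.exp ((B t ω - B s ω) - ((t - s).toNNReal : ℝ) / 2) - 1 := by
    ext ω; simp only [kernel, hv]; congr 2; ring
  rw [e, hB.eLpNorm_comp_increment hs hst
    (g := fun x => Real.exp (x - ((t - s).toNNReal : ℝ) / 2) - 1) (by fun_prop)]
  have h := sq_eLpNorm_exp_sub_one_gaussianReal (t - s).toNNReal
  refine (ENNReal.pow_right_strictMono two_ne_zero).injective ?_
  have h0 : 0 ≤ Real.exp (t - s) - 1 := by
    have := Real.add_one_le_exp (t - s); linarith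
  rw [h, hv, expModulus, ← ENNReal.ofReal_pow (Real.sqrt_nonneg _), Real.sq_sqrt h0]

variable {T : ℝ} {g : ℝ → Ω → ℝ}

/-- The error in one step of the Euler scheme for `dX = g dt + X dB`. -/
theorem linSol_increment {ω : Ω} (hω : Integrable (fun t => g t ω) (timeMeasure T)) {s t : ℝ}
    (hs : 0 ≤ s) (hst : s ≤ t) (ht : t ≤ T) :
    linSol (fun _ => 0) B g t ω - linSol (fun _ => 0) B g s ω - (∫ q in Ioc s t, g q ω) -
      linSol (fun _ => 0) B g s ω * (B t ω - B s ω) =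
    linSol (fun _ => 0) B g s ω * expDefect (t - s) (B t ω - B s ω) +
      ∫ q in Ioc s t, (kernel (fun _ => 0) B q t ω - 1) * g q ω := by
  have hsub : Ioc s t ⊆ Icc 0 T := fun x hx => ⟨hs.trans hx.1.le, hx.2.trans ht⟩
  have h1 : IntegrableOn (fun s => g s ω) (Icc 0 T) := by
    rw [integrableOn_Icc_iff_integrableOn_Ioo]; exact hω
  have hi := (integrableOn_kernel_mul (A := fun _ => 0) continuous_const hB hω t).mono_set hsub
  have e : ∫ q in Ioc s t, (kernel (fun _ => 0) B q t ω - 1) * g q ω =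
      (∫ q in Ioc s t, kernel (fun _ => 0) B q t ω * g q ω) - ∫ q in Ioc s t, g q ω := by
    rw [← integral_sub hi (h1.mono_set hsub)]
    refine integral_congr_ae (Eventually.of_forall fun q => ?_)
    simp only; ring
  have e2 : expDefect (t - s) (B t ω - B s ω) =
      kernel (fun _ => 0) B s t ω - 1 - (B t ω - B s ω) := by
    simp [kernel, expDefect]
  rw [e, e2, linSol_flow continuous_const hB hω hs hst ht]
  ring

/-- The effect of freezing the forcing over one step: an integral over the step times a factor that
vanishes with the mesh. -/
theorem eLpNorm_integral_kernel_sub_one_le [SFinite P] (hg : IsForcing 𝓕 P T 2 g) {s t : ℝ}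
    (hs : 0 ≤ s) (ht : t ≤ T) :
    eLpNorm (fun ω => ∫ q in Ioc s t, (kernel (fun _ => 0) B q t ω - 1) * g q ω) 2 P ≤
      expModulus (t - s) * ∫⁻ q in Ioc s t, eLpNorm (g q) 2 P := by
  have hmeas : Measurable (Function.uncurry fun q ω => (kernel (fun _ => 0) B q t ω - 1) * g q ω) :=
    (((measurable_kernel continuous_const hB).comp
      ((measurable_fst.prodMk measurable_const).prodMk measurable_snd)).sub_const 1).mul hg.meas
  have h := eLpNorm_integral_le (P := P) (μ := volume.restrict (Ioc s t)) hmeas (p := 2)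
    (by norm_num)
  rw [ofReal_two] at h
  refine h.trans ?_
  rw [← lintegral_const_mul' _ _ (show expModulus (t - s) ≠ ⊤ from ENNReal.ofReal_ne_top)]
  refine lintegral_mono_ae ?_
  have hle : volume.restrict (Ioc s t) ≤ timeMeasure T := by
    rw [← timeMeasure_eq_Ioc]
    exact Measure.restrict_mono (Ioc_subset_Ioc hs ht) le_rfl
  filter_upwards [hle.absolutelyContinuous hg.adapted, ae_restrict_mem measurableSet_Ioc]
    with q hq hqm
  have hq0 : 0 ≤ q := hs.trans hqm.1.le
  have hi : IndepFun (fun ω => kernel (fun _ => 0) B q t ω - 1) (g q) P :=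
    ((indepFun_kernel hB hq0 hqm.2 hq).comp measurable_id (measurable_id.sub_const 1)).symm
  rw [eLpNorm_mul_of_indepFun_two hi
    ((measurable_kernel_apply continuous_const hB q t).sub_const 1).aestronglyMeasurable
    (hq.mono (𝓕.le _)), eLpNorm_kernel_sub_one hB hq0 hqm.2]
  gcongr
  exact expModulus_mono (by linarith [hqm.1])

theorem memLp_two_linSol [IsProbabilityMeasure P] (hg : IsForcing 𝓕 P T 2 g) {t : ℝ} (ht : t ≤ T) :
    MemLp (linSol (fun _ => 0) B g t) 2 P := by
  have := memLp_linSol (A := fun _ => 0) continuous_const hB hg one_le_two ht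
  rwa [ofReal_two] at this

/-- The martingale part of the accumulated errors of the Euler scheme: the summands are orthogonal
and of first order in the mesh. -/
theorem sq_eLpNorm_sum_linSol_mul_expDefect_le [IsProbabilityMeasure P] (hg : IsForcing 𝓕 P T 2 g)
    {N : ℝ≥0∞} (hN : ∀ t ∈ Icc 0 T, eLpNorm (linSol (fun _ => 0) B g t) 2 P ≤ N)
    {τ : ℕ → ℝ} (hτ : Monotone τ) (hτ0 : ∀ i, 0 ≤ τ i) (hτT : ∀ i, τ i ≤ T) {h : ℝ} (h1 : h ≤ 1)
    (hh : ∀ i, τ (i + 1) - τ i ≤ h) (n : ℕ) :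
    eLpNorm (fun ω => ∑ i ∈ Finset.range n, linSol (fun _ => 0) B g (τ i) ω *
      expDefect (τ (i + 1) - τ i) (B (τ (i + 1)) ω - B (τ i) ω)) 2 P ^ 2 ≤
      n * (N ^ 2 * ENNReal.ofReal (h ^ 2)) := by
  have hle : ∀ i, τ i ≤ τ (i + 1) := fun i => hτ (Nat.le_succ i)
  have hv : ∀ i, ((τ (i + 1) - τ i).toNNReal : ℝ) = τ (i + 1) - τ i := fun i =>
    Real.coe_toNNReal _ (sub_nonneg.2 (hle i))
  have hXm := fun i => memLp_two_linSol hB hg (hτT i)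
  have hXa := fun i => adapted_linSol (A := fun _ => 0) continuous_const hB hg one_le_two (hτT i)
  have hGm : ∀ i, MemLp (fun ω => expDefect (τ (i + 1) - τ i) (B (τ (i + 1)) ω - B (τ i) ω)) 2 P := by
    intro i
    refine hB.memLp_comp_increment (hτ0 i) (hle i) (measurable_expDefect _) ?_
    have := memLp_expDefect (τ (i + 1) - τ i).toNNReal
    rwa [hv] at this
  have hind : ∀ i, IndepFun (linSol (fun _ => 0) B g (τ i))
      (fun ω => expDefect (τ (i + 1) - τ i) (B (τ (i + 1)) ω - B (τ i) ω)) P := fun i =>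
    (hB.indep _ _ (hτ0 i) (hle i) _ (hXa i)).comp measurable_id (measurable_expDefect _)
  have hm : ∀ i, MemLp (fun ω => linSol (fun _ => 0) B g (τ i) ω *
      expDefect (τ (i + 1) - τ i) (B (τ (i + 1)) ω - B (τ i) ω)) 2 P := fun i =>
    memLp_mul_of_indepFun (hind i) (hXm i) (hGm i)
  have horth : ∀ i j, i < j → ∫ ω, (linSol (fun _ => 0) B g (τ i) ω *
      expDefect (τ (i + 1) - τ i) (B (τ (i + 1)) ω - B (τ i) ω)) *
      (linSol (fun _ => 0) B g (τ j) ω *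
      expDefect (τ (j + 1) - τ j) (B (τ (j + 1)) ω - B (τ j) ω)) ∂P = 0 := by
    intro i j hij
    have hij' : τ (i + 1) ≤ τ j := hτ hij
    have m1 : AEStronglyMeasurable[𝓕 (τ j).toNNReal] (fun ω => linSol (fun _ => 0) B g (τ i) ω *
        expDefect (τ (i + 1) - τ i) (B (τ (i + 1)) ω - B (τ i) ω) *
        linSol (fun _ => 0) B g (τ j) ω) P := by
      refine AEStronglyMeasurable.mul (AEStronglyMeasurable.mul ?_ ?_) (hXa j)
      · exact (hXa i).mono (𝓕.mono (Real.toNNReal_le_toNNReal (hτ hij.le)))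
      · have := (hB.adapted_of_le (hτ0 (i + 1)) hij').sub (hB.adapted_of_le (hτ0 i) (hτ hij.le))
        exact Continuous.comp_aestronglyMeasurable (g := expDefect (τ (i + 1) - τ i))
          (by unfold expDefect; fun_prop) this
    have h0 := hB.integral_mul_comp_increment (hτ0 j) (hle j)
      (measurable_expDefect (τ (j + 1) - τ j)) m1
    have h2 := integral_expDefect (τ (j + 1) - τ j).toNNReal
    rw [hv] at h2
    rw [h2, mul_zero] at h0
    refine Eq.trans (integral_congr_ae (Eventually.of_forall fun ω => ?_)) h0
    simp only
    ring
  rw [sq_eLpNorm_sum_of_orthogonal _ _ (fun i _ => hm i) (fun i _ j _ hij => by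
    rcases lt_or_gt_of_ne hij with h | h
    · exact horth i j h
    · exact Eq.trans (integral_congr_ae (Eventually.of_forall fun ω => mul_comm _ _))
        (horth j i h))]
  calc ∑ i ∈ Finset.range n, eLpNorm (fun ω => linSol (fun _ => 0) B g (τ i) ω *
        expDefect (τ (i + 1) - τ i) (B (τ (i + 1)) ω - B (τ i) ω)) 2 P ^ 2
      ≤ ∑ i ∈ Finset.range n, N ^ 2 * ENNReal.ofReal (h ^ 2) := by
        refine Finset.sum_le_sum fun i _ => ?_
        rw [eLpNorm_mul_of_indepFun_two (hind i) (hXm i).1 (hGm i).1, mul_pow]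
        gcongr
        · exact hN _ ⟨hτ0 i, hτT i⟩
        · rw [hB.eLpNorm_comp_increment (hτ0 i) (hle i) (measurable_expDefect _)]
          have := sq_eLpNorm_expDefect (τ (i + 1) - τ i).toNNReal
          rw [hv] at this
          rw [this]
          refine ENNReal.ofReal_le_ofReal ?_
          have h0 : 0 ≤ τ (i + 1) - τ i := sub_nonneg.2 (hle i)
          have h3 : |τ (i + 1) - τ i| ≤ 1 := by rw [abs_of_nonneg h0]; exact (hh i).trans h1
          have h4 := (abs_le.1 (Real.abs_exp_sub_one_sub_id_le h3)).2
          refine h4.trans ?_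
          exact pow_le_pow_left₀ h0 (hh i) 2
    _ = _ := by rw [Finset.sum_const, Finset.card_range, nsmul_eq_mul]

/-- The part of the errors of the Euler scheme due to the forcing. -/
theorem eLpNorm_sum_integral_le [SFinite P] (hg : IsForcing 𝓕 P T 2 g)
    {τ : ℕ → ℝ} (hτ : Monotone τ) (hτ0 : ∀ i, 0 ≤ τ i) (hτT : ∀ i, τ i ≤ T) {h : ℝ}
    (hh : ∀ i, τ (i + 1) - τ i ≤ h) (n : ℕ) :
    eLpNorm (fun ω => ∑ i ∈ Finset.range n,
      ∫ q in Ioc (τ i) (τ (i + 1)), (kernel (fun _ => 0) B q (τ (i + 1)) ω - 1) * g q ω) 2 P ≤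
      expModulus h * ∫⁻ q in Ioo 0 T, eLpNorm (g q) 2 P := by
  have hmeas : ∀ t, Measurable
      (Function.uncurry fun q ω => (kernel (fun _ => 0) B q t ω - 1) * g q ω) := fun t =>
    (((measurable_kernel continuous_const hB).comp
      ((measurable_fst.prodMk measurable_const).prodMk measurable_snd)).sub_const 1).mul hg.meas
  have hsm : ∀ i, AEStronglyMeasurable (fun ω => ∫ q in Ioc (τ i) (τ (i + 1)),
      (kernel (fun _ => 0) B q (τ (i + 1)) ω - 1) * g q ω) P := fun i =>
    ((hmeas (τ (i + 1))).stronglyMeasurable.integral_prod_left).aestronglyMeasurable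
  have e : (fun ω => ∑ i ∈ Finset.range n, ∫ q in Ioc (τ i) (τ (i + 1)),
      (kernel (fun _ => 0) B q (τ (i + 1)) ω - 1) * g q ω) =
      ∑ i ∈ Finset.range n, fun ω => ∫ q in Ioc (τ i) (τ (i + 1)),
      (kernel (fun _ => 0) B q (τ (i + 1)) ω - 1) * g q ω := by
    ext ω; simp
  rw [e]
  refine (eLpNorm_sum_le (fun i _ => hsm i) one_le_two).trans ?_
  have hsum : ∑ i ∈ Finset.range n, ∫⁻ q in Ioc (τ i) (τ (i + 1)), eLpNorm (g q) 2 P =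
      ∫⁻ q in Ioc (τ 0) (τ n), eLpNorm (g q) 2 P := by
    induction n with
    | zero => simp
    | succ k ih =>
      rw [Finset.sum_range_succ, ih (by ext ω; simp),
        ← Ioc_union_Ioc_eq_Ioc (hτ (Nat.zero_le k)) (hτ (Nat.le_succ k)),
        lintegral_union measurableSet_Ioc (Ioc_disjoint_Ioc_of_le le_rfl)]
  calc ∑ i ∈ Finset.range n, eLpNorm (fun ω => ∫ q in Ioc (τ i) (τ (i + 1)),
        (kernel (fun _ => 0) B q (τ (i + 1)) ω - 1) * g q ω) 2 P
      ≤ ∑ i ∈ Finset.range n, expModulus h * ∫⁻ q in Ioc (τ i) (τ (i + 1)), eLpNorm (g q) 2 P := by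
        refine Finset.sum_le_sum fun i _ => ?_
        refine (eLpNorm_integral_kernel_sub_one_le hB hg (hτ0 i) (hτT _)).trans ?_
        gcongr
        exact expModulus_mono (hh i)
    _ = expModulus h * ∫⁻ q in Ioc (τ 0) (τ n), eLpNorm (g q) 2 P := by
        rw [← Finset.mul_sum, hsum]
    _ ≤ _ := by
        rw [← timeMeasure, ← timeMeasure_eq_Ioc]
        exact mul_le_mul_right (lintegral_mono_set (Ioc_subset_Ioc (hτ0 0) (hτT n))) _

/-- Continuity in time of the solution, in `L²(Ω)`. -/
theorem eLpNorm_linSol_sub_le [IsProbabilityMeasure P] (hg : IsForcing 𝓕 P T 2 g)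
    {N : ℝ≥0∞} (hN : ∀ t ∈ Icc 0 T, eLpNorm (linSol (fun _ => 0) B g t) 2 P ≤ N) {s t : ℝ}
    (hs : 0 ≤ s) (hst : s ≤ t) (ht : t ≤ T) :
    eLpNorm (fun ω => linSol (fun _ => 0) B g t ω - linSol (fun _ => 0) B g s ω) 2 P ≤
      N * expModulus (t - s) +
        ENNReal.ofReal (Real.exp (T / 2)) * ∫⁻ q in Ioc s t, eLpNorm (g q) 2 P := by
  have hXa := adapted_linSol (A := fun _ => 0) continuous_const hB hg one_le_two (hst.trans ht)
  have hKm := (measurable_kernel_apply (A := fun _ => 0) continuous_const hB s t)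
  have e : (fun ω => linSol (fun _ => 0) B g t ω - linSol (fun _ => 0) B g s ω) =ᵐ[P]
      (fun ω => linSol (fun _ => 0) B g s ω * (kernel (fun _ => 0) B s t ω - 1)) +
      fun ω => ∫ q in Ioc s t, kernel (fun _ => 0) B q t ω * g q ω := by
    filter_upwards [hg.ae_integrable one_le_two] with ω hω
    simp only [Pi.add_apply]
    rw [linSol_flow continuous_const hB hω hs hst ht]
    ring
  rw [eLpNorm_congr_ae e]
  have m1 : AEStronglyMeasurable (fun ω => linSol (fun _ => 0) B g s ω *
      (kernel (fun _ => 0) B s t ω - 1)) P :=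
    (hXa.mono (𝓕.le _)).mul (hKm.sub_const 1).aestronglyMeasurable
  have m2 : AEStronglyMeasurable (fun ω => ∫ q in Ioc s t, kernel (fun _ => 0) B q t ω * g q ω) P :=
    ((measurable_kernel_mul continuous_const hB
      hg.meas t).stronglyMeasurable.integral_prod_left).aestronglyMeasurable
  refine (eLpNorm_add_le m1 m2 one_le_two).trans ?_
  gcongr
  · have hi : IndepFun (linSol (fun _ => 0) B g s) (fun ω => kernel (fun _ => 0) B s t ω - 1) P :=
      (indepFun_kernel hB hs hst hXa).comp measurable_id (measurable_id.sub_const 1)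
    rw [eLpNorm_mul_of_indepFun_two hi (hXa.mono (𝓕.le _)) (hKm.sub_const 1).aestronglyMeasurable]
    rw [eLpNorm_kernel_sub_one hB hs hst]
    gcongr
    exact hN s ⟨hs, hst.trans ht⟩
  · have := eLpNorm_integral_kernel_le (A := fun _ => 0) continuous_const hB hg (K := 0)
      (by simp) one_le_two hs ht
    rw [ofReal_two] at this
    refine this.trans (le_of_eq ?_)
    congr 3
    ring

end

/-! ### The Itô integral of the explicit solution -/

theorem SimpleAdapted.value_eq_of_mem (S : SimpleAdapted 𝓕) {i : ℕ} (hi : i < S.N) {t : ℝ}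
    (ht : t ∈ Ioc (S.time i : ℝ) (S.time (i + 1))) (ω : Ω) : S.value t ω = S.coeff i ω := by
  unfold SimpleAdapted.value
  rw [Finset.sum_eq_single i]
  · exact indicator_of_mem ht _
  · intro j _ hj
    refine indicator_of_notMem (fun h => ?_) _
    have hm : Monotone fun i => (S.time i : ℝ) := fun a b hab => NNReal.coe_le_coe.2 (S.mono hab)
    exact Set.disjoint_left.1 (hm.pairwise_disjoint_on_Ioc_succ hj) h ht
  · intro h; exact absurd (Finset.mem_range.2 hi) h

section

variable (hB : IsContinuousVersion 𝓕 P W B) {T : ℝ} {g : ℝ → Ω → ℝ}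
include hB

/-- The Euler scheme of mesh `h`, with coefficients truncated to bounded random variables. -/
theorem exists_simple_scheme [IsProbabilityMeasure P] (hg : IsForcing 𝓕 P T 2 g) {h : ℝ}
    (hh : 0 ≤ h) (m : ℕ) {ε : ℝ≥0∞} (hε : ε ≠ 0) :
    ∃ S : SimpleAdapted 𝓕, S.N = m ∧ (∀ i, (S.time i : ℝ) = i * h) ∧ ∀ i : ℕ, i * h ≤ T →
      eLpNorm (fun ω => linSol (fun _ => 0) B g (i * h) ω - S.coeff i ω) 2 P ≤ ε := by
  have key : ∀ i : ℕ, ∃ d : Ω → ℝ, Measurable[𝓕 (i * h).toNNReal] d ∧ (∃ K : ℝ, ∀ ω, |d ω| ≤ K) ∧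
      (i * h ≤ T → eLpNorm (fun ω => linSol (fun _ => 0) B g (i * h) ω - d ω) 2 P ≤ ε) := by
    intro i
    by_cases hi : i * h ≤ T
    · obtain ⟨d, h1, h2, h3⟩ := exists_simple_approx (𝓕.le (i * h).toNNReal)
        (memLp_two_linSol hB hg hi)
        (adapted_linSol (A := fun _ => 0) continuous_const hB hg one_le_two hi) hε
      exact ⟨d, h1, h2, fun _ => h3⟩
    · exact ⟨0, measurable_const, ⟨0, by simp⟩, fun h => absurd h hi⟩
  choose d h1 h2 h3 using key
  exact ⟨⟨m, fun i => (i * h).toNNReal, fun i j hij => Real.toNNReal_le_toNNReal (by gcongr), d,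
    h1, h2⟩, rfl, fun i => Real.coe_toNNReal _ (by positivity), h3⟩

variable {S : SimpleAdapted 𝓕} {h : ℝ} {ε N : ℝ≥0∞}

/-- The values of the Euler scheme converge to the solution in `L²((0,T) × Ω)`, with an explicit
rate in terms of the modulus `w` of absolute continuity of the forcing. -/
theorem sq_eLpNorm_sub_scheme_le [IsProbabilityMeasure P] (hg : IsForcing 𝓕 P T 2 g) (hh : 0 < h)
    (hSN : S.N * h = T) (hS : ∀ i, (S.time i : ℝ) = i * h)
    (hε : ∀ i : ℕ, i * h ≤ T →
      eLpNorm (fun ω => linSol (fun _ => 0) B g (i * h) ω - S.coeff i ω) 2 P ≤ ε)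
    (hN : ∀ t ∈ Icc 0 T, eLpNorm (linSol (fun _ => 0) B g t) 2 P ≤ N) {w : ℝ≥0∞}
    (hw : ∀ t, ∫⁻ q in Ioc (t - h) t, eLpNorm (g q) 2 P ∂timeMeasure T ≤ w) :
    eLpNorm (fun q : ℝ × Ω => linSol (fun _ => 0) B g q.1 q.2 - S.value q.1 q.2) 2
      ((timeMeasure T).prod P) ^ 2 ≤
      (N * expModulus h + ENNReal.ofReal (Real.exp (T / 2)) * w + ε) ^ 2 * ENNReal.ofReal T := by
  have hXm := measurable_linSol (A := fun _ => 0) continuous_const hB hg.meas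
  have hm : Measurable (fun q : ℝ × Ω => linSol (fun _ => 0) B g q.1 q.2 - S.value q.1 q.2) :=
    hXm.sub S.measurable_uncurry_value
  rw [sq_eLpNorm_prod (H := fun t ω => linSol (fun _ => 0) B g t ω - S.value t ω)
    hm.aestronglyMeasurable]
  have hvol : ∫⁻ _ in Ioo 0 T, (N * expModulus h + ENNReal.ofReal (Real.exp (T / 2)) * w + ε) ^ 2 =
      (N * expModulus h + ENNReal.ofReal (Real.exp (T / 2)) * w + ε) ^ 2 * ENNReal.ofReal T := by
    rw [setLIntegral_const, Real.volume_Ioo, sub_zero]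
  rw [← hvol]
  refine setLIntegral_mono measurable_const fun t ht => ?_
  gcongr
  -- the cell of the partition containing `t`
  have hpos : 0 < t / h := div_pos ht.1 hh
  set i := ⌈t / h⌉₊ - 1 with hi
  have hc : i + 1 = ⌈t / h⌉₊ := Nat.succ_pred_eq_of_pos (Nat.ceil_pos.2 hpos)
  have hc1 : t ≤ ((i + 1 : ℕ) : ℝ) * h := by
    rw [hc, ← div_le_iff₀ hh]; exact Nat.le_ceil _
  have hc2 : (i : ℝ) * h < t := by
    rw [← lt_div_iff₀ hh]
    exact Nat.lt_ceil.1 (by omega)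
  have hiN : i < S.N := by
    have : (i : ℝ) * h < S.N * h := by rw [hSN]; exact hc2.trans ht.2
    exact_mod_cast lt_of_mul_lt_mul_right this hh.le
  have hmem : t ∈ Ioc (S.time i : ℝ) (S.time (i + 1)) := by
    rw [hS, hS]; exact ⟨hc2, hc1⟩
  have hi0 : 0 ≤ (i : ℝ) * h := by positivity
  have e : (fun ω => linSol (fun _ => 0) B g t ω - S.value t ω) =
      (fun ω => linSol (fun _ => 0) B g t ω - linSol (fun _ => 0) B g (i * h) ω) +
      fun ω => linSol (fun _ => 0) B g (i * h) ω - S.coeff i ω := by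
    ext ω
    simp only [Pi.add_apply]
    rw [S.value_eq_of_mem hiN hmem]; ring
  have hXm' : ∀ t, AEStronglyMeasurable (linSol (fun _ => 0) B g t) P := fun t =>
    (hXm.of_uncurry_left).aestronglyMeasurable
  have hth : t - i * h ≤ h := by push_cast at hc1; linarith
  rw [e]
  refine (eLpNorm_add_le ((hXm' t).sub (hXm' _)) ((hXm' _).sub
    ((S.measurable i).mono (𝓕.le _) le_rfl).aestronglyMeasurable) one_le_two).trans ?_
  refine add_le_add ((eLpNorm_linSol_sub_le hB hg hN hi0 hc2.le ht.2.le).trans ?_)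
    (hε i (hc2.le.trans ht.2.le))
  gcongr
  · exact expModulus_mono hth
  · refine le_trans ?_ (hw t)
    rw [Measure.restrict_restrict measurableSet_Ioc]
    refine lintegral_mono_set fun q hq => ⟨⟨by linarith [hq.1], hq.2⟩, hi0.trans_lt hq.1,
      hq.2.trans_lt ht.2⟩

/-- The elementary integrals of the Euler scheme converge in `L²(Ω)`. The error is the sum of the
martingale parts of the one-step errors, of the contributions of the forcing, and of the errors made
in truncating the coefficients. -/
theorem eLpNorm_sub_scheme_integral_le [IsProbabilityMeasure P] (hg : IsForcing 𝓕 P T 2 g)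
    (hh : 0 < h) (h1 : h ≤ 1) (hSN : S.N * h = T) (hS : ∀ i, (S.time i : ℝ) = i * h)
    (hε : ∀ i : ℕ, i * h ≤ T →
      eLpNorm (fun ω => linSol (fun _ => 0) B g (i * h) ω - S.coeff i ω) 2 P ≤ ε)
    (hN : ∀ t ∈ Icc 0 T, eLpNorm (linSol (fun _ => 0) B g t) 2 P ≤ N) {t : ℝ}
    (ht : t ∈ Icc 0 T) :
    eLpNorm (fun ω => (linSol (fun _ => 0) B g t ω - ∫ s in Ioc 0 t, g s ω) -
      S.integral W t ω) 2 P ≤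
      N * ENNReal.ofReal (Real.sqrt (T * h)) +
      expModulus h * (∫⁻ q in Ioo 0 T, eLpNorm (g q) 2 P) +
      S.N * (ε * ENNReal.ofReal (Real.sqrt T)) := by
  have hX0 : ∀ ω, linSol (fun _ => 0) B g 0 ω = 0 := fun ω => linSol_zero _ _ _ ω
  have hXm : ∀ t, AEStronglyMeasurable (linSol (fun _ => 0) B g t) P := fun t =>
    ((measurable_linSol (A := fun _ => 0) continuous_const hB
      hg.meas).of_uncurry_left).aestronglyMeasurable
  have hBm : ∀ t, AEStronglyMeasurable (B t) P := fun t =>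
    (hB.measurable_apply t).aestronglyMeasurable
  -- the partition points, stopped at `t`
  let τ : ℕ → ℝ := fun i => min (S.time i : ℝ) t
  have hτ : Monotone τ := fun i j hij => min_le_min_right _ (NNReal.coe_le_coe.2 (S.mono hij))
  have hτ0 : ∀ i, 0 ≤ τ i := fun i => le_min (S.time i).2 ht.1
  have hτT : ∀ i, τ i ≤ T := fun i => (min_le_right _ _).trans ht.2
  have hτh : ∀ i, τ (i + 1) - τ i ≤ h := by
    intro i
    have e : (S.time (i + 1) : ℝ) = S.time i + h := by rw [hS, hS]; push_cast; ring
    simp only [τ, e]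
    rcases le_total (S.time i : ℝ) t with h' | h'
    · rw [min_eq_left h']; linarith [min_le_left ((S.time i : ℝ) + h) t]
    · rw [min_eq_right h']; linarith [min_le_right ((S.time i : ℝ) + h) t]
  have hτz : τ 0 = 0 := by simp [τ, hS, ht.1]
  have hτN : τ S.N = t := by simp only [τ, hS, hSN]; exact min_eq_right ht.2
  have hle : ∀ i, τ i ≤ τ (i + 1) := fun i => hτ (Nat.le_succ i)
  have e : (fun ω => (linSol (fun _ => 0) B g t ω - ∫ s in Ioc 0 t, g s ω) - S.integral W t ω)
      =ᵐ[P]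
      ((fun ω => ∑ i ∈ Finset.range S.N, linSol (fun _ => 0) B g (τ i) ω *
        expDefect (τ (i + 1) - τ i) (B (τ (i + 1)) ω - B (τ i) ω)) +
      (fun ω => ∑ i ∈ Finset.range S.N, ∫ q in Ioc (τ i) (τ (i + 1)),
        (kernel (fun _ => 0) B q (τ (i + 1)) ω - 1) * g q ω)) +
      ∑ i ∈ Finset.range S.N, fun ω => (linSol (fun _ => 0) B g (τ i) ω - S.stopCoeff t i ω) *
        (B (τ (i + 1)) ω - B (τ i) ω) := by
    filter_upwards [hB.ae_eq, hg.ae_integrable one_le_two] with ω hω hi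
    have hgi : IntegrableOn (fun s => g s ω) (Icc 0 T) := by
      rw [integrableOn_Icc_iff_integrableOn_Ioo]; exact hi
    -- `X(t) - ∫₀ᵗ g` is the telescoping sum of its increments over the partition
    let Y : ℝ → ℝ := fun r => linSol (fun _ => 0) B g r ω - ∫ s in Ioc 0 r, g s ω
    have hY : ∀ i, Y (τ (i + 1)) - Y (τ i) = linSol (fun _ => 0) B g (τ (i + 1)) ω -
        linSol (fun _ => 0) B g (τ i) ω - ∫ q in Ioc (τ i) (τ (i + 1)), g q ω := by
      intro i
      simp only [Y]
      rw [← Ioc_union_Ioc_eq_Ioc (hτ0 i) (hle i), setIntegral_union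
        (Ioc_disjoint_Ioc_of_le le_rfl) measurableSet_Ioc]
      · ring
      · exact hgi.mono_set fun x hx => ⟨hx.1.le, hx.2.trans (hτT i)⟩
      · exact hgi.mono_set fun x hx => ⟨(hτ0 i).trans hx.1.le, hx.2.trans (hτT _)⟩
    have hY0 : Y (τ 0) = 0 := by simp [Y, hτz, hX0]
    have htel := Finset.sum_range_sub (fun i => Y (τ i)) S.N
    rw [hY0, sub_zero, hτN] at htel
    simp only [Pi.add_apply, Finset.sum_apply]
    rw [← Finset.sum_add_distrib, ← Finset.sum_add_distrib]
    change Y t - _ = _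
    rw [← htel, S.integral_eq_sum ht.1 hω, ← Finset.sum_sub_distrib]
    refine Finset.sum_congr rfl fun i _ => ?_
    rw [hY, ← linSol_increment hB hi (hτ0 i) (hle i) (hτT _)]
    ring
  rw [eLpNorm_congr_ae e]
  have hinc : ∀ i, eLpNorm (fun ω => B (τ (i + 1)) ω - B (τ i) ω) 2 P ≤
      ENNReal.ofReal (Real.sqrt T) := by
    intro i
    refine (ENNReal.pow_right_strictMono two_ne_zero).le_iff_le.1 ?_
    have hi := hB.integral_mul_sq_increment (P := P) (hτ0 i) (hle i) (c := fun _ => 1)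
      aestronglyMeasurable_const
    simp only [one_mul, integral_const, probReal_univ, smul_eq_mul, mul_one] at hi
    simp only [sq_eLpNorm_two (hB.memLp_increment (hτ0 i) (hle i)), hi]
    rw [← ENNReal.ofReal_pow (Real.sqrt_nonneg _), Real.sq_sqrt (ht.1.trans ht.2)]
    exact ENNReal.ofReal_le_ofReal (by linarith [hτ0 i, hτT (i + 1)])
  have m3 : ∀ i ∈ Finset.range S.N, AEStronglyMeasurable (fun ω =>
      (linSol (fun _ => 0) B g (τ i) ω - S.stopCoeff t i ω) * (B (τ (i + 1)) ω - B (τ i) ω)) P :=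
    fun i _ => ((hXm _).sub ((S.isBlock ht.1 i).adapted.mono (𝓕.le _))).mul
      ((hBm _).sub (hBm _))
  have m1 : AEStronglyMeasurable (fun ω => ∑ i ∈ Finset.range S.N,
      linSol (fun _ => 0) B g (τ i) ω *
        expDefect (τ (i + 1) - τ i) (B (τ (i + 1)) ω - B (τ i) ω)) P :=
    Finset.aestronglyMeasurable_fun_sum _ fun i _ => (hXm _).mul
      ((measurable_expDefect _).comp ((hB.measurable_apply _).sub
        (hB.measurable_apply _))).aestronglyMeasurable
  have m2 : AEStronglyMeasurable (fun ω => ∑ i ∈ Finset.range S.N, ∫ q in Ioc (τ i) (τ (i + 1)),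
        (kernel (fun _ => 0) B q (τ (i + 1)) ω - 1) * g q ω) P := by
    refine Finset.aestronglyMeasurable_fun_sum _ fun i _ => ?_
    have : Measurable (Function.uncurry fun q ω =>
        (kernel (fun _ => 0) B q (τ (i + 1)) ω - 1) * g q ω) :=
      (((measurable_kernel continuous_const hB).comp
        ((measurable_fst.prodMk measurable_const).prodMk measurable_snd)).sub_const 1).mul hg.meas
    exact this.stronglyMeasurable.integral_prod_left.aestronglyMeasurable
  refine (eLpNorm_add_le (m1.add m2) (Finset.aestronglyMeasurable_sum _ m3) one_le_two).trans ?_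
  refine add_le_add ((eLpNorm_add_le m1 m2 one_le_two).trans (add_le_add ?_ ?_)) ?_
  · refine (ENNReal.pow_right_strictMono two_ne_zero).le_iff_le.1 ?_
    refine (sq_eLpNorm_sum_linSol_mul_expDefect_le hB hg hN hτ hτ0 hτT h1 hτh S.N).trans ?_
    have hT0 : 0 ≤ T := ht.1.trans ht.2
    rw [mul_pow, ← ENNReal.ofReal_pow (Real.sqrt_nonneg _), Real.sq_sqrt (by positivity), ← hSN,
      mul_left_comm, ← ENNReal.ofReal_natCast, ← ENNReal.ofReal_mul (Nat.cast_nonneg _)]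
    refine mul_le_mul_right (ENNReal.ofReal_le_ofReal (le_of_eq ?_)) _
    ring
  · exact eLpNorm_sum_integral_le hB hg hτ hτ0 hτT hτh S.N
  · refine (eLpNorm_sum_le m3 one_le_two).trans ?_
    refine (Finset.sum_le_sum (g := fun _ => ε * ENNReal.ofReal (Real.sqrt T)) fun i _ => ?_).trans
      (by rw [Finset.sum_const, Finset.card_range, nsmul_eq_mul])
    by_cases hi : (S.time i : ℝ) ≤ t
    · have e1 : τ i = i * h := by simp only [τ]; rw [min_eq_left hi, hS]
      have hd : IndepFun (fun ω => linSol (fun _ => 0) B g (τ i) ω - S.stopCoeff t i ω)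
          (fun ω => B (τ (i + 1)) ω - B (τ i) ω) P :=
        hB.indep _ _ (hτ0 i) (hle i) _ ((adapted_linSol (A := fun _ => 0) continuous_const hB hg
          one_le_two (hτT i)).sub (S.isBlock ht.1 i).adapted)
      rw [eLpNorm_mul_of_indepFun_two hd ((hXm _).sub ((S.isBlock ht.1 i).adapted.mono (𝓕.le _)))
        ((hBm _).sub (hBm _))]
      refine mul_le_mul' ?_ (hinc i)
      have e2 : S.stopCoeff t i = S.coeff i := by
        ext ω; simp [SimpleAdapted.stopCoeff, hi]
      rw [e2, e1]
      exact hε i (e1 ▸ hτT i)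
    · -- both ends of the interval are stopped at `t`, and the increment vanishes
      have h1 : t ≤ S.time i := (not_le.1 hi).le
      have e1 : τ (i + 1) = τ i := by
        simp only [τ]
        rw [min_eq_right h1, min_eq_right (h1.trans (NNReal.coe_le_coe.2 (S.mono (Nat.le_succ i))))]
      simp [e1]

/-- The explicit solution `X` of `dX = g dt + X dB` satisfies `∫₀ᵗ X dW = X(t) - ∫₀ᵗ g`. -/
theorem isItoIntegral_linSol [IsProbabilityMeasure P] (hg : IsForcing 𝓕 P T 2 g) (hT : 0 < T) :
    IsItoIntegral 𝓕 P W T (linSol (fun _ => 0) B g)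
      (fun t ω => linSol (fun _ => 0) B g t ω - ∫ s in Ioc 0 t, g s ω) := by
  obtain ⟨N, hNtop, hN⟩ : ∃ N : ℝ≥0∞, N ≠ ⊤ ∧
      ∀ t ∈ Icc 0 T, eLpNorm (linSol (fun _ => 0) B g t) 2 P ≤ N := by
    refine ⟨ENNReal.ofReal (Real.exp (2 * 0 + (2 - 1) * T / 2)) *
      ∫⁻ q in Ioo 0 T, eLpNorm (g q) (ENNReal.ofReal 2) P,
      ENNReal.mul_ne_top ENNReal.ofReal_ne_top hg.finite.ne, fun t ht => ?_⟩
    have := eLpNorm_linSol_le (A := fun _ => 0) continuous_const hB hg (K := 0) (by simp)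
      one_le_two ht.2
    rw [ofReal_two] at this ⊢
    exact this
  have hfin : ∫⁻ t in Ioo 0 T, eLpNorm (g t) 2 P ≠ ⊤ := by
    have := hg.finite.ne
    rwa [ofReal_two] at this
  let h : ℕ → ℝ := fun n => T / ((n + 1 : ℕ) : ℝ)
  have hh : ∀ n, 0 < h n := fun n => by positivity
  -- the truncation errors of all `n + 1` coefficients together still vanish in the limit
  let ε : ℕ → ℝ≥0∞ := fun n => ENNReal.ofReal (1 / ((n + 1 : ℕ) : ℝ) ^ 2)
  have hε0 : ∀ n, ε n ≠ 0 := fun n => (ENNReal.ofReal_pos.2 (by positivity)).ne'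
  have hc : ∀ n, ((n + 1 : ℕ) : ℝ) * h n = T := fun n => by
    simp only [h]; field_simp
  choose S hSN hS hε using fun n => exists_simple_scheme hB hg (hh n).le (n + 1) (hε0 n)
  have hcast : Tendsto (fun n : ℕ => ((n + 1 : ℕ) : ℝ)) atTop atTop :=
    tendsto_natCast_atTop_atTop.comp (tendsto_add_atTop_nat 1)
  have hhlim : Tendsto h atTop (𝓝 0) := hcast.const_div_atTop T
  have hinv : Tendsto (fun n : ℕ => 1 / ((n + 1 : ℕ) : ℝ)) atTop (𝓝 0) := hcast.const_div_atTop 1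
  have hεlim : Tendsto ε atTop (𝓝 0) := by
    rw [← ENNReal.ofReal_zero]
    refine ENNReal.tendsto_ofReal ?_
    simpa [one_div, inv_pow] using hinv.pow 2
  have hElim : Tendsto (fun n => expModulus (h n)) atTop (𝓝 0) := by
    have := (continuous_expModulus.tendsto 0).comp hhlim
    rwa [expModulus_zero] at this
  refine ⟨S, ?_, fun t ht => ⟨?_, ?_⟩⟩
  · -- the modulus of absolute continuity is uniform in the location of the interval
    let w : ℕ → ℝ≥0∞ := fun n =>
      ⨆ t : ℝ, ∫⁻ q in Ioc (t - h n) t, eLpNorm (g q) 2 P ∂timeMeasure T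
    have hw : Tendsto w atTop (𝓝 0) := by
      refine ENNReal.tendsto_nhds_zero.2 fun η hη => ?_
      obtain ⟨δ, hδ, hδ'⟩ := exists_pos_setLIntegral_lt_of_measure_lt hfin hη.ne'
      have : Tendsto (fun n => ENNReal.ofReal (h n)) atTop (𝓝 0) := by
        simpa using ENNReal.tendsto_ofReal hhlim
      filter_upwards [this.eventually (gt_mem_nhds hδ)] with n hn
      refine iSup_le fun t => (hδ' _ ?_).le
      refine lt_of_le_of_lt (Measure.restrict_apply_le _ _) ?_
      rwa [Real.volume_Ioc, sub_sub_cancel]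
    have hlim : Tendsto (fun n => (N * expModulus (h n) + ENNReal.ofReal (Real.exp (T / 2)) * w n +
        ε n) ^ 2 * ENNReal.ofReal T) atTop (𝓝 0) := by
      have h1 := ENNReal.Tendsto.const_mul (a := N) hElim (Or.inr hNtop)
      have h2 := ENNReal.Tendsto.const_mul (a := ENNReal.ofReal (Real.exp (T / 2))) hw
        (Or.inr ENNReal.ofReal_ne_top)
      have h3 := ENNReal.Tendsto.mul_const (b := ENNReal.ofReal T)
        (ENNReal.Tendsto.pow (n := 2) ((h1.add h2).add hεlim)) (Or.inr ENNReal.ofReal_ne_top)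
      simpa using h3
    have hsq := tendsto_of_tendsto_of_tendsto_of_le_of_le tendsto_const_nhds hlim
      (fun _ => zero_le) fun n => sq_eLpNorm_sub_scheme_le hB hg (hh n)
        (by rw [hSN]; exact hc n) (hS n) (hε n) hN (w := w n)
        (fun t => le_iSup (fun t => ∫⁻ q in Ioc (t - h n) t, eLpNorm (g q) 2 P ∂timeMeasure T) t)
    have := hsq.ennrpow_const (1 / 2 : ℝ)
    rw [ENNReal.zero_rpow_of_pos (by norm_num)] at this
    refine this.congr fun n => ?_
    rw [← ENNReal.rpow_natCast, ← ENNReal.rpow_mul]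
    norm_num
  · have h1 := (measurable_linSol (A := fun _ => 0) continuous_const hB hg.meas).of_uncurry_left
      (x := t)
    have h2 : StronglyMeasurable fun ω => ∫ s in Ioc 0 t, g s ω :=
      hg.meas.stronglyMeasurable.integral_prod_left
    exact h1.aestronglyMeasurable.sub h2.aestronglyMeasurable
  · have hlim : Tendsto (fun n => N * ENNReal.ofReal (Real.sqrt (T * h n)) +
        expModulus (h n) * (∫⁻ q in Ioo 0 T, eLpNorm (g q) 2 P) +
        (S n).N * (ε n * ENNReal.ofReal (Real.sqrt T))) atTop (𝓝 0) := by
      have h1 : Tendsto (fun n => ENNReal.ofReal (Real.sqrt (T * h n))) atTop (𝓝 0) := by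
        have : Tendsto (fun n => Real.sqrt (T * h n)) atTop (𝓝 (Real.sqrt (T * 0))) :=
          (Real.continuous_sqrt.tendsto _).comp (hhlim.const_mul T)
        simpa using ENNReal.tendsto_ofReal this
      have h2 := ENNReal.Tendsto.const_mul (a := N) h1 (Or.inr hNtop)
      have h3 := ENNReal.Tendsto.mul_const hElim (Or.inr hfin)
      have h4 : Tendsto (fun n => ((S n).N : ℝ≥0∞) * (ε n * ENNReal.ofReal (Real.sqrt T))) atTop
          (𝓝 0) := by
        have e : ∀ n, ((S n).N : ℝ≥0∞) * (ε n * ENNReal.ofReal (Real.sqrt T)) =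
            ENNReal.ofReal (1 / ((n + 1 : ℕ) : ℝ)) * ENNReal.ofReal (Real.sqrt T) := by
          intro n
          rw [hSN, ← mul_assoc, ← ENNReal.ofReal_natCast, ← ENNReal.ofReal_mul (Nat.cast_nonneg _)]
          congr 2
          field_simp
        simp_rw [e]
        have h5 := ENNReal.Tendsto.mul_const (b := ENNReal.ofReal (Real.sqrt T))
          (ENNReal.tendsto_ofReal hinv) (Or.inr ENNReal.ofReal_ne_top)
        simpa using h5
      simpa using (h2.add h3).add h4
    refine tendsto_of_tendsto_of_tendsto_of_le_of_le' tendsto_const_nhds hlim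
      (Eventually.of_forall fun _ => zero_le) ?_
    filter_upwards [hhlim.eventually (gt_mem_nhds one_pos)] with n hn
    exact eLpNorm_sub_scheme_integral_le hB hg (hh n) hn.le (by rw [hSN]; exact hc n) (hS n)
      (hε n) hN ht

end

/-! ### Existence of solutions -/

theorem lipschitzWith_primitive {a : ℝ → ℝ} {K : ℝ≥0} (ham : Measurable a) (ha : ∀ s, |a s| ≤ K) :
    LipschitzWith K fun t => ∫ s in (0 : ℝ)..t, a s := by
  have hi : ∀ s t : ℝ, IntervalIntegrable a volume s t := fun s t =>
    (intervalIntegrable_const (c := (K : ℝ))).mono_fun ham.aestronglyMeasurable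
      (Eventually.of_forall fun x => by simpa using ha x)
  refine LipschitzWith.of_dist_le_mul fun t s => ?_
  rw [Real.dist_eq, Real.dist_eq, intervalIntegral.integral_interval_sub_left (hi _ _) (hi _ _)]
  rw [← Real.norm_eq_abs]
  exact intervalIntegral.norm_integral_le_of_norm_le_const fun x _ => (Real.norm_eq_abs _).trans_le (ha x)

/-- Variation of constants for the scalar equation `y' = a y + k`, `y(0) = 0`. -/
theorem variation_of_constants {a k : ℝ → ℝ} {K : ℝ≥0} (ham : Measurable a) (ha : ∀ s, |a s| ≤ K)
    {A : ℝ → ℝ} (hA : A = fun t => ∫ s in (0 : ℝ)..t, a s) {t : ℝ}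
    (hk : IntervalIntegrable k volume 0 t) :
    Real.exp (A t) * ∫ s in (0 : ℝ)..t, Real.exp (-A s) * k s =
      ∫ s in (0 : ℝ)..t,
        (a s * (Real.exp (A s) * ∫ r in (0 : ℝ)..s, Real.exp (-A r) * k r) + k s) := by
  have hL : LipschitzWith K A := hA ▸ lipschitzWith_primitive ham ha
  have hA0 : A 0 = 0 := by simp [hA]
  have hai : IntervalIntegrable a volume 0 t :=
    (intervalIntegrable_const (c := (K : ℝ))).mono_fun ham.aestronglyMeasurable
      (Eventually.of_forall fun x => by simpa using ha x)
  have hki : IntervalIntegrable (fun s => Real.exp (-A s) * k s) volume 0 t :=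
    hk.continuousOn_mul (Real.continuous_exp.comp hL.continuous.neg).continuousOn
  have hE : AbsolutelyContinuousOnInterval (fun s => Real.exp (A s)) 0 t := by
    obtain ⟨M, hM⟩ := (isCompact_uIcc (a := (0 : ℝ)) (b := t)).exists_bound_of_continuousOn
      hL.continuous.continuousOn
    obtain ⟨C, hC⟩ := (Real.contDiff_exp (n := 1)).contDiffOn.exists_lipschitzOnWith (by decide)
      (convex_Icc (-M) M) isCompact_Icc
    exact (hC.comp (hL.lipschitzOnWith (s := uIcc 0 t))
      (fun s hs => abs_le.1 (hM s hs))).absolutelyContinuousOnInterval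
  have hG := hki.absolutelyContinuousOnInterval_intervalIntegral left_mem_uIcc
  have h := hE.integral_deriv_mul_eq_sub hG
  simp only [intervalIntegral.integral_same, mul_zero, sub_zero] at h
  rw [← h]
  refine intervalIntegral.integral_congr_ae ?_
  filter_upwards [hai.ae_hasDerivAt_integral, hki.ae_hasDerivAt_integral] with x h1 h2 hx
  have hx' := uIoc_subset_uIcc hx
  have d1 : HasDerivAt A (a x) x := by
    rw [hA]; exact h1 hx' 0 left_mem_uIcc
  rw [d1.exp.deriv, (h2 hx' 0 left_mem_uIcc).deriv, ← mul_assoc (Real.exp (A x)) _ (k x),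
    ← Real.exp_add]
  simp only [add_neg_cancel, Real.exp_zero, one_mul]
  ring

/-- Drift terms can be moved into the forcing. -/
theorem linSol_eq_linSol_zero (hB : IsContinuousVersion 𝓕 P W B) {a : ℝ → ℝ} {K : ℝ≥0}
    (ham : Measurable a) (ha : ∀ s, |a s| ≤ K)
    {A : ℝ → ℝ} (hA : A = fun t => ∫ s in (0 : ℝ)..t, a s) {T : ℝ} {f : ℝ → Ω → ℝ} {ω : Ω}
    (hω : Integrable (fun t => f t ω) (timeMeasure T)) {t : ℝ} (ht : t ∈ Icc 0 T) :
    linSol A B f t ω =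
      linSol (fun _ => 0) B (fun s ω => a s * linSol A B f s ω + f s ω) t ω := by
  have hk0 : IntervalIntegrable (fun s => kernel (fun _ => 0) B s 0 ω * f s ω) volume 0 t := by
    rw [intervalIntegrable_iff_integrableOn_Ioc_of_le ht.1]
    exact (integrableOn_kernel_mul (A := fun _ => 0) continuous_const hB hω 0).mono_set
      fun x hx => ⟨hx.1.le, hx.2.trans ht.2⟩
  have hs : ∀ s, 0 ≤ s → linSol A B f s ω = kernel (fun _ => 0) B 0 s ω *
      (Real.exp (A s) * ∫ r in (0 : ℝ)..s,
        Real.exp (-A r) * (kernel (fun _ => 0) B r 0 ω * f r ω)) := by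
    intro s hs
    have hA0 : A 0 = 0 := by simp [hA]
    rw [linSol_eq, intervalIntegral.integral_of_le hs, ← mul_assoc]
    congr 1
    · simp only [kernel, hA0]
      rw [← Real.exp_add]; congr 1; ring
    · refine integral_congr_ae (Eventually.of_forall fun r => ?_)
      simp only [kernel, hA0]
      rw [← mul_assoc, ← Real.exp_add]; congr 2; ring
  rw [hs t ht.1, variation_of_constants ham ha hA hk0, linSol_eq,
    intervalIntegral.integral_of_le ht.1]
  congr 1
  refine setIntegral_congr_fun measurableSet_Ioc fun r hr => ?_
  rw [hs r hr.1.le]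
  have h1 : kernel (fun _ => 0) B r 0 ω * kernel (fun _ => 0) B 0 r ω = 1 := by
    rw [kernel_mul_kernel, kernel_self]
  linear_combination (-(a r * (Real.exp (A r) * ∫ r in (0 : ℝ)..r,
        Real.exp (-A r) * (kernel (fun _ => 0) B r 0 ω * f r ω)))) * h1

/-- Fubini for null sets, with the second coordinate outside. -/
theorem ae_ae_swap_of_ae_prod [SFinite P] {μ : Measure ℝ} [SFinite μ] {q : ℝ × Ω → Prop}
    (h : ∀ᵐ x ∂μ.prod P, q x) : ∀ᵐ ω ∂P, ∀ᵐ t ∂μ, q (t, ω) :=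
  Measure.ae_ae_of_ae_prod (Measure.measurePreserving_swap.quasiMeasurePreserving.ae h)

theorem ae_prod_of_ae_forall [SFinite P] {T : ℝ} {q : ℝ × Ω → Prop}
    (h : ∀ᵐ ω ∂P, ∀ t ∈ Icc 0 T, q (t, ω)) : ∀ᵐ x ∂(timeMeasure T).prod P, q x := by
  have h1 : ∀ᵐ x ∂(timeMeasure T).prod P, x.1 ∈ Ioo 0 T :=
    Measure.quasiMeasurePreserving_fst.ae (ae_restrict_mem measurableSet_Ioo)
  filter_upwards [h1, Measure.quasiMeasurePreserving_snd.ae h] with x hx hx'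
  exact hx' x.1 (Ioo_subset_Icc_self hx)

theorem IsItoIntegral.congr_left {T : ℝ} {H H' I : ℝ → Ω → ℝ} (h : IsItoIntegral 𝓕 P W T H I)
    (hH : ∀ᵐ q ∂(timeMeasure T).prod P, H q.1 q.2 = H' q.1 q.2) : IsItoIntegral 𝓕 P W T H' I := by
  obtain ⟨S, h1, h2⟩ := h
  refine ⟨S, h1.congr fun n => eLpNorm_congr_ae ?_, h2⟩
  filter_upwards [hH] with q hq
  rw [hq]

theorem IsSolution.congr [SFinite P] {T : ℝ} {a a' : ℝ → ℝ} {X₀ : Ω → ℝ} {f f' X : ℝ → Ω → ℝ}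
    (h : IsSolution 𝓕 P W T a X₀ f X) (ha : a =ᵐ[timeMeasure T] a')
    (hf : ∀ᵐ q ∂(timeMeasure T).prod P, f q.1 q.2 = f' q.1 q.2) :
    IsSolution 𝓕 P W T a' X₀ f' X := by
  obtain ⟨I, hI, hX⟩ := h.equation
  have hf' := ae_ae_swap_of_ae_prod hf
  refine ⟨h.mem, h.cont, ?_, I, hI, fun t ht => ?_⟩
  · filter_upwards [h.integrable_drift, hf'] with ω h1 h2
    refine h1.congr ?_
    filter_upwards [ha, h2] with t h3 h4
    rw [h3, h4]
  · filter_upwards [hX t ht, hf'] with ω h1 h2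
    rw [h1, intervalIntegral.integral_of_le ht.1, intervalIntegral.integral_of_le ht.1]
    congr 2
    rw [timeMeasure_eq_Ioc]
    refine integral_congr_ae ?_
    have hac := (timeMeasure_mono ht.2).absolutelyContinuous
    filter_upwards [hac ha, hac h2] with s h3 h4
    rw [h3, h4]

section

variable (hB : IsContinuousVersion 𝓕 P W B) {T : ℝ} {f : ℝ → Ω → ℝ}
include hB

/-- The forcing that results from moving the drift term to the right-hand side. -/
theorem IsForcing.drift [IsProbabilityMeasure P] {p : ℝ} (hf : IsForcing 𝓕 P T p f) (hp : 1 ≤ p)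
    {a A : ℝ → ℝ} {K : ℝ≥0} (ham : Measurable a) (ha : ∀ s, |a s| ≤ K) (hA : Continuous A) :
    IsForcing 𝓕 P T p fun s ω => a s * linSol A B f s ω + f s ω := by
  have hXm := measurable_linSol hA hB hf.meas
  refine ⟨((ham.comp measurable_fst).mul hXm).add hf.meas, ?_, ?_⟩
  · filter_upwards [hf.adapted, ae_restrict_mem measurableSet_Ioo] with t h1 ht
    exact ((adapted_linSol hA hB hf hp ht.2.le).const_mul (a t)).add h1
  · obtain ⟨M, hM⟩ := exists_abs_le hA T
    set c : ℝ≥0∞ := ENNReal.ofReal (Real.exp (2 * M + (p - 1) * T / 2)) *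
        ∫⁻ q in Ioo 0 T, eLpNorm (f q) (ENNReal.ofReal p) P
    have hc : c ≠ ⊤ := ENNReal.mul_ne_top ENNReal.ofReal_ne_top hf.finite.ne
    have hp' : 1 ≤ ENNReal.ofReal p := by simpa using hp
    have hb : ∀ t ∈ Ioo 0 T, eLpNorm (fun ω => a t * linSol A B f t ω + f t ω) (ENNReal.ofReal p) P ≤
        K * c + eLpNorm (f t) (ENNReal.ofReal p) P := by
      intro t ht
      refine (eLpNorm_add_le ((hXm.of_uncurry_left (x := t)).const_mul
        (a t)).aestronglyMeasurable hf.meas.of_uncurry_left.aestronglyMeasurable hp').trans ?_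
      gcongr
      have e : (fun ω => a t * linSol A B f t ω) = a t • linSol A B f t := rfl
      rw [e, eLpNorm_const_smul]
      gcongr
      · rw [Real.enorm_eq_ofReal_abs, ← ENNReal.ofReal_coe_nnreal]
        exact ENNReal.ofReal_le_ofReal (ha t)
      · exact eLpNorm_linSol_le hA hB hf hM hp ht.2.le
    refine lt_of_le_of_lt (setLIntegral_mono' measurableSet_Ioo hb) ?_
    rw [lintegral_add_left measurable_const, setLIntegral_const, Real.volume_Ioo]
    exact ENNReal.add_lt_top.2 ⟨ENNReal.mul_lt_top
      (ENNReal.mul_lt_top ENNReal.coe_lt_top hc.lt_top) ENNReal.ofReal_lt_top, hf.finite⟩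

/-- **Existence of solutions**: the variation of constants formula gives one. -/
theorem isSolution_linSol [IsProbabilityMeasure P] (hf : IsForcing 𝓕 P T 2 f) (hT : 0 < T)
    {a A : ℝ → ℝ} {K : ℝ≥0} (ham : Measurable a) (ha : ∀ s, |a s| ≤ K)
    (hA : A = fun t => ∫ s in (0 : ℝ)..t, a s) :
    IsSolution 𝓕 P W T a 0 f (linSol A B f) := by
  have hAc : Continuous A := hA ▸ (lipschitzWith_primitive ham ha).continuous
  have hXm := measurable_linSol hAc hB hf.meas
  have hg := hf.drift hB one_le_two ham ha hAc
  have hae : ∀ᵐ ω ∂P, ∀ t ∈ Icc 0 T, linSol (fun _ => 0) B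
      (fun s ω => a s * linSol A B f s ω + f s ω) t ω = linSol A B f t ω := by
    filter_upwards [hf.ae_integrable one_le_two] with ω hω t ht
    exact (linSol_eq_linSol_zero hB ham ha hA hω ht).symm
  refine ⟨⟨hXm.aestronglyMeasurable, fun t ht => adapted_linSol hAc hB hf one_le_two ht.2,
    fun t ht => memLp_linSol hAc hB hf one_le_two ht.2, ?_⟩, ?_, hg.ae_integrable one_le_two,
    _, (isItoIntegral_linSol hB hg hT).congr_left (ae_prod_of_ae_forall hae), ?_⟩
  · obtain ⟨M, hM⟩ := exists_abs_le hAc T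
    refine lt_of_le_of_lt (setLIntegral_mono' measurableSet_Ioo fun t ht =>
      pow_le_pow_left' (eLpNorm_linSol_le hAc hB hf hM one_le_two ht.2.le) 2) ?_
    rw [setLIntegral_const, Real.volume_Ioo]
    exact ENNReal.mul_lt_top (ENNReal.pow_lt_top
      (ENNReal.mul_lt_top ENNReal.ofReal_lt_top hf.finite)) ENNReal.ofReal_lt_top
  · filter_upwards [hf.ae_integrable one_le_two] with ω hω
    exact continuousOn_linSol hAc hB hω
  · intro t ht
    filter_upwards [hae] with ω hω
    rw [hω t ht, intervalIntegral.integral_of_le ht.1]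
    simp

end

/-! ### Measurability of the integrand -/

/-- Composition of the integrand with a process is measurable: `F` is a Carathéodory function, up to
a null set of times. -/
theorem HypH3.aemeasurable_comp {T : ℝ} {F : ℝ → ℝ → ℝ} (h3 : HypH3 T F) [SFinite P]
    {X : ℝ × Ω → ℝ} (hX : Measurable X) :
    AEMeasurable (fun q : ℝ × Ω => F q.1 (X q)) ((timeMeasure T).prod P) := by
  classical
  have hgood : ∀ᵐ t ∂timeMeasure T, t ∈ Ioo 0 T ∧ ∀ r : ℚ, F t r = (h3.measurable r).mk _ t :=
    (ae_restrict_mem measurableSet_Ioo).and (ae_all_iff.2 fun r => (h3.measurable r).ae_eq_mk)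
  set N := toMeasurable (timeMeasure T)
    {t | ¬ (t ∈ Ioo 0 T ∧ ∀ r : ℚ, F t r = (h3.measurable r).mk _ t)} with hN
  have hN0 : timeMeasure T N = 0 := by rw [hN, measure_toMeasurable]; exact hgood
  have hNm : MeasurableSet N := measurableSet_toMeasurable _ _
  have hNc : ∀ t, t ∉ N → t ∈ Ioo 0 T ∧ ∀ r : ℚ, F t r = (h3.measurable r).mk _ t := fun t ht => by
    by_contra h
    exact ht (subset_toMeasurable _ _ h)
  let G : ℝ → ℝ → ℝ := fun ξ t => if t ∈ N then 0 else F t ξ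
  have hGc : ∀ t, Continuous fun ξ => G ξ t := by
    intro t
    by_cases ht : t ∈ N
    · simp only [G, ht, if_true]; exact continuous_const
    · simp only [G, ht, if_false]
      exact (h3.contDiff t (Ioo_subset_Icc_self (hNc t ht).1)).continuous
  have hGr : ∀ r : ℚ, Measurable (G r) := by
    intro r
    have : G r = fun t => if t ∈ N then 0 else (h3.measurable r).mk _ t := by
      ext t
      by_cases ht : t ∈ N
      · simp [G, ht]
      · simp only [G, ht, if_false]; exact (hNc t ht).2 r
    rw [this]
    exact Measurable.ite hNm measurable_const (h3.measurable r).measurable_mk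
  have hGm : ∀ ξ, Measurable (G ξ) := by
    intro ξ
    obtain ⟨x, hx, hxlim⟩ := mem_closure_iff_seq_limit.1 (Rat.denseRange_cast (𝕜 := ℝ) ξ)
    choose r hr using hx
    refine measurable_of_tendsto_metrizable (f := fun n => G (r n)) (fun n => hGr _)
      (tendsto_pi_nhds.2 fun t => ?_)
    simp only [hr]
    exact ((hGc t).tendsto ξ).comp hxlim
  have hG : Measurable (Function.uncurry fun ξ t => G ξ t) :=
    measurable_uncurry_of_continuous_of_measurable hGc hGm
  refine ⟨fun q => G (X q) q.1, hG.comp (hX.prodMk measurable_fst), ?_⟩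
  have h0 : ∀ᵐ t ∂timeMeasure T, t ∉ N := measure_eq_zero_iff_ae_notMem.1 hN0
  filter_upwards [Measure.quasiMeasurePreserving_fst.ae h0] with q hq
  simp [G, hq]

/-! ### Dependence of the solution on the forcing -/

theorem isForcing_of_integrable [IsProbabilityMeasure P] {T p : ℝ} (hp : 1 ≤ p) {v : ℝ → ℝ}
    (hvm : Measurable v) (hv : Integrable v (timeMeasure T)) :
    IsForcing 𝓕 P T p fun s _ => v s := by
  refine ⟨hvm.comp measurable_fst, Eventually.of_forall fun t => aestronglyMeasurable_const, ?_⟩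
  have hp0 : ENNReal.ofReal p ≠ 0 := (ENNReal.ofReal_pos.2 (by linarith)).ne'
  have e : ∀ t, eLpNorm (fun _ : Ω => v t) (ENNReal.ofReal p) P = ‖v t‖ₑ := fun t => by
    rw [eLpNorm_const _ hp0 (IsProbabilityMeasure.ne_zero P)]; simp
  simp_rw [e]
  exact hv.2

theorem IsForcing.sub [IsProbabilityMeasure P] {T p : ℝ} (hp : 1 ≤ p) {f g : ℝ → Ω → ℝ}
    (hf : IsForcing 𝓕 P T p f) (hg : IsForcing 𝓕 P T p g) :
    IsForcing 𝓕 P T p fun t ω => f t ω - g t ω := by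
  refine ⟨hf.meas.sub hg.meas, ?_, ?_⟩
  · filter_upwards [hf.adapted, hg.adapted] with t h1 h2
    exact h1.sub h2
  · have hm : Measurable fun t => eLpNorm (f t) (ENNReal.ofReal p) P :=
      measurable_eLpNorm_left hf.meas (by linarith)
    refine lt_of_le_of_lt (lintegral_mono fun t => eLpNorm_sub_le
      hf.meas.of_uncurry_left.aestronglyMeasurable hg.meas.of_uncurry_left.aestronglyMeasurable
      (by simpa using hp)) ?_
    rw [lintegral_add_left hm]
    exact ENNReal.add_lt_top.2 ⟨hf.finite, hg.finite⟩

theorem linSol_congr (A : ℝ → ℝ) (B : ℝ → Ω → ℝ) {T : ℝ} {f g : ℝ → Ω → ℝ} {ω : Ω}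
    (h : ∀ᵐ s ∂timeMeasure T, f s ω = g s ω) {t : ℝ} (ht : t ≤ T) :
    linSol A B f t ω = linSol A B g t ω := by
  unfold linSol
  rw [timeMeasure_eq_Ioc]
  refine integral_congr_ae ?_
  filter_upwards [(timeMeasure_mono ht).absolutelyContinuous h] with s hs
  rw [hs]

section

variable {A : ℝ → ℝ} (hA : Continuous A) (hB : IsContinuousVersion 𝓕 P W B) {T : ℝ}
include hA hB

theorem integrableOn_Ioc_kernel_mul {f : ℝ → Ω → ℝ} {ω : Ω}
    (hω : Integrable (fun t => f t ω) (timeMeasure T)) {t : ℝ} (ht : t ≤ T) :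
    IntegrableOn (fun s => kernel A B s t ω * f s ω) (Ioc 0 t) :=
  (integrableOn_kernel_mul hA hB hω t).mono_set fun _ hx => ⟨hx.1.le, hx.2.trans ht⟩

theorem linSol_sub {f g : ℝ → Ω → ℝ} {ω : Ω} (hf : Integrable (fun t => f t ω) (timeMeasure T))
    (hg : Integrable (fun t => g t ω) (timeMeasure T)) {t : ℝ} (ht : t ≤ T) :
    linSol A B (fun s ω => f s ω - g s ω) t ω = linSol A B f t ω - linSol A B g t ω := by
  unfold linSol
  rw [← integral_sub (integrableOn_Ioc_kernel_mul hA hB hf ht)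
    (integrableOn_Ioc_kernel_mul hA hB hg ht)]
  simp_rw [mul_sub]

theorem linSol_combination {f g : ℝ → Ω → ℝ} {ω : Ω}
    (hf : Integrable (fun t => f t ω) (timeMeasure T))
    (hg : Integrable (fun t => g t ω) (timeMeasure T)) {t : ℝ} (ht : t ≤ T) (a b : ℝ) :
    linSol A B (fun s ω => a * f s ω + b * g s ω) t ω =
      a * linSol A B f t ω + b * linSol A B g t ω := by
  unfold linSol
  rw [← integral_const_mul, ← integral_const_mul, ← integral_add
    ((integrableOn_Ioc_kernel_mul hA hB hf ht).const_mul a)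
    ((integrableOn_Ioc_kernel_mul hA hB hg ht).const_mul b)]
  refine integral_congr_ae (Eventually.of_forall fun s => ?_)
  simp only
  ring

/-- The solution depends continuously on the forcing, path by path. -/
theorem abs_linSol_sub_le {ω : Ω} : ∃ κ : ℝ, ∀ f g : ℝ → Ω → ℝ,
    Integrable (fun t => f t ω) (timeMeasure T) → Integrable (fun t => g t ω) (timeMeasure T) →
    ∀ t ∈ Icc 0 T, |linSol A B f t ω - linSol A B g t ω| ≤
      κ * ∫ s in Ioo 0 T, |f s ω - g s ω| := by
  have hc : Continuous fun q : ℝ × ℝ => kernel A B q.1 q.2 ω := by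
    unfold kernel
    have := hB.cont ω
    fun_prop
  obtain ⟨κ, hκ⟩ := ((isCompact_Icc (a := (0 : ℝ)) (b := T)).prod
    (isCompact_Icc (a := (0 : ℝ)) (b := T))).exists_bound_of_continuousOn hc.continuousOn
  refine ⟨κ, fun f g hf hg t ht => ?_⟩
  have hκ0 : 0 ≤ κ := (norm_nonneg _).trans (hκ (t, t) ⟨ht, ht⟩)
  have hi : Integrable (fun s => |f s ω - g s ω|) (timeMeasure T) := (hf.sub hg).abs
  have hle := timeMeasure_mono ht.2
  rw [← linSol_sub hA hB hf hg ht.2]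
  unfold linSol
  rw [timeMeasure_eq_Ioc, ← Real.norm_eq_abs]
  refine (norm_integral_le_of_norm_le ((hi.mono_measure hle).const_mul κ) ?_).trans ?_
  · filter_upwards [ae_restrict_mem measurableSet_Ioo] with s hs
    rw [norm_mul, Real.norm_eq_abs (f s ω - g s ω)]
    gcongr
    exact hκ (s, t) ⟨⟨hs.1.le, hs.2.le.trans ht.2⟩, ht⟩
  · rw [integral_const_mul]
    exact mul_le_mul_of_nonneg_left
      (integral_mono_measure hle (Eventually.of_forall fun s => abs_nonneg _) hi) hκ0

/-- The forcing is determined by the solution. -/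
theorem ae_eq_zero_of_linSol_eq_zero {f : ℝ → Ω → ℝ} {ω : Ω}
    (hf : Integrable (fun t => f t ω) (timeMeasure T))
    (h : ∀ᵐ t ∂timeMeasure T, linSol A B f t ω = 0) : ∀ᵐ t ∂timeMeasure T, f t ω = 0 := by
  rcases le_or_gt T 0 with hT | hT
  · simp [timeMeasure, Ioo_eq_empty_of_le hT]
  let G : ℝ → ℝ := fun t => ∫ s in (0 : ℝ)..t, kernel A B s 0 ω * f s ω
  have hki : IntervalIntegrable (fun s => kernel A B s 0 ω * f s ω) volume 0 T := by
    rw [intervalIntegrable_iff_integrableOn_Icc_of_le hT.le]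
    exact integrableOn_kernel_mul hA hB hf 0
  have hGc : ContinuousOn G (Ioo 0 T) := by
    have := intervalIntegral.continuousOn_primitive_interval' hki left_mem_uIcc
    rw [uIcc_of_le hT.le] at this
    exact this.mono Ioo_subset_Icc_self
  have hG0 : ∀ᵐ t ∂timeMeasure T, G t = 0 := by
    filter_upwards [h, ae_restrict_mem measurableSet_Ioo] with t h1 ht
    rw [linSol_eq, mul_eq_zero] at h1
    rcases h1 with h1 | h1
    · exact absurd h1 (kernel_pos _ _ _ _ _).ne'
    · simp only [G]; rw [intervalIntegral.integral_of_le ht.1.le]; exact h1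
  have hG : ∀ t ∈ Ioo 0 T, G t = 0 :=
    Measure.eqOn_open_of_ae_eq hG0 isOpen_Ioo hGc continuousOn_const
  have hd := hki.ae_hasDerivAt_integral
  filter_upwards [ae_restrict_of_ae hd, ae_restrict_mem measurableSet_Ioo] with t h1 ht
  have h2 : HasDerivAt G (kernel A B t 0 ω * f t ω) t := by
    refine h1 ?_ 0 left_mem_uIcc
    rw [uIcc_of_le hT.le]; exact Ioo_subset_Icc_self ht
  have h3 : HasDerivAt G 0 t := (hasDerivAt_const t (0 : ℝ)).congr_of_eventuallyEq
    (by filter_upwards [Ioo_mem_nhds ht.1 ht.2] with s hs using hG s hs)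
  rcases mul_eq_zero.1 (h2.unique h3) with h4 | h4
  · exact absurd h4 (kernel_pos _ _ _ _ _).ne'
  · exact h4

end

/-! ### The cost as a functional of the control -/

/-- A process with bounded `p`-th moments has finite energy for integrands growing with an exponent
`α < p`. -/
theorem lintegral_growth_lt_top [IsProbabilityMeasure P] {T p α : ℝ} (hp : 1 ≤ p) (hα : 0 < α)
    (hαp : α < p) {L : ℝ → ℝ} (hL : Integrable L (timeMeasure T)) {X : ℝ → Ω → ℝ}
    (hX : Measurable (Function.uncurry X)) {N : ℝ≥0∞} (hN : N ≠ ⊤)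
    (hXN : ∀ t ∈ Ioo 0 T, eLpNorm (X t) (ENNReal.ofReal p) P ≤ N) :
    ∫⁻ q : ℝ × Ω, ENNReal.ofReal (L q.1 * (1 + |X q.1 q.2| ^ α)) ∂(timeMeasure T).prod P < ⊤ := by
  have hp0 : 0 < p := by linarith
  have hpt : ∀ x : ℝ, |x| ^ α ≤ 1 + |x| ^ p := by
    intro x
    rcases le_total |x| 1 with h | h
    · have h1 := Real.rpow_le_one (abs_nonneg x) h hα.le
      have h2 : 0 ≤ |x| ^ p := by positivity
      linarith
    · have := Real.rpow_le_rpow_of_exponent_le h hαp.le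
      linarith
  have hle : ∀ q : ℝ × Ω, ENNReal.ofReal (L q.1 * (1 + |X q.1 q.2| ^ α)) ≤
      ‖L q.1‖ₑ * (2 + ‖X q.1 q.2‖ₑ ^ p) := by
    intro q
    have e : ‖L q.1‖ₑ * (2 + ‖X q.1 q.2‖ₑ ^ p) =
        ENNReal.ofReal (|L q.1| * (2 + |X q.1 q.2| ^ p)) := by
      rw [ENNReal.ofReal_mul (abs_nonneg _), ENNReal.ofReal_add zero_le_two (by positivity),
        Real.enorm_eq_ofReal_abs, Real.enorm_eq_ofReal_abs,
        ENNReal.ofReal_rpow_of_nonneg (abs_nonneg _) hp0.le]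
      simp
    rw [e]
    refine ENNReal.ofReal_le_ofReal ?_
    exact mul_le_mul (le_abs_self _) (by linarith [hpt (X q.1 q.2)]) (by positivity)
      (abs_nonneg _)
  refine lt_of_le_of_lt (lintegral_mono hle) ?_
  have hXp : Measurable fun q : ℝ × Ω => ‖X q.1 q.2‖ₑ ^ p := hX.enorm.pow_const p
  have hm : AEMeasurable (fun q : ℝ × Ω => ‖L q.1‖ₑ * (2 + ‖X q.1 q.2‖ₑ ^ p))
      ((timeMeasure T).prod P) := hL.1.comp_fst.enorm.mul (hXp.const_add 2).aemeasurable
  rw [lintegral_prod _ hm]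
  have hb : ∀ t ∈ Ioo 0 T, ∫⁻ ω, ‖L t‖ₑ * (2 + ‖X t ω‖ₑ ^ p) ∂P ≤ ‖L t‖ₑ * (2 + N ^ p) := by
    intro t ht
    have hm : Measurable fun ω => ‖X t ω‖ₑ ^ p := hX.of_uncurry_left.enorm.pow_const p
    rw [lintegral_const_mul _ (hm.const_add 2), lintegral_add_left measurable_const,
      lintegral_const, measure_univ, mul_one]
    gcongr
    have h1 := hXN t ht
    rw [eLpNorm_ofReal hp] at h1
    have h2 := ENNReal.rpow_le_rpow h1 hp0.le
    rwa [← ENNReal.rpow_mul, one_div_mul_cancel hp0.ne', ENNReal.rpow_one] at h2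
  refine lt_of_le_of_lt (setLIntegral_mono' measurableSet_Ioo hb) ?_
  rw [lintegral_mul_const'' _ hL.1.enorm]
  exact ENNReal.mul_lt_top hL.2
    (ENNReal.add_lt_top.2 ⟨by simp, ENNReal.rpow_lt_top_of_nonneg hp0.le hN⟩)

/-- The gap process, given by the explicit formula. -/
noncomputable def gapSol {T : ℝ} (A : ℝ → ℝ) (B ζ : ℝ → Ω → ℝ) (u : L1 T) : ℝ → Ω → ℝ :=
  linSol A B fun s ω => ζ s ω - u s

/-- The cost of the explicit gap process, as an integral over `(0,T) × Ω`. -/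
noncomputable def gapCost {T : ℝ} (P : Measure Ω) (A : ℝ → ℝ) (B ζ : ℝ → Ω → ℝ) (F : ℝ → ℝ → ℝ)
    (u : L1 T) : ℝ≥0∞ :=
  ∫⁻ q : ℝ × Ω, ENNReal.ofReal (F q.1 (gapSol A B ζ u q.1 q.2)) ∂(timeMeasure T).prod P

theorem measurable_coe_L1 {T : ℝ} (u : L1 T) : Measurable (u : ℝ → ℝ) :=
  (Lp.stronglyMeasurable u).measurable

theorem integrable_coe_L1 {T : ℝ} (u : L1 T) : Integrable (u : ℝ → ℝ) (timeMeasure T) :=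
  L1.integrable_coeFn u

section

variable {A : ℝ → ℝ} (hA : Continuous A) (hB : IsContinuousVersion 𝓕 P W B) {T p : ℝ}
  (hp : 1 ≤ p) {ζ : ℝ → Ω → ℝ} (hζ : IsForcing 𝓕 P T p ζ)

theorem isForcing_gap [IsProbabilityMeasure P] (hp : 1 ≤ p) (hζ : IsForcing 𝓕 P T p ζ)
    (u : L1 T) : IsForcing 𝓕 P T p fun s ω => ζ s ω - u s :=
  hζ.sub hp (isForcing_of_integrable hp (measurable_coe_L1 u) (integrable_coe_L1 u))

include hA hB in
theorem gapSol_eq {ω : Ω} (hω : Integrable (fun t => ζ t ω) (timeMeasure T)) (u : L1 T) {t : ℝ}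
    (ht : t ≤ T) : gapSol A B ζ u t ω = linSol A B ζ t ω - linSol A B (fun s _ => u s) t ω :=
  linSol_sub hA hB hω (integrable_coe_L1 u) ht

include hA hB in
theorem gapSol_combination {ω : Ω} (hω : Integrable (fun t => ζ t ω) (timeMeasure T)) (u v : L1 T)
    {a b : ℝ} (hab : a + b = 1) {t : ℝ} (ht : t ≤ T) :
    gapSol A B ζ (a • u + b • v) t ω = a * gapSol A B ζ u t ω + b * gapSol A B ζ v t ω := by
  rw [gapSol_eq hA hB hω _ ht, gapSol_eq hA hB hω _ ht, gapSol_eq hA hB hω _ ht]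
  have e : linSol A B (fun s _ => (a • u + b • v : L1 T) s) t ω =
      a * linSol A B (fun s _ => u s) t ω + b * linSol A B (fun s _ => v s) t ω := by
    rw [← linSol_combination hA hB (integrable_coe_L1 u) (integrable_coe_L1 v) ht]
    refine linSol_congr A B (T := T) ?_ ht
    filter_upwards [Lp.coeFn_add (a • u) (b • v), Lp.coeFn_smul a u, Lp.coeFn_smul b v]
      with s h1 h2 h3
    rw [h1, Pi.add_apply, h2, h3]; rfl
  rw [e]
  linear_combination (-linSol A B ζ t ω) * hab

variable {F : ℝ → ℝ → ℝ} (h2 : HypH2 T F) (h3 : HypH3 T F) (h4 : HypH4 T p F)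
  (h5 : HypH5 T F)

include hp hζ in
theorem ae_prod_good [IsProbabilityMeasure P] : ∀ᵐ q ∂(timeMeasure T).prod P,
    q.1 ∈ Ioo 0 T ∧ Integrable (fun t => ζ t q.2) (timeMeasure T) :=
  (Measure.quasiMeasurePreserving_fst.ae (ae_restrict_mem measurableSet_Ioo)).and
    (Measure.quasiMeasurePreserving_snd.ae (hζ.ae_integrable hp))

include hA hB hp hζ in
theorem measurable_gapSol [IsProbabilityMeasure P] (u : L1 T) :
    Measurable (Function.uncurry (gapSol A B ζ u)) :=
  measurable_linSol hA hB (isForcing_gap hp hζ u).meas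

include hA hB hp hζ h3 in
theorem aemeasurable_integrand [IsProbabilityMeasure P] (u : L1 T) :
    AEMeasurable (fun q : ℝ × Ω => ENNReal.ofReal (F q.1 (gapSol A B ζ u q.1 q.2)))
      ((timeMeasure T).prod P) :=
  (h3.aemeasurable_comp (measurable_gapSol hA hB hp hζ u)).ennreal_ofReal

include hA hB hp hζ h4 in
/-- Finiteness of the cost, from the growth condition and the a priori estimate. -/
theorem gapCost_lt_top [IsProbabilityMeasure P] (u : L1 T) : gapCost P A B ζ F u < ⊤ := by
  obtain ⟨α, hα, L, hL, -, hb⟩ := h4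
  obtain ⟨M, hM⟩ := exists_abs_le hA T
  have hf := isForcing_gap hp hζ u
  have key := lintegral_growth_lt_top (P := P) hp hα.1 hα.2 hL (measurable_gapSol hA hB hp hζ u)
    (ENNReal.mul_ne_top ENNReal.ofReal_ne_top hf.finite.ne)
    fun t ht => eLpNorm_linSol_le hA hB hf hM hp ht.2.le
  refine lt_of_le_of_lt (lintegral_mono_ae ?_) key
  filter_upwards [ae_prod_good hp hζ] with q hq
  refine ENNReal.ofReal_le_ofReal ?_
  have := hb q.1 (Ioo_subset_Icc_self hq.1) (gapSol A B ζ u q.1 q.2)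
  have h1 := le_abs_self (F q.1 (gapSol A B ζ u q.1 q.2))
  have h2 := abs_nonneg (deriv (F q.1) (gapSol A B ζ u q.1 q.2))
  have h3 := abs_nonneg (deriv (deriv (F q.1)) (gapSol A B ζ u q.1 q.2))
  linarith

include hA hB hp hζ h3 h5 in
/-- The state depends on the control in an affine way. -/
theorem gapCost_convex [IsProbabilityMeasure P] (u v : L1 T) (a b : ℝ) (ha : 0 ≤ a) (hb : 0 ≤ b)
    (hab : a + b = 1) : gapCost P A B ζ F (a • u + b • v) ≤
      ENNReal.ofReal a * gapCost P A B ζ F u + ENNReal.ofReal b * gapCost P A B ζ F v := by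
  unfold gapCost
  rw [← lintegral_const_mul' _ _ ENNReal.ofReal_ne_top,
    ← lintegral_const_mul' _ _ ENNReal.ofReal_ne_top,
    ← lintegral_add_left' ((aemeasurable_integrand hA hB hp hζ h3 u).const_mul _)]
  refine lintegral_mono_ae ?_
  filter_upwards [ae_prod_good hp hζ] with q hq
  rw [gapSol_combination hA hB hq.2 u v hab hq.1.2.le, ← ENNReal.ofReal_mul ha,
    ← ENNReal.ofReal_mul hb]
  exact (ENNReal.ofReal_le_ofReal ((h5 q.1 (Ioo_subset_Icc_self hq.1)).2 (mem_univ _) (mem_univ _)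
    ha hb hab)).trans ENNReal.ofReal_add_le

include hA hB hp hζ h3 in
/-- Lower semicontinuity in the norm of `L¹(0,T)`: the states converge path by path, and Fatou's
lemma applies since the integrand is nonnegative. -/
theorem gapCost_lsc [IsProbabilityMeasure P] (u : ℕ → L1 T) (v : L1 T) (c : ℝ≥0∞)
    (huv : Tendsto u atTop (𝓝 v)) (hc : ∀ n, gapCost P A B ζ F (u n) ≤ c) :
    gapCost P A B ζ F v ≤ c := by
  have hdist : Tendsto (fun n => ∫ s in Ioo 0 T, |u n s - v s|) atTop (𝓝 0) := by
    have h := (tendsto_iff_norm_sub_tendsto_zero.1 huv)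
    refine h.congr fun n => ?_
    rw [L1.norm_eq_integral_norm]
    refine integral_congr_ae ?_
    filter_upwards [Lp.coeFn_sub (u n) v] with s hs
    rw [hs, Pi.sub_apply, Real.norm_eq_abs]
  have hlim : ∀ᵐ q ∂(timeMeasure T).prod P, Tendsto
      (fun n => ENNReal.ofReal (F q.1 (gapSol A B ζ (u n) q.1 q.2))) atTop
      (𝓝 (ENNReal.ofReal (F q.1 (gapSol A B ζ v q.1 q.2)))) := by
    filter_upwards [ae_prod_good hp hζ] with q hq
    have hX : Tendsto (fun n => gapSol A B ζ (u n) q.1 q.2) atTop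
        (𝓝 (gapSol A B ζ v q.1 q.2)) := by
      obtain ⟨κ, hκ⟩ := abs_linSol_sub_le hA hB (T := T) (ω := q.2)
      refine tendsto_iff_dist_tendsto_zero.2 (squeeze_zero (fun _ => dist_nonneg) (fun n => ?_)
        (by simpa using hdist.const_mul κ))
      rw [Real.dist_eq]
      refine (hκ _ _ (hq.2.sub (integrable_coe_L1 _)) (hq.2.sub (integrable_coe_L1 _)) q.1
        (Ioo_subset_Icc_self hq.1)).trans (le_of_eq ?_)
      congr 2
      ext s
      rw [sub_sub_sub_cancel_left, abs_sub_comm]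
    exact ((ENNReal.continuous_ofReal.comp
      (h3.contDiff q.1 (Ioo_subset_Icc_self hq.1)).continuous).tendsto _).comp hX
  unfold gapCost
  calc ∫⁻ q : ℝ × Ω, ENNReal.ofReal (F q.1 (gapSol A B ζ v q.1 q.2)) ∂(timeMeasure T).prod P
      = ∫⁻ q : ℝ × Ω, liminf (fun n => ENNReal.ofReal (F q.1 (gapSol A B ζ (u n) q.1 q.2))) atTop
          ∂(timeMeasure T).prod P := by
        refine lintegral_congr_ae ?_
        filter_upwards [hlim] with q hq
        exact hq.liminf_eq.symm
    _ ≤ liminf (fun n => gapCost P A B ζ F (u n)) atTop :=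
        lintegral_liminf_le' fun n => aemeasurable_integrand hA hB hp hζ h3 (u n)
    _ ≤ c := by
        refine liminf_le_of_le ⟨0, Eventually.of_forall fun _ => zero_le⟩ fun b hb => ?_
        obtain ⟨n, hn⟩ := hb.exists
        exact hn.trans (hc n)

include hA hB hp hζ h3 h4 in
/-- The infimum of the cost does not change under restriction to bounded controls. -/
theorem exists_bounded_gapCost_lt [IsProbabilityMeasure P] (v : L1 T) (c : ℝ≥0∞)
    (hc : gapCost P A B ζ F v < c) :
    ∃ w : L1 T, gapCost P A B ζ F w < c ∧ ∃ K : ℝ, ∀ᵐ t ∂timeMeasure T, |w t| ≤ K := by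
  obtain ⟨α, hα, L, hL, hL0, hb⟩ := h4
  obtain ⟨M, hM⟩ := exists_abs_le hA T
  let w : ℕ → L1 T := fun n => (memLp_truncate (Nat.cast_nonneg n) v 1).toLp _
  have hw : ∀ n, w n =ᵐ[timeMeasure T] truncate n v := fun n => MemLp.coeFn_toLp _
  have hvabs : IsForcing 𝓕 P T p fun s _ => |v s| :=
    isForcing_of_integrable hp (measurable_coe_L1 v).abs (integrable_coe_L1 v).abs
  -- the modulus of the state is bounded by `Y`, uniformly in the level of truncation
  let Y : ℝ → Ω → ℝ := fun t ω => |linSol A B ζ t ω| + |linSol A B (fun s _ => |v s|) t ω|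
  have hYm : Measurable (Function.uncurry Y) :=
    (measurable_linSol hA hB hζ.meas).abs.add (measurable_linSol hA hB hvabs.meas).abs
  have hYfin := lintegral_growth_lt_top (P := P) hp hα.1 hα.2 hL hYm
    (N := ENNReal.ofReal (Real.exp (2 * M + (p - 1) * T / 2)) *
        (∫⁻ q in Ioo 0 T, eLpNorm (ζ q) (ENNReal.ofReal p) P) +
      ENNReal.ofReal (Real.exp (2 * M + (p - 1) * T / 2)) *
        ∫⁻ q in Ioo 0 T, eLpNorm (fun _ : Ω => |v q|) (ENNReal.ofReal p) P)
    (ENNReal.add_ne_top.2 ⟨ENNReal.mul_ne_top ENNReal.ofReal_ne_top hζ.finite.ne,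
      ENNReal.mul_ne_top ENNReal.ofReal_ne_top hvabs.finite.ne⟩) (fun t ht => by
      refine (eLpNorm_add_le (f := fun ω => |linSol A B ζ t ω|)
        (g := fun ω => |linSol A B (fun s _ => |v s|) t ω|)
        (measurable_linSol hA hB hζ.meas).of_uncurry_left.abs.aestronglyMeasurable
        (measurable_linSol hA hB hvabs.meas).of_uncurry_left.abs.aestronglyMeasurable
        (by simpa using hp)).trans (add_le_add ?_ ?_)
      · exact (eLpNorm_norm (linSol A B ζ t)).trans_le (eLpNorm_linSol_le hA hB hζ hM hp ht.2.le)
      · exact (eLpNorm_norm (linSol A B (fun s _ => |v s|) t)).trans_le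
          (eLpNorm_linSol_le hA hB hvabs hM hp ht.2.le))
  have htr : ∀ t, Tendsto (fun n : ℕ => truncate n v t) atTop (𝓝 (v t)) := by
    intro t
    refine tendsto_const_nhds.congr' ?_
    filter_upwards [eventually_ge_atTop ⌈|v t|⌉₊] with n hn
    have : |v t| ≤ n := (Nat.le_ceil _).trans (by exact_mod_cast hn)
    exact (indicator_of_mem (s := {s | |v s| ≤ (n : ℝ)}) this _).symm
  have hsol : ∀ q : ℝ × Ω, q.1 ∈ Ioo 0 T ∧ Integrable (fun t => ζ t q.2) (timeMeasure T) → ∀ n,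
      gapSol A B ζ (w n) q.1 q.2 = linSol A B ζ q.1 q.2 -
        linSol A B (fun s _ => truncate n v s) q.1 q.2 := by
    intro q hq n
    rw [gapSol_eq hA hB hq.2 _ hq.1.2.le, linSol_congr (T := T) (f := fun s _ => w n s)
      (g := fun s _ => truncate n v s) A B (hw n)
      hq.1.2.le]
  have hlimit : Tendsto (fun n => gapCost P A B ζ F (w n)) atTop (𝓝 (gapCost P A B ζ F v)) := by
    refine tendsto_lintegral_of_dominated_convergence' _
      (fun n => aemeasurable_integrand hA hB hp hζ h3 (w n)) (fun n => ?_) hYfin.ne ?_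
    · filter_upwards [ae_prod_good hp hζ] with q hq
      have hqI := Ioo_subset_Icc_self hq.1
      refine ENNReal.ofReal_le_ofReal ?_
      have h1 := le_abs_self (F q.1 (gapSol A B ζ (w n) q.1 q.2))
      have h2 := abs_nonneg (deriv (F q.1) (gapSol A B ζ (w n) q.1 q.2))
      have h3 := abs_nonneg (deriv (deriv (F q.1)) (gapSol A B ζ (w n) q.1 q.2))
      have h4 := hb q.1 hqI (gapSol A B ζ (w n) q.1 q.2)
      have h5 : |gapSol A B ζ (w n) q.1 q.2| ≤ Y q.1 q.2 := by
        rw [hsol q hq]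
        refine (abs_sub _ _).trans (add_le_add le_rfl ?_)
        refine le_trans ?_ (le_abs_self _)
        unfold linSol
        rw [← Real.norm_eq_abs]
        refine norm_integral_le_of_norm_le
          (integrableOn_Ioc_kernel_mul (ω := q.2) (f := fun s _ => |v s|) hA hB
            (integrable_coe_L1 v).abs hq.1.2.le)
          (Eventually.of_forall fun s => ?_)
        rw [norm_mul, Real.norm_eq_abs, Real.norm_eq_abs, abs_of_pos (kernel_pos _ _ _ _ _)]
        exact mul_le_mul_of_nonneg_left (abs_truncate_le_abs v s) (kernel_pos _ _ _ _ _).le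
      have h6 : |gapSol A B ζ (w n) q.1 q.2| ^ α ≤ |Y q.1 q.2| ^ α :=
        Real.rpow_le_rpow (abs_nonneg _) (h5.trans (le_abs_self _)) hα.1.le
      have h7 := mul_le_mul_of_nonneg_left (add_le_add_right h6 1) (hL0 q.1 hqI)
      linarith
    · filter_upwards [ae_prod_good hp hζ] with q hq
      refine ((ENNReal.continuous_ofReal.comp
        (h3.contDiff q.1 (Ioo_subset_Icc_self hq.1)).continuous).tendsto _).comp ?_
      rw [gapSol_eq hA hB hq.2 _ hq.1.2.le]
      simp only [hsol q hq]
      refine tendsto_const_nhds.sub ?_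
      unfold linSol
      refine tendsto_integral_of_dominated_convergence
        (fun s => kernel A B s q.1 q.2 * |v s|)
        (fun n => ((continuous_kernel_left hA hB q.1 q.2).measurable.mul
          (measurable_truncate _ v)).aestronglyMeasurable)
        (integrableOn_Ioc_kernel_mul (ω := q.2) (f := fun s _ => |v s|) hA hB
            (integrable_coe_L1 v).abs hq.1.2.le)
        (fun n => Eventually.of_forall fun s => ?_)
        (Eventually.of_forall fun s => (htr s).const_mul _)
      rw [norm_mul, Real.norm_eq_abs, Real.norm_eq_abs, abs_of_pos (kernel_pos _ _ _ _ _)]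
      exact mul_le_mul_of_nonneg_left (abs_truncate_le_abs v s) (kernel_pos _ _ _ _ _).le
  obtain ⟨n, hn⟩ := (hlimit.eventually (gt_mem_nhds hc)).exists
  refine ⟨w n, hn, n, ?_⟩
  filter_upwards [hw n] with t ht
  rw [ht]
  exact abs_truncate_le (Nat.cast_nonneg n) v t

include hA hB hp hζ h2 h3 h4 in
/-- Different controls produce states that differ on a set of positive measure, where strict
convexity of the integrand gives a gain. -/
theorem gapCost_strict [IsProbabilityMeasure P] (h6 : HypH5plus T F) (u v : L1 T) (huv : u ≠ v) :
    gapCost P A B ζ F ((1 / 2 : ℝ) • u + (1 / 2 : ℝ) • v) <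
      (gapCost P A B ζ F u + gapCost P A B ζ F v) / 2 := by
  have hhalf : ENNReal.ofReal (1 / 2) = 2⁻¹ := by
    rw [one_div, ENNReal.ofReal_inv_of_pos two_pos]; simp
  have hmu := aemeasurable_integrand hA hB hp hζ h3 u
  have hmv := aemeasurable_integrand hA hB hp hζ h3 v
  have e : (gapCost P A B ζ F u + gapCost P A B ζ F v) / 2 = ∫⁻ q : ℝ × Ω,
      (ENNReal.ofReal (F q.1 (gapSol A B ζ u q.1 q.2)) +
        ENNReal.ofReal (F q.1 (gapSol A B ζ v q.1 q.2))) * 2⁻¹ ∂(timeMeasure T).prod P := by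
    rw [lintegral_mul_const' _ _ (by simp), lintegral_add_left' hmu, ENNReal.div_eq_inv_mul,
      mul_comm]
    rfl
  have hpt : ∀ q : ℝ × Ω, q.1 ∈ Ioo 0 T ∧ Integrable (fun t => ζ t q.2) (timeMeasure T) →
      (ENNReal.ofReal (F q.1 (gapSol A B ζ u q.1 q.2)) +
        ENNReal.ofReal (F q.1 (gapSol A B ζ v q.1 q.2))) * 2⁻¹ =
      ENNReal.ofReal (1 / 2 * F q.1 (gapSol A B ζ u q.1 q.2) +
        1 / 2 * F q.1 (gapSol A B ζ v q.1 q.2)) := by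
    intro q hq
    have hqI := Ioo_subset_Icc_self hq.1
    rw [← mul_add, ENNReal.ofReal_mul (by norm_num), hhalf,
      ENNReal.ofReal_add (h2 _ hqI _) (h2 _ hqI _), mul_comm]
  have hsum : (1 / 2 : ℝ) + 1 / 2 = 1 := by norm_num
  rw [e]
  unfold gapCost
  refine lintegral_strict_mono_of_ae_le_of_ae_lt_on ((hmu.add hmv).mul_const _)
    (gapCost_lt_top hA hB hp hζ h4 _).ne ?_
    (s := {q : ℝ × Ω | gapSol A B ζ u q.1 q.2 ≠ gapSol A B ζ v q.1 q.2}) ?_ ?_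
  · filter_upwards [ae_prod_good hp hζ] with q hq
    rw [hpt q hq, gapSol_combination hA hB hq.2 u v hsum hq.1.2.le]
    exact ENNReal.ofReal_le_ofReal ((h6 q.1 (Ioo_subset_Icc_self hq.1)).convexOn.2 (mem_univ _)
      (mem_univ _) (by norm_num) (by norm_num) hsum)
  · intro h0
    refine huv (Lp.ext ?_)
    have h7 : ∀ᵐ q ∂(timeMeasure T).prod P,
        gapSol A B ζ u q.1 q.2 = gapSol A B ζ v q.1 q.2 := by
      rw [ae_iff]; exact h0
    -- a single path suffices to recover the difference of the controls
    obtain ⟨ω, h8, hω⟩ := ((ae_ae_swap_of_ae_prod h7).and (hζ.ae_integrable hp)).exists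
    have h9 : ∀ᵐ t ∂timeMeasure T, linSol A B (fun s (_ : Ω) => u s - v s) t ω = 0 := by
      filter_upwards [h8, ae_restrict_mem measurableSet_Ioo] with t h8 ht
      simp only [gapSol_eq hA hB hω _ ht.2.le] at h8
      rw [linSol_sub hA hB (integrable_coe_L1 u) (integrable_coe_L1 v) ht.2.le]
      linarith
    filter_upwards [ae_eq_zero_of_linSol_eq_zero hA hB
      (f := fun s (_ : Ω) => u s - v s) ((integrable_coe_L1 u).sub (integrable_coe_L1 v)) h9]
      with t ht
    exact sub_eq_zero.1 ht
  · filter_upwards [ae_prod_good hp hζ] with q hq hne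
    have hqI := Ioo_subset_Icc_self hq.1
    rw [hpt q hq, gapSol_combination hA hB hq.2 u v hsum hq.1.2.le]
    have hlt := (h6 q.1 hqI).2 (mem_univ _) (mem_univ _) hne (by norm_num : (0 : ℝ) < 1 / 2)
      (by norm_num : (0 : ℝ) < 1 / 2) hsum
    exact (ENNReal.ofReal_lt_ofReal_iff_of_nonneg (h2 _ hqI _)).2 hlt

end

/-! ### Identification of the cost -/

/-- A process of class `𝓛²_p` has a jointly measurable modification that is a forcing term; it
remains adapted at almost every time. -/
theorem MemL2p.exists_isForcing [IsProbabilityMeasure P] {T p : ℝ} {z : ℝ → Ω → ℝ}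
    (hz : MemL2p 𝓕 P T p z) : ∃ ζ : ℝ → Ω → ℝ, IsForcing 𝓕 P T p ζ ∧
      ∀ᵐ q ∂(timeMeasure T).prod P, ζ q.1 q.2 = z q.1 q.2 := by
  have hae := hz.measurable.ae_eq_mk
  have hae' : ∀ᵐ t ∂timeMeasure T, z t =ᵐ[P] fun ω => hz.measurable.mk _ (t, ω) :=
    Measure.ae_ae_of_ae_prod hae
  refine ⟨fun t ω => hz.measurable.mk _ (t, ω), ⟨hz.measurable.stronglyMeasurable_mk.measurable,
    ?_, ?_⟩, ?_⟩
  · filter_upwards [hae', ae_restrict_mem measurableSet_Ioo] with t h1 ht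
    exact (hz.adapted t (Ioo_subset_Icc_self ht)).congr h1
  · have hle : ∀ᵐ t ∂timeMeasure T,
        eLpNorm (fun ω => hz.measurable.mk _ (t, ω)) (ENNReal.ofReal p) P ≤
          1 + eLpNorm (z t) (ENNReal.ofReal p) P ^ 2 := by
      filter_upwards [hae'] with t h1
      rw [← eLpNorm_congr_ae h1]
      rcases le_total (eLpNorm (z t) (ENNReal.ofReal p) P) 1 with h | h
      · exact h.trans le_self_add
      · exact (le_self_pow h two_ne_zero).trans le_add_self
    refine lt_of_le_of_lt (lintegral_mono_ae hle) ?_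
    rw [lintegral_add_left measurable_const, setLIntegral_const, Real.volume_Ioo, one_mul]
    exact ENNReal.add_lt_top.2 ⟨ENNReal.ofReal_lt_top, hz.norm_lt_top⟩
  · filter_upwards [hae] with q hq
    exact hq.symm

/-- Every essentially bounded coefficient agrees almost everywhere with a measurable function that
is bounded everywhere, for which the primitive is Lipschitz. -/
theorem exists_bounded_version {T : ℝ} {a : ℝ → ℝ} (ha : MemLp a ⊤ (timeMeasure T)) :
    ∃ (a' : ℝ → ℝ) (K : ℝ≥0), Measurable a' ∧ (∀ s, |a' s| ≤ K) ∧ a' =ᵐ[timeMeasure T] a := by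
  obtain ⟨K, hK, hb⟩ := exists_ae_abs_le ha
  have hm := ha.1.stronglyMeasurable_mk.measurable
  refine ⟨fun s => max (-K) (min K (ha.1.mk a s)), ⟨K, hK.le⟩,
    measurable_const.max (measurable_const.min hm), fun s => ?_, ?_⟩
  · exact abs_le.2 ⟨le_max_left _ _, max_le (by simpa using by linarith) (min_le_left _ _)⟩
  · filter_upwards [hb, ha.1.ae_eq_mk] with s h1 h2
    rw [← h2, min_eq_right (abs_le.1 h1).2, max_eq_right (abs_le.1 h1).1]

/-- Two processes with continuous paths that agree almost surely at each time are
indistinguishable. -/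
theorem ae_forall_eq_of_forall_ae_eq {T : ℝ} (hT : 0 < T) {X Y : ℝ → Ω → ℝ}
    (hX : ∀ᵐ ω ∂P, ContinuousOn (fun t => X t ω) (Icc 0 T))
    (hY : ∀ᵐ ω ∂P, ContinuousOn (fun t => Y t ω) (Icc 0 T))
    (h : ∀ t ∈ Icc 0 T, X t =ᵐ[P] Y t) : ∀ᵐ ω ∂P, ∀ t ∈ Icc 0 T, X t ω = Y t ω := by
  have hq : ∀ᵐ ω ∂P, ∀ r : ℚ, (r : ℝ) ∈ Icc 0 T → X r ω = Y r ω :=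
    ae_all_iff.2 fun r => by
      by_cases hr : (r : ℝ) ∈ Icc 0 T
      · filter_upwards [h r hr] with ω hω _ using hω
      · exact Eventually.of_forall fun ω h => absurd h hr
  filter_upwards [hX, hY, hq] with ω h1 h2 h3
  have hcl : Icc 0 T ⊆ closure (Ioo 0 T ∩ range ((↑) : ℚ → ℝ)) := by
    rw [← closure_Ioo hT.ne]
    exact closure_minimal (Rat.denseRange_cast.open_subset_closure_inter isOpen_Ioo)
      isClosed_closure
  refine Set.EqOn.of_subset_closure ?_ h1 h2 (fun t ht => Ioo_subset_Icc_self ht.1) hcl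
  rintro _ ⟨hr, r, rfl⟩
  exact h3 r (Ioo_subset_Icc_self hr)

/-- The solution map picks the explicit solution, up to indistinguishability, and the cost is that
of the explicit solution. -/
theorem cost_eq_gapCost [IsProbabilityMeasure P] (hB : IsContinuousVersion 𝓕 P W B) {T : ℝ}
    (hT : 0 < T) {a : ℝ → ℝ} (ha : MemLp a ⊤ (timeMeasure T)) {a' : ℝ → ℝ} {K : ℝ≥0}
    (ham : Measurable a') (haK : ∀ s, |a' s| ≤ K) (haa : a' =ᵐ[timeMeasure T] a)
    {A : ℝ → ℝ} (hA : A = fun t => ∫ s in (0 : ℝ)..t, a' s) {p : ℝ} (hp : 2 ≤ p)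
    {z ζ : ℝ → Ω → ℝ} (hζ : IsForcing 𝓕 P T p ζ)
    (hzζ : ∀ᵐ q ∂(timeMeasure T).prod P, ζ q.1 q.2 = z q.1 q.2) {F : ℝ → ℝ → ℝ} (h3 : HypH3 T F)
    (u : L1 T) : cost 𝓕 P W T a z F u = gapCost P A B ζ F u := by
  have hAc : Continuous A := hA ▸ (lipschitzWith_primitive ham haK).continuous
  have hp1 : 1 ≤ p := one_le_two.trans hp
  have hf := (isForcing_gap hp1 hζ u).mono_exponent hp
  have hsol : IsSolution 𝓕 P W T a 0 (fun t ω => z t ω - u t) (gapSol A B ζ u) := by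
    refine (isSolution_linSol hB hf hT ham haK hA).congr haa ?_
    filter_upwards [hzζ] with q hq
    rw [hq]
  have hex : ∃ X, IsSolution 𝓕 P W T a 0 (fun t ω => z t ω - u t) X := ⟨_, hsol⟩
  have hgap : IsSolution 𝓕 P W T a 0 (fun t ω => z t ω - u t) (gap 𝓕 P W T a z u) := by
    unfold gap solutionMap
    rw [dif_pos hex]
    exact hex.choose_spec
  have hind := ae_forall_eq_of_forall_ae_eq hT hgap.cont hsol.cont (hgap.ae_eq hB ha hsol)
  unfold cost gapCost
  rw [lintegral_prod_symm _ (aemeasurable_integrand hAc hB hp1 hζ h3 u)]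
  refine lintegral_congr_ae ?_
  filter_upwards [hind] with ω hω
  refine setLIntegral_congr_fun measurableSet_Ioo fun t ht => ?_
  simp only [hω t (Ioo_subset_Icc_self ht)]

end LinearSDE

theorem mainTheorem5 {Ω : Type*} [mΩ : MeasurableSpace Ω] (P : Measure Ω)
    [IsProbabilityMeasure P] (𝓕 : Filtration ℝ≥0 mΩ) (W : ℝ≥0 → Ω → ℝ)
    (hW : LinearSDE.IsFilteredBrownian 𝓕 P W)
    (T : ℝ) (hT : 0 < T)
    (a : ℝ → ℝ) (ha : MemLp a ⊤ (LinearSDE.timeMeasure T))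
    (p : ℝ) (hp : 2 ≤ p) (z : ℝ → Ω → ℝ) (h1 : LinearSDE.MemL2p 𝓕 P T p z)
    (F : ℝ → ℝ → ℝ) (h2 : LinearSDE.HypH2 T F) (h3 : LinearSDE.HypH3 T F)
    (h4 : LinearSDE.HypH4 T p F) (h5 : LinearSDE.HypH5 T F)
    (J : LinearSDE.L1 T → ℝ≥0∞) (hJ : J = LinearSDE.cost 𝓕 P W T a z F)
    (Ψ₁ Ψ₂ : ℝ → ℝ) (hΨ₁ : LinearSDE.IsYoung Ψ₁) (hΨ₂ : LinearSDE.IsYoung Ψ₂)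
    (hΔ₁ : LinearSDE.Delta2 Ψ₁) (hΔ₂ : LinearSDE.Delta2 Ψ₂)
    (C δ₀ : ℝ) (hC : 0 < C) (hδ₀ : 0 < δ₀)
    (u : ℝ → LinearSDE.L1 T)
    (hu : ∀ δ ∈ Ioo 0 δ₀, LinearSDE.IsPenalizedMinimizer T J δ Ψ₁ (u δ))
    (hbound : ∀ δ ∈ Ioo 0 δ₀, LinearSDE.modular T Ψ₂ (u δ) ≤ ENNReal.ofReal C) :
    (∃ ū : LinearSDE.L1 T, J ū = (⨅ v, J v) ∧ J ū < ⊤) ∧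
    (∀ δ : ℕ → ℝ, (∀ n, 0 < δ n) → Tendsto δ atTop (𝓝 0) →
      ∃ φ : ℕ → ℕ, StrictMono φ ∧ ∃ ū : LinearSDE.L1 T, J ū = (⨅ v, J v) ∧
        Tendsto (fun n => toWeakSpace ℝ (LinearSDE.L1 T) (u (δ (φ n)))) atTop
          (𝓝 (toWeakSpace ℝ (LinearSDE.L1 T) ū))) ∧
    (LinearSDE.HypH5plus T F →
      (∃! ū : LinearSDE.L1 T, J ū = (⨅ v, J v)) ∧
      ∀ ū : LinearSDE.L1 T, J ū = (⨅ v, J v) →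
        Tendsto (fun δ => toWeakSpace ℝ (LinearSDE.L1 T) (u δ)) (𝓝[>] 0)
          (𝓝 (toWeakSpace ℝ (LinearSDE.L1 T) ū))) := by
  obtain ⟨B, hB⟩ := LinearSDE.exists_isContinuousVersion hW
  obtain ⟨a', K, ham, haK, haa⟩ := LinearSDE.exists_bounded_version ha
  obtain ⟨ζ, hζ, hzζ⟩ := h1.exists_isForcing
  obtain ⟨A, hA⟩ : ∃ A : ℝ → ℝ, A = fun t => ∫ s in (0 : ℝ)..t, a' s := ⟨_, rfl⟩
  have hAc : Continuous A := hA ▸ (LinearSDE.lipschitzWith_primitive ham haK).continuous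
  have hp1 : 1 ≤ p := one_le_two.trans hp
  have hJ' : J = LinearSDE.gapCost P A B ζ F := by
    rw [hJ]
    exact funext fun v => LinearSDE.cost_eq_gapCost hB hT ha ham haK haa hA hp hζ hzζ h3 v
  subst hJ'
  exact LinearSDE.penalized_minimizers_converge hΨ₁ hΨ₂
    (LinearSDE.gapCost_lt_top hAc hB hp1 hζ h4)
    (LinearSDE.gapCost_convex hAc hB hp1 hζ h3 h5)
    (LinearSDE.gapCost_lsc hAc hB hp1 hζ h3)
    (LinearSDE.exists_bounded_gapCost_lt hAc hB hp1 hζ h3 h4)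
    hC hδ₀ hu hbound (LinearSDE.gapCost_strict hAc hB hp1 hζ h2 h3 h4)
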